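/- **Setting.** Write $J=\begin{pmatrix}0&-I_n\\ I_n&0\end{pmatrix}$, let $\omega_0$ be the standard symplectic form on $\mathbb R^{2n}$, extended bilinearly to $\mathbb C^{2n}$ by $\omega_0(\xi,\eta)=(-J\xi)^T\eta$, and let $\mathcal P(2n,\mathbb R)$ be the set of all continuous paths $\Phi:[0,1]\to Sp(2n,\mathbb R)$, with arbitrary endpoints ($n\ge 0$). *The map $\rho$ and the rotation number.* Let $M\in Sp(2n,\mathbb R)$. For an eigenvalue $\lambda\ne\pm1$ with $|\lambda|=1$ let $m^+(\lambda)$ be the maximal complex dimension of a subspace of the generalized eigenspace of $\lambda$ in $\mathbb C^{2n}$ on which $\xi\mapsto \operatorname{Im}\omega_0(\bar\xi,\xi)$ is positive definite. Let $m_0$ be the number of pairs $\{\lambda,\lambda^{-1}\}$ of negative real eigenvalues, with multiplicity, and put $$\rho(M)=(-1)^{m_0}\prod_{|\lambda|=1,\ \lambda\neq\pm1}\lambda^{m^+(\lambda)}.$$ The $n$ eigenvalues of the first kind of $M$ are the $\lambda$ with $|\lambda|<1$ (with algebraic multiplicity), the $\lambda\neq\pm1$ with $|\lambda|=1$ (with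 multiplicity $m^+(\lambda)$), and $\pm1$ (with half the algebraic multiplicity). For a symplectic path $\Phi$ let $\Delta(\Phi)=\alpha(1)-\alpha(0)$, where $\alpha:[0,1]\to\mathbb R$ is continuous and $\rho(\Phi(t))=e^{i\pi\alpha(t)}$. *Construction of the index.* For $a\in\mathbb R^n$ let $R(a)\in Sp(2n,\mathbb R)$ be the rotation by $a_j$ in each plane $(x_j,y_j)$, that is, with blocks $\begin{pmatrix}\cos a_j&-\sin a_j\\ \sin a_j&\cos a_j\end{pmatrix}$. A normal form of $M$ is a matrix $R(a)$ such that the $e^{ia_j}$, with multiplicity, are the numbers $\lambda/|\lambda|$, $\lambda$ running through the eigenvalues of the first kind of $M$. * An *orthogonalization* $\Phi^\#$ of $\Phi$ is the catenation, over the three thirds of $[0,1]$, of a path from a normal form of $\Phi(0)$ to $\Phi(0)$, of $\Phi$, and of a path from $\Phi(1)$ to a normal form of $\Phi(1)$, where the two added paths have rotation number $0$. * Its *global perturbation* is $\Phi^\#_\theta(t)=e^{-\theta J}\Phi^\#(t)$, $\theta\ge0$. * Let $\mathscr C=\{M\in Sp(2n,\mathbb R): M \text{ has an eigenvalue } 1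 \text{ or } -1\}=Sp_1\cup Sp_{-1}$, and suppose that $A=\Phi^\#_\theta(0)=R(a)$ and $B=\Phi^\#_\theta(1)=R(b)$ are not in $\mathscr C$. Let $W_{A,B}=R(w)$, where $w_j=a_j$ if $\sin a_j\sin b_j>0$ and $w_j=a_j+\pi$ if $\sin a_j\sin b_j<0$. An *extension* is a continuous path $\beta:[0,1]\to Sp(2n,\mathbb R)\setminus\mathscr C$ with $\beta(0)=B$ and $\beta(1)=W_{A,B}$. **Theorem.** To every $n$ and every $\Phi\in\mathcal P(2n,\mathbb R)$ one can assign a number $\mu(\Phi)$ with the following properties. 1. $\mu(\Phi)$ is an integer. 2. (Construction and independence of choices.) $\Phi$ has an orthogonalization, and there is $\varepsilon>0$ such that for all $0\le\theta<\varepsilon$ and every orthogonalization $\Phi^\#$ of $\Phi$: if $\theta>0$, then $\Phi^\#_\theta(0),\Phi^\#_\theta(1)\notin\mathscr C$; and whenever $\Phi^\#_\theta(0),\Phi^\#_\theta(1)\notin\mathscr C$, an extension exists, the rotation numbers below are defined, and for every extension $\beta$ $$\mu(\Phi)=\Delta(\Phi^\#_\theta)+\Delta(\beta).$$ 3. If $\Phi,\Psi\in\mathcal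 P(2n,\mathbb R)$ are homotopic with fixed endpoints, then $\mu(\Phi)=\mu(\Psi)$. 4. For all $0<a<1$, $\mu(\Phi)=\mu(\Phi|_{[0,a]})+\mu(\Phi|_{[a,1]})$, where the two restrictions are reparametrized linearly by $[0,1]$. 5. If $(\mathbb R^{2n},\omega_0)=(V_1\oplus V_2,\omega_1\oplus\omega_2)$ is a direct sum of $\omega_0$-orthogonal subspaces, and $\Phi(t)(z_1,z_2)=(\Phi_1(t)z_1,\Phi_2(t)z_2)$ with paths $\Phi_j$ in $Sp(V_j,\omega_j)$, then $\mu(\Phi)=\mu(\Phi_1)+\mu(\Phi_2)$, where $\mu(\Phi_j)$ is computed in any linear symplectic coordinates $V_j\cong\mathbb R^{2n_j}$. -/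

import Mathlib

open Matrix

noncomputable section

namespace MaslovType

/-- `Sp(2n, ℝ)`, with the topology induced from real matrices. Coordinates are indexed by
`Fin n ⊕ Fin n`, i.e. `(x₁, …, xₙ, y₁, …, yₙ)`. -/
abbrev Sp (n : ℕ) : Type := Matrix.symplecticGroup (Fin n) ℝ

/-- The continuous paths `[0,1] → Sp(2n, ℝ)`, with arbitrary endpoints. -/
abbrev SpPath (n : ℕ) : Type := C(unitInterval, Sp n)

/-- The form `(ξ, η) ↦ (J₀ ξ)ᵀ η`, where `J₀ = [[0, I], [-I, 0]]`
(the matrix `Matrix.J` of Mathlib is `-J₀ = [[0, -I], [I, 0]]`). It is bilinear also over `ℂ`. -/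
def omega0 {n : ℕ} {R : Type*} [CommRing R] (ξ η : Fin n ⊕ Fin n → R) : R :=
  ((-Matrix.J (Fin n) R) *ᵥ ξ) ⬝ᵥ η

/-! ### Eigenvalues of the first kind and the map `ρ` -/

/-- A real symplectic matrix, viewed as a complex matrix. -/
def toComplex {n : ℕ} (M : Sp n) : Matrix (Fin n ⊕ Fin n) (Fin n ⊕ Fin n) ℂ :=
  (M : Matrix (Fin n ⊕ Fin n) (Fin n ⊕ Fin n) ℝ).map (fun x : ℝ => (x : ℂ))

/-- The complex eigenvalues of `M`, repeated according to algebraic multiplicity. -/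
def eigenvalues {n : ℕ} (M : Sp n) : Multiset ℂ := (toComplex M).charpoly.roots

/-- The generalized eigenspace of `M` in `ℂ²ⁿ`. -/
def genEigenspace {n : ℕ} (M : Sp n) (z : ℂ) : Submodule ℂ (Fin n ⊕ Fin n → ℂ) :=
  Module.End.maxGenEigenspace (Matrix.toLin' (toComplex M)) z

/-- The quadratic form `Q(ξ, ξ) = Im ω₀(ξ̄, ξ)`. -/
def kreinForm {n : ℕ} (ξ : Fin n ⊕ Fin n → ℂ) : ℝ := (omega0 (star ξ) ξ).im

/-- `m⁺(z)`: the complex dimension (that is, half the real dimension) of a maximal subspace of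
the generalized eigenspace on which `Q` is positive definite. Since `Q(iξ, iξ) = Q(ξ, ξ)`, a maximal
positive subspace can be taken to be complex. -/
def mPlus {n : ℕ} (M : Sp n) (z : ℂ) : ℕ :=
  sSup {k : ℕ | ∃ W : Submodule ℂ (Fin n ⊕ Fin n → ℂ), W ≤ genEigenspace M z ∧
    (∀ ξ ∈ W, ξ ≠ 0 → 0 < kreinForm ξ) ∧ Module.finrank ℂ W = k}

/-- The multiplicity of `z` as an eigenvalue of the first kind of `M`, so that there are `n` of them
altogether: the eigenvalues inside the unit disc count with their algebraic multiplicity, those on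
the unit circle other than `±1` with `m⁺`, and for `±1` the pairs `{z, z⁻¹}` are counted. -/
def firstKindMult {n : ℕ} (M : Sp n) (z : ℂ) : ℕ :=
  if z = 1 ∨ z = -1 then (eigenvalues M).count z / 2
  else if ‖z‖ = 1 then mPlus M z
  else if ‖z‖ < 1 then (eigenvalues M).count z
  else 0

/-- The multiset of the `z / |z|`, where `z` runs through the eigenvalues of the first kind. -/
def normalizedFirstKind {n : ℕ} (M : Sp n) : Multiset ℂ :=
  ∑ z ∈ (eigenvalues M).toFinset, Multiset.replicate (firstKindMult M z) (z / (‖z‖ : ℂ))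

/-- `m₀`: the number of pairs `{z, z⁻¹}` of negative real eigenvalues. -/
def mZero {n : ℕ} (M : Sp n) : ℕ :=
  ((eigenvalues M).filter (fun z => z.im = 0 ∧ z.re < 0)).card / 2

/-- The Salamon-Zehnder map `ρ(M) = (-1)^{m₀} ∏ z^{m⁺(z)}`, the product being over the eigenvalues
on the unit circle other than `±1`. -/
def rho {n : ℕ} (M : Sp n) : ℂ :=
  (-1) ^ mZero M *
    ∏ z ∈ (eigenvalues M).toFinset.filter (fun z => ‖z‖ = 1 ∧ z ≠ 1 ∧ z ≠ -1), z ^ mPlus M z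

/-- `Δ(Φ) = d`: the rotation number of `Φ` is `α(1) - α(0)`, where `α` is a continuous real function
with `ρ(Φ(t)) = e^{iπα(t)}`. -/
def HasRotationNumber {n : ℕ} (Φ : SpPath n) (d : ℝ) : Prop :=
  ∃ α : C(unitInterval, ℝ),
    (∀ t, rho (Φ t) = Complex.exp (Complex.I * Real.pi * (α t : ℂ))) ∧ α 1 - α 0 = d

/-! ### Paths -/

/-- `Φ([a,b])`, the piece of `Φ` between the times `a` and `b`, reparametrized linearly by `[0,1]`.
(For `a, b ∈ [0,1]` the projection `Set.projIcc` to `[0,1]` does nothing.) -/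
def piece {n : ℕ} (Φ : SpPath n) (a b : ℝ) : SpPath n where
  toFun t := Φ (Set.projIcc 0 1 zero_le_one ((1 - (t : ℝ)) * a + (t : ℝ) * b))
  continuous_toFun := by fun_prop

/-- The matrix with rotation blocks `[[cos aⱼ, -sin aⱼ], [sin aⱼ, cos aⱼ]]` in the coordinate planes
`(xⱼ, yⱼ)`. -/
def blockRotation {n : ℕ} (a : Fin n → ℝ) : Matrix (Fin n ⊕ Fin n) (Fin n ⊕ Fin n) ℝ :=
  Matrix.fromBlocks
    (Matrix.diagonal fun j => Real.cos (a j)) (-Matrix.diagonal fun j => Real.sin (a j))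
    (Matrix.diagonal fun j => Real.sin (a j)) (Matrix.diagonal fun j => Real.cos (a j))

/-- `O` is an orthogonal normal form of `M`: a block rotation by angles `aⱼ`, where the `e^{i aⱼ}`
are the normalized first kind eigenvalues of `M` (with multiplicity, listed in any order). -/
def IsNormalForm {n : ℕ} (M O : Sp n) : Prop :=
  ∃ a : Fin n → ℝ,
    (O : Matrix (Fin n ⊕ Fin n) (Fin n ⊕ Fin n) ℝ) = blockRotation a ∧
    Multiset.map (fun j => Complex.exp (Complex.I * (a j : ℂ))) Finset.univ.val =
      normalizedFirstKind M

/-- `Ψ` is an orthogonalization `Φ^#` of `Φ`: the catenation, over the three thirds of `[0,1]`, of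
a path from a normal form of `Φ(0)` to `Φ(0)`, of `Φ`, and of a path from `Φ(1)` to a normal form of
`Φ(1)`, where the two added paths have rotation number `0`. -/
def IsOrthogonalization {n : ℕ} (Φ Ψ : SpPath n) : Prop :=
  piece Ψ (1 / 3) (2 / 3) = Φ ∧
  IsNormalForm (Φ 0) (Ψ 0) ∧ HasRotationNumber (piece Ψ 0 (1 / 3)) 0 ∧
  IsNormalForm (Φ 1) (Ψ 1) ∧ HasRotationNumber (piece Ψ (2 / 3) 1) 0

/-! ### Perturbation and extension -/

theorem exp_smul_J_mem (n : ℕ) (s : ℝ) :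
    NormedSpace.exp (s • Matrix.J (Fin n) ℝ) ∈ Matrix.symplecticGroup (Fin n) ℝ := by
  have hc : Matrix.J (Fin n) ℝ * (s • Matrix.J (Fin n) ℝ) * (Matrix.J (Fin n) ℝ)⁻¹ =
      s • Matrix.J (Fin n) ℝ := by
    rw [Matrix.mul_smul, Matrix.smul_mul, Matrix.mul_nonsing_inv_cancel_right _ _
      (Matrix.isUnit_det_J (Fin n) ℝ)]
  have hconj := Matrix.exp_conj (Matrix.J (Fin n) ℝ) (s • Matrix.J (Fin n) ℝ)
    ((Matrix.isUnit_iff_isUnit_det _).2 (Matrix.isUnit_det_J (Fin n) ℝ))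
  rw [hc] at hconj
  have hcomm : NormedSpace.exp (s • Matrix.J (Fin n) ℝ) * Matrix.J (Fin n) ℝ =
      Matrix.J (Fin n) ℝ * NormedSpace.exp (s • Matrix.J (Fin n) ℝ) := by
    conv_lhs => rw [hconj]
    rw [Matrix.nonsing_inv_mul_cancel_right _ _ (Matrix.isUnit_det_J (Fin n) ℝ)]
  have ht : (NormedSpace.exp (s • Matrix.J (Fin n) ℝ))ᵀ =
      (NormedSpace.exp (s • Matrix.J (Fin n) ℝ))⁻¹ := by
    rw [← Matrix.exp_transpose, Matrix.transpose_smul, Matrix.J_transpose, smul_neg,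
      Matrix.exp_neg]
  rw [SymplecticGroup.mem_iff, ht, hcomm, Matrix.mul_nonsing_inv_cancel_right]
  exact (Matrix.isUnit_iff_isUnit_det _).1 (Matrix.isUnit_exp _)

/-- The rotation `e^{-θJ}`, `J = [[0, -I], [I, 0]]`. -/
def rotation (n : ℕ) (θ : ℝ) : Sp n :=
  ⟨NormedSpace.exp ((-θ) • Matrix.J (Fin n) ℝ), exp_smul_J_mem n (-θ)⟩

/-- The global perturbation `t ↦ e^{-θJ} Ψ(t)`. -/
def perturb {n : ℕ} (θ : ℝ) (Ψ : SpPath n) : SpPath n where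
  toFun t := rotation n θ * Ψ t
  continuous_toFun := by fun_prop

/-- The degenerate cycle `Sp₁ ∪ Sp₋₁`: the symplectic matrices with an eigenvalue `1` or `-1`. -/
def cycle (n : ℕ) : Set (Sp n) :=
  {M | (1 - (M : Matrix (Fin n ⊕ Fin n) (Fin n ⊕ Fin n) ℝ)).det = 0 ∨
    (-1 - (M : Matrix (Fin n ⊕ Fin n) (Fin n ⊕ Fin n) ℝ)).det = 0}

/-- `W = W_{A,B}` for block rotations `A`, `B` without eigenvalues `±1`: the `j`-th block of `W` is
`Aⱼ` if the first kind eigenvalues `e^{i aⱼ}` and `e^{i bⱼ}` of the `j`-th blocks of `A` and `B` lie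
in the same open half plane `± Im > 0`, and `-Aⱼ` if they lie in opposite ones. -/
def IsTarget {n : ℕ} (A B W : Sp n) : Prop :=
  ∃ a b w : Fin n → ℝ,
    (A : Matrix (Fin n ⊕ Fin n) (Fin n ⊕ Fin n) ℝ) = blockRotation a ∧
    (B : Matrix (Fin n ⊕ Fin n) (Fin n ⊕ Fin n) ℝ) = blockRotation b ∧
    (W : Matrix (Fin n ⊕ Fin n) (Fin n ⊕ Fin n) ℝ) = blockRotation w ∧
    ∀ j, (0 < Real.sin (a j) * Real.sin (b j) ∧ w j = a j) ∨
      (Real.sin (a j) * Real.sin (b j) < 0 ∧ w j = a j + Real.pi)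

/-- `β` is an extension of `Ψ` (an orthogonalized and perturbed path with endpoints off the cycle):
a path off the cycle from `B = Ψ(1)` to `W_{A,B}`, where `A = Ψ(0)`. -/
def IsExtension {n : ℕ} (Ψ β : SpPath n) : Prop :=
  (∀ t, β t ∉ cycle n) ∧ β 0 = Ψ 1 ∧ IsTarget (Ψ 0) (Ψ 1) (β 1)

end MaslovType

end

noncomputable section

namespace MaslovType

open Module

/-! ### The positive index of a quadratic form on a subspace -/

section PosIndex

variable {V : Type*} [AddCommGroup V] [Module ℂ V]

/-- `q` is positive definite on `W`. -/
def PosOn (q : V → ℝ) (W : Submodule ℂ V) : Prop := ∀ ξ ∈ W, ξ ≠ 0 → 0 < q ξ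

/-- The maximal dimension of a complex subspace of `E` on which `q` is positive definite. -/
def posIndex (q : V → ℝ) (E : Submodule ℂ V) : ℕ :=
  sSup {k : ℕ | ∃ W : Submodule ℂ V, W ≤ E ∧ PosOn q W ∧ finrank ℂ W = k}

/-- Sylvester's law of inertia holds without null part for `q` on `E`. -/
def IsSylvester (q : V → ℝ) (E : Submodule ℂ V) : Prop :=
  posIndex q E + posIndex (-q) E = finrank ℂ E

/-! ### Hermitian forms -/

/-- The form `B` is Hermitian. -/
def IsHerm (B : V →ₗ⋆[ℂ] V →ₗ[ℂ] ℂ) : Prop := ∀ x y, star (B x y) = B y x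

/-- The restriction of `B` to `E` is nondegenerate. -/
def NondegOn (B : V →ₗ⋆[ℂ] V →ₗ[ℂ] ℂ) (E : Submodule ℂ V) : Prop :=
  ∀ x ∈ E, (∀ y ∈ E, B x y = 0) → x = 0

/-- `E` and `F` are orthogonal with respect to `B`. -/
def OrthoOn (B : V →ₗ⋆[ℂ] V →ₗ[ℂ] ℂ) (E F : Submodule ℂ V) : Prop :=
  ∀ x ∈ E, ∀ y ∈ F, B x y = 0

/-- The real quadratic form of a Hermitian form. -/
def qf (B : V →ₗ⋆[ℂ] V →ₗ[ℂ] ℂ) : V → ℝ := fun x => (B x x).re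

theorem IsHerm.eq_zero_symm {B : V →ₗ⋆[ℂ] V →ₗ[ℂ] ℂ} (hB : IsHerm B) {x y : V}
    (h : B x y = 0) : B y x = 0 := by
  rw [← hB x y, h, star_zero]

theorem qf_add {B : V →ₗ⋆[ℂ] V →ₗ[ℂ] ℂ} (hB : IsHerm B) {x y : V} (h : B x y = 0) :
    qf B (x + y) = qf B x + qf B y := by
  simp [qf, h, hB.eq_zero_symm h]

theorem qf_smul (B : V →ₗ⋆[ℂ] V →ₗ[ℂ] ℂ) (c : ℂ) (x : V) :
    qf B (c • x) = Complex.normSq c * qf B x := by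
  simp only [qf, LinearMap.map_smulₛₗ, map_smul, LinearMap.smul_apply, smul_eq_mul]
  rw [← mul_assoc, Complex.mul_conj]
  simp

theorem qf_neg (B : V →ₗ⋆[ℂ] V →ₗ[ℂ] ℂ) : qf (-B) = -qf B := by
  ext x; simp [qf]

theorem IsHerm.neg {B : V →ₗ⋆[ℂ] V →ₗ[ℂ] ℂ} (hB : IsHerm B) : IsHerm (-B) := by
  intro x y
  have := hB x y
  simp only [LinearMap.neg_apply, star_neg, this]

/-- A semidefinite Hermitian form vanishes against its null vectors. -/
theorem IsHerm.eq_zero_of_nonpos {B : V →ₗ⋆[ℂ] V →ₗ[ℂ] ℂ} (hB : IsHerm B) {F : Submodule ℂ V}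
    (hF : ∀ x ∈ F, qf B x ≤ 0) {x y : V} (hx : x ∈ F) (hy : y ∈ F) (h0 : qf B x = 0) :
    B x y = 0 := by
  by_contra hne
  set c := B x y with hc
  have hyx : B y x = star c := (hB x y).symm
  have key : ∀ s : ℝ, qf B y + 2 * s * Complex.normSq c ≤ 0 := by
    intro s
    have h1 := hF (y + ((s : ℂ) * c) • x) (F.add_mem hy (F.smul_mem _ hx))
    have h2 : qf B (y + ((s : ℂ) * c) • x) = qf B y + 2 * s * Complex.normSq c := by
      have e0 : (B x x).re = 0 := h0
      have e1 : (B x x).im = 0 := by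
        have := congrArg Complex.im (hB x x)
        simp at this
        linarith
      simp only [qf, map_add, LinearMap.map_smulₛₗ, LinearMap.add_apply, LinearMap.smul_apply,
        map_smul, smul_eq_mul, hyx, ← hc, map_mul, Complex.conj_ofReal]
      simp only [Complex.add_re, Complex.mul_re, Complex.mul_im, Complex.ofReal_re,
        Complex.ofReal_im, e0, e1, Complex.star_def, Complex.conj_re, Complex.conj_im,
        Complex.normSq_apply, Complex.add_im]
      ring
    rw [h2] at h1
    exact h1
  have hpos : 0 < Complex.normSq c := Complex.normSq_pos.2 hne
  have h1 := key ((|qf B y| + 1) / Complex.normSq c)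
  have h2 : 2 * ((|qf B y| + 1) / Complex.normSq c) * Complex.normSq c = 2 * (|qf B y| + 1) := by
    field_simp
  rw [h2] at h1
  have := neg_abs_le (qf B y)
  have := abs_nonneg (qf B y)
  linarith

variable [FiniteDimensional ℂ V]

theorem le_posIndex {q : V → ℝ} {E W : Submodule ℂ V} (hWE : W ≤ E) (hW : PosOn q W) :
    finrank ℂ W ≤ posIndex q E := by
  refine le_csSup ⟨finrank ℂ V, ?_⟩ ⟨W, hWE, hW, rfl⟩
  rintro k ⟨W, -, -, rfl⟩
  exact Submodule.finrank_le W

theorem exists_posIndex (q : V → ℝ) (E : Submodule ℂ V) :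
    ∃ W : Submodule ℂ V, W ≤ E ∧ PosOn q W ∧ finrank ℂ W = posIndex q E := by
  have h := Nat.sSup_mem (s := {k : ℕ | ∃ W : Submodule ℂ V, W ≤ E ∧ PosOn q W ∧ finrank ℂ W = k})
    ⟨0, ⊥, bot_le, fun ξ hξ h0 => absurd ((Submodule.mem_bot ℂ).1 hξ) h0, by simp⟩
    ⟨finrank ℂ V, by rintro k ⟨W, -, -, rfl⟩; exact Submodule.finrank_le W⟩
  exact h

theorem posIndex_mono {q q' : V → ℝ} {E E' : Submodule ℂ V} (hE : E ≤ E')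
    (h : ∀ ξ ∈ E, 0 < q ξ → 0 < q' ξ) : posIndex q E ≤ posIndex q' E' := by
  obtain ⟨W, hWE, hW, hk⟩ := exists_posIndex q E
  rw [← hk]
  exact le_posIndex (hWE.trans hE) fun ξ hξ h0 => h ξ (hWE hξ) (hW ξ hξ h0)

theorem posIndex_congr {q q' : V → ℝ} {E : Submodule ℂ V}
    (h : ∀ ξ ∈ E, 0 < q ξ ↔ 0 < q' ξ) : posIndex q E = posIndex q' E :=
  le_antisymm (posIndex_mono le_rfl fun ξ hξ => (h ξ hξ).1)
    (posIndex_mono le_rfl fun ξ hξ => (h ξ hξ).2)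

theorem finrank_add_le_of_inf_eq_bot {E W W' : Submodule ℂ V} (hW : W ≤ E) (hW' : W' ≤ E)
    (h : ∀ ξ ∈ W, ξ ∈ W' → ξ = 0) : finrank ℂ W + finrank ℂ W' ≤ finrank ℂ E := by
  have h0 : W ⊓ W' = ⊥ := by
    rw [eq_bot_iff]
    rintro ξ ⟨h1, h2⟩
    exact (Submodule.mem_bot ℂ).2 (h ξ h1 h2)
  have h1 := Submodule.finrank_sup_add_finrank_inf_eq W W'
  rw [h0, finrank_bot, add_zero] at h1
  rw [← h1]
  exact Submodule.finrank_mono (sup_le hW hW')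

theorem posIndex_add_posIndex_neg_le (q : V → ℝ) (E : Submodule ℂ V) :
    posIndex q E + posIndex (-q) E ≤ finrank ℂ E := by
  obtain ⟨W, hWE, hW, hk⟩ := exists_posIndex q E
  obtain ⟨W', hWE', hW', hk'⟩ := exists_posIndex (-q) E
  rw [← hk, ← hk']
  refine finrank_add_le_of_inf_eq_bot hWE hWE' fun ξ h1 h2 => ?_
  by_contra h0
  have := hW ξ h1 h0
  have := hW' ξ h2 h0
  simp only [Pi.neg_apply] at this
  linarith

/-- The positive index of `E` is carried over by injective maps that respect the forms. -/
theorem posIndex_map_le {V' : Type*} [AddCommGroup V'] [Module ℂ V'] [FiniteDimensional ℂ V']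
    {q : V → ℝ} {q' : V' → ℝ} (f : V →+ V') (σ : ℂ ≃+* ℂ)
    (hf : ∀ (c : ℂ) ξ, f (c • ξ) = σ c • f ξ) (hinj : Function.Injective f)
    {E : Submodule ℂ V} {E' : Submodule ℂ V'} (hE : ∀ ξ ∈ E, f ξ ∈ E')
    (hq : ∀ ξ ∈ E, 0 < q ξ → 0 < q' (f ξ)) : posIndex q E ≤ posIndex q' E' := by
  obtain ⟨W, hWE, hW, hk⟩ := exists_posIndex q E
  let b := finBasis ℂ W
  let v : Fin (finrank ℂ W) → V' := fun i => f (b i)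
  have hmem : ∀ η ∈ Submodule.span ℂ (Set.range v), ∃ ξ ∈ W, f ξ = η := by
    intro η hη
    induction hη using Submodule.span_induction with
    | mem x hx =>
      obtain ⟨i, rfl⟩ := hx
      exact ⟨b i, (b i).2, rfl⟩
    | zero => exact ⟨0, W.zero_mem, map_zero f⟩
    | add x y _ _ hx hy =>
      obtain ⟨a, ha, rfl⟩ := hx
      obtain ⟨c, hc, rfl⟩ := hy
      exact ⟨a + c, W.add_mem ha hc, map_add f a c⟩
    | smul c x _ hx =>
      obtain ⟨a, ha, rfl⟩ := hx
      exact ⟨σ.symm c • a, W.smul_mem _ ha, by rw [hf]; simp⟩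
  have hli : LinearIndependent ℂ v := by
    rw [Fintype.linearIndependent_iff]
    intro g hg i
    have h1 : f (∑ i, σ.symm (g i) • (b i : V)) = 0 := by
      rw [map_sum, ← hg]
      exact Finset.sum_congr rfl fun i _ => by rw [hf]; simp [v]
    have h2 : ∑ i, σ.symm (g i) • (b i : V) = 0 := hinj (h1.trans (map_zero f).symm)
    have h3 : ∑ i, σ.symm (g i) • b i = 0 := by
      apply Subtype.ext
      simpa using h2
    have h4 := (Fintype.linearIndependent_iff.1 b.linearIndependent) _ h3 i
    simpa using h4
  have hfr : finrank ℂ (Submodule.span ℂ (Set.range v)) = finrank ℂ W := by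
    rw [finrank_span_eq_card hli, Fintype.card_fin]
  rw [← hk, ← hfr]
  refine le_posIndex (fun η hη => ?_) (fun η hη h0 => ?_)
  · obtain ⟨ξ, hξ, rfl⟩ := hmem η hη
    exact hE ξ (hWE hξ)
  · obtain ⟨ξ, hξ, rfl⟩ := hmem η hη
    exact hq ξ (hWE hξ) (hW ξ hξ fun h => h0 (by rw [h, map_zero]))

theorem posIndex_linearMap_le {V' : Type*} [AddCommGroup V'] [Module ℂ V'] [FiniteDimensional ℂ V']
    {q : V → ℝ} {q' : V' → ℝ} (f : V →ₗ[ℂ] V') {E : Submodule ℂ V} {E' : Submodule ℂ V'}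
    (hinj : ∀ ξ ∈ E, f ξ = 0 → ξ = 0) (hE : ∀ ξ ∈ E, f ξ ∈ E')
    (hq : ∀ ξ ∈ E, 0 < q ξ → 0 < q' (f ξ)) : posIndex q E ≤ posIndex q' E' := by
  obtain ⟨W, hWE, hW, hk⟩ := exists_posIndex q E
  have hker : LinearMap.ker (f.domRestrict W) = ⊥ := by
    rw [LinearMap.ker_eq_bot']
    intro m hm
    exact Subtype.ext (hinj m (hWE m.2) hm)
  have hr := LinearMap.finrank_range_of_inj (LinearMap.ker_eq_bot.1 hker)
  rw [← hk, ← hr]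
  refine le_posIndex ?_ ?_
  · rintro _ ⟨ξ, rfl⟩
    exact hE ξ (hWE ξ.2)
  · rintro _ ⟨ξ, rfl⟩ h0
    exact hq ξ (hWE ξ.2) (hW ξ ξ.2 fun h => h0 (by simp [h]))

/-- **Sylvester's law of inertia** for nondegenerate Hermitian forms. -/
theorem IsHerm.isSylvester {B : V →ₗ⋆[ℂ] V →ₗ[ℂ] ℂ} (hB : IsHerm B) {E : Submodule ℂ V}
    (hE : NondegOn B E) : IsSylvester (qf B) E := by
  refine le_antisymm (posIndex_add_posIndex_neg_le _ _) ?_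
  obtain ⟨W, hWE, hW, hk⟩ := exists_posIndex (qf B) E
  let b := finBasis ℂ W
  let T : E →ₗ[ℂ] (Fin (finrank ℂ W) → ℂ) :=
    LinearMap.pi fun i => (B (b i)).comp E.subtype
  let W' : Submodule ℂ V := (LinearMap.ker T).map E.subtype
  have hW'E : W' ≤ E := Submodule.map_subtype_le E _
  have hdim : finrank ℂ E ≤ finrank ℂ W + finrank ℂ W' := by
    have h1 := LinearMap.finrank_range_add_finrank_ker T
    have h2 := Submodule.finrank_le (LinearMap.range T)
    rw [finrank_fin_fun] at h2
    have h3 : finrank ℂ W' = finrank ℂ (LinearMap.ker T) :=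
      Submodule.finrank_map_subtype_eq E _
    omega
  have hperp : ∀ w ∈ W, ∀ x ∈ W', B w x = 0 := by
    rintro w hw _ ⟨x, hx, rfl⟩
    have hx' : ∀ i, B (b i) x = 0 := fun i => congrFun (LinearMap.mem_ker.1 hx) i
    have hs' : w = ∑ i, b.repr ⟨w, hw⟩ i • (b i : V) := by
      have h := congrArg W.subtype (b.sum_repr ⟨w, hw⟩)
      rw [map_sum] at h
      exact h.symm
    rw [hs']
    simp [hx']
  have hnonpos : ∀ x ∈ W', qf B x ≤ 0 := by
    intro x hx
    by_contra hpos
    push Not at hpos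
    have hxW : x ∉ W := fun hxW => by
      have := hperp x hxW x hx
      simp [qf, this] at hpos
    have hle : W ⊔ Submodule.span ℂ {x} ≤ E := by
      refine sup_le hWE ?_
      rw [Submodule.span_singleton_le_iff_mem]
      exact hW'E hx
    have hP : PosOn (qf B) (W ⊔ Submodule.span ℂ {x}) := by
      intro ξ hξ h0
      obtain ⟨w, hw, y, hy, rfl⟩ := Submodule.mem_sup.1 hξ
      obtain ⟨c, rfl⟩ := Submodule.mem_span_singleton.1 hy
      rw [qf_add hB (by rw [map_smul, hperp w hw x hx, smul_zero]), qf_smul]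
      by_cases hw0 : w = 0
      · have hc : c ≠ 0 := by rintro rfl; simp [hw0] at h0
        have h1 := mul_pos (Complex.normSq_pos.2 hc) hpos
        have h2 : qf B w = 0 := by simp [hw0, qf]
        linarith
      · have h1 := hW w hw hw0
        have h2 := mul_nonneg (Complex.normSq_nonneg c) hpos.le
        linarith
    have h1 := le_posIndex hle hP
    have h2 : finrank ℂ W < finrank ℂ (W ⊔ Submodule.span ℂ {x} : Submodule ℂ V) := by
      refine Submodule.finrank_lt_finrank_of_lt (lt_of_le_of_ne le_sup_left fun h => hxW ?_)
      rw [h]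
      exact Submodule.mem_sup_right (Submodule.mem_span_singleton_self x)
    omega
  have hinf : ∀ ξ ∈ W, ξ ∈ W' → ξ = 0 := by
    intro ξ h1 h2
    by_contra h0
    have := hW ξ h1 h0
    have := hnonpos ξ h2
    linarith
  have hsup : W ⊔ W' = E := by
    refine Submodule.eq_of_le_of_finrank_le (sup_le hWE hW'E) ?_
    have h1 := finrank_add_le_of_inf_eq_bot (le_sup_left (a := W) (b := W')) le_sup_right hinf
    omega
  have hneg : PosOn (-qf B) W' := by
    intro x hx h0
    have h1 := hnonpos x hx
    rcases h1.lt_or_eq with h1 | h1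
    · simpa using h1
    · refine absurd (hE x (hW'E hx) fun y hy => ?_) h0
      rw [← hsup] at hy
      obtain ⟨w, hw, y', hy', rfl⟩ := Submodule.mem_sup.1 hy
      rw [map_add, hB.eq_zero_symm (hperp w hw x hx),
        hB.eq_zero_of_nonpos hnonpos hx hy' h1, add_zero]
  have h1 := le_posIndex hW'E hneg
  omega

theorem le_posIndex_sup {B : V →ₗ⋆[ℂ] V →ₗ[ℂ] ℂ} (hB : IsHerm B) {E F : Submodule ℂ V}
    (hd : Disjoint E F) (ho : OrthoOn B E F) :
    posIndex (qf B) E + posIndex (qf B) F ≤ posIndex (qf B) (E ⊔ F) := by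
  obtain ⟨W, hWE, hW, hk⟩ := exists_posIndex (qf B) E
  obtain ⟨W', hWF, hW', hk'⟩ := exists_posIndex (qf B) F
  have h0 : W ⊓ W' = ⊥ := (hd.mono hWE hWF).eq_bot
  have h1 := Submodule.finrank_sup_add_finrank_inf_eq W W'
  rw [h0, finrank_bot, add_zero, hk, hk'] at h1
  rw [← h1]
  refine le_posIndex (sup_le_sup hWE hWF) fun ξ hξ hne => ?_
  obtain ⟨w, hw, w', hw', rfl⟩ := Submodule.mem_sup.1 hξ
  rw [qf_add hB (ho w (hWE hw) w' (hWF hw'))]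
  by_cases hw0 : w = 0
  · have h2 : w' ≠ 0 := by rintro rfl; simp [hw0] at hne
    have h3 : qf B w = 0 := by simp [hw0, qf]
    linarith [hW' w' hw' h2]
  · have h1 := hW w hw hw0
    have h2 : 0 ≤ qf B w' := by
      by_cases hw0' : w' = 0
      · simp [hw0', qf]
      · exact (hW' w' hw' hw0').le
    linarith

theorem finrank_sup_of_disjoint {E F : Submodule ℂ V} (hd : Disjoint E F) :
    finrank ℂ (E ⊔ F : Submodule ℂ V) = finrank ℂ E + finrank ℂ F := by
  have h1 := Submodule.finrank_sup_add_finrank_inf_eq E F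
  rwa [hd.eq_bot, finrank_bot, add_zero] at h1

/-- Additivity of the positive index for orthogonal sums. -/
theorem posIndex_sup {B : V →ₗ⋆[ℂ] V →ₗ[ℂ] ℂ} (hB : IsHerm B) {E F : Submodule ℂ V}
    (hd : Disjoint E F) (ho : OrthoOn B E F) (hE : IsSylvester (qf B) E)
    (hF : IsSylvester (qf B) F) :
    posIndex (qf B) (E ⊔ F) = posIndex (qf B) E + posIndex (qf B) F ∧
      IsSylvester (qf B) (E ⊔ F) := by
  have h1 := le_posIndex_sup hB hd ho
  have h2 := le_posIndex_sup hB.neg hd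
    (fun x hx y hy => by simp [ho x hx y hy] : OrthoOn (-B) E F)
  rw [qf_neg] at h2
  have h3 := posIndex_add_posIndex_neg_le (qf B) (E ⊔ F)
  have h4 := finrank_sup_of_disjoint hd
  unfold IsSylvester at *
  omega

/-- The positive index of a nondegenerate form on the sum of two isotropic subspaces. -/
theorem posIndex_of_isotropic {B : V →ₗ⋆[ℂ] V →ₗ[ℂ] ℂ} {E F : Submodule ℂ V}
    (hd : Disjoint E F) (hEE : OrthoOn B E E) (hFF : OrthoOn B F F)
    (hs : IsSylvester (qf B) (E ⊔ F)) :
    posIndex (qf B) (E ⊔ F) = finrank ℂ E ∧ finrank ℂ E = finrank ℂ F := by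
  have h4 := finrank_sup_of_disjoint hd
  have key : ∀ q : V → ℝ, (∀ x ∈ E, q x = 0) → (∀ x ∈ F, q x = 0) →
      posIndex q (E ⊔ F) ≤ finrank ℂ E ∧ posIndex q (E ⊔ F) ≤ finrank ℂ F := by
    intro q hqE hqF
    obtain ⟨W, hWE, hW, hk⟩ := exists_posIndex q (E ⊔ F)
    have h1 := finrank_add_le_of_inf_eq_bot hWE (le_sup_left (a := E) (b := F))
      (fun ξ h1 h2 => by_contra fun h0 => (hW ξ h1 h0).ne' (hqE ξ h2))
    have h2 := finrank_add_le_of_inf_eq_bot hWE (le_sup_right (a := E) (b := F))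
      (fun ξ h1 h2 => by_contra fun h0 => (hW ξ h1 h0).ne' (hqF ξ h2))
    omega
  have h5 := key (qf B) (fun x hx => by simp [qf, hEE x hx x hx])
    (fun x hx => by simp [qf, hFF x hx x hx])
  have h6 := key (-qf B) (fun x hx => by simp [qf, hEE x hx x hx])
    (fun x hx => by simp [qf, hFF x hx x hx])
  unfold IsSylvester at hs
  omega

end PosIndex

/-! ### Local constancy of the positive index -/

section Continuity

variable {ι : Type*} [Fintype ι] {T : Type*} [TopologicalSpace T]

/-- The positive index is lower semicontinuous. -/
theorem eventually_posIndex_le {q : T → (ι → ℂ) → ℝ}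
    (hq : Continuous fun p : T × (ι → ℂ) => q p.1 p.2)
    (hh : ∀ t (c : ℂ) x, q t (c • x) = Complex.normSq c * q t x)
    (E : Submodule ℂ (ι → ℂ)) (t₀ : T) :
    ∀ᶠ t in nhds t₀, posIndex (q t₀) E ≤ posIndex (q t) E := by
  obtain ⟨W, hWE, hW, hk⟩ := exists_posIndex (q t₀) E
  have hK : IsCompact ((W : Set (ι → ℂ)) ∩ Metric.sphere 0 1) :=
    (isCompact_sphere 0 1).inter_left W.closed_of_finiteDimensional
  have hev : ∀ᶠ t in nhds t₀, ∀ x ∈ (W : Set (ι → ℂ)) ∩ Metric.sphere 0 1, 0 < q t x := by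
    refine hK.eventually_forall_of_forall_eventually fun x hx => ?_
    have h0 : x ≠ 0 := by
      rintro rfl
      simp at hx
    exact hq.continuousAt.eventually (lt_mem_nhds (hW x hx.1 h0))
  filter_upwards [hev] with t ht
  rw [← hk]
  refine le_posIndex hWE fun x hx h0 => ?_
  have hn : ‖x‖ ≠ 0 := norm_ne_zero_iff.2 h0
  have h1 := ht (((‖x‖⁻¹ : ℝ) : ℂ) • x) ⟨W.smul_mem _ hx, by
    rw [mem_sphere_zero_iff_norm, norm_smul]
    simp [hn]⟩
  rw [hh] at h1
  exact pos_of_mul_pos_right h1 (Complex.normSq_nonneg _)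

/-- The positive index of a nondegenerate form is locally constant. -/
theorem eventually_posIndex_eq {q : T → (ι → ℂ) → ℝ}
    (hq : Continuous fun p : T × (ι → ℂ) => q p.1 p.2)
    (hh : ∀ t (c : ℂ) x, q t (c • x) = Complex.normSq c * q t x)
    (E : Submodule ℂ (ι → ℂ)) (t₀ : T) (hs : IsSylvester (q t₀) E) :
    ∀ᶠ t in nhds t₀, posIndex (q t) E = posIndex (q t₀) E := by
  have h1 := eventually_posIndex_le hq hh E t₀
  have h2 := eventually_posIndex_le (q := fun t => -q t) hq.neg
    (fun t c x => by simp [hh]) E t₀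
  filter_upwards [h1, h2] with t h1 h2
  have h3 := posIndex_add_posIndex_neg_le (q t) E
  unfold IsSylvester at hs
  omega

theorem posIndex_eq_of_homotopy {q : ℝ → (ι → ℂ) → ℝ}
    (hq : Continuous fun p : ℝ × (ι → ℂ) => q p.1 p.2)
    (hh : ∀ t (c : ℂ) x, q t (c • x) = Complex.normSq c * q t x)
    (E : Submodule ℂ (ι → ℂ)) (hs : ∀ t ∈ Set.Icc (0 : ℝ) 1, IsSylvester (q t) E) :
    posIndex (q 0) E = posIndex (q 1) E := by
  have hc : ContinuousOn (fun t => posIndex (q t) E) (Set.Icc (0 : ℝ) 1) := by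
    intro t ht
    refine ContinuousAt.continuousWithinAt ?_
    have := eventually_posIndex_eq hq hh E t (hs t ht)
    exact (tendsto_const_nhds.congr' (this.mono fun s h => h.symm) :
      Filter.Tendsto (fun t => posIndex (q t) E) (nhds t) (nhds (posIndex (q t) E)))
  exact isPreconnected_Icc.constant hc (by simp) (by simp)

end Continuity

end MaslovType

end

noncomputable section

namespace MaslovType

open Module

/-! ### Generalized eigenspaces of isometries of a Hermitian form -/

section Spectral

variable {V : Type*} [AddCommGroup V] [Module ℂ V]

theorem eq_zero_of_affine_eq_zero {A : End ℂ V} {c d w : ℂ} (h : c * w + d ≠ 0) {y : V}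
    (hy : y ∈ A.maxGenEigenspace w) (h0 : c • A y + d • y = 0) : y = 0 := by
  obtain ⟨k, hk⟩ := (End.mem_maxGenEigenspace A w y).1 hy
  have h1 : c • (A - w • (1 : End ℂ V)) y = (-(c * w + d)) • y := by
    have : c • A y = -(d • y) := eq_neg_of_add_eq_zero_left h0
    simp only [LinearMap.sub_apply, LinearMap.smul_apply, End.one_apply, smul_sub, this]
    module
  have h2 : ∀ j : ℕ, c ^ j • ((A - w • (1 : End ℂ V)) ^ j) y = (-(c * w + d)) ^ j • y := by
    intro j
    induction j with
    | zero => simp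
    | succ j ih =>
      rw [pow_succ', pow_succ', Module.End.mul_apply, mul_smul, ← map_smul, ih, map_smul,
        smul_comm, h1, smul_smul, pow_succ]
  have h3 := h2 k
  rw [hk, smul_zero] at h3
  exact (smul_eq_zero.1 h3.symm).resolve_left (pow_ne_zero _ (neg_ne_zero.2 h))

theorem affine_mem_maxGenEigenspace (A : End ℂ V) (c d w : ℂ) {y : V}
    (hy : y ∈ A.maxGenEigenspace w) : (c • A + d • (1 : End ℂ V)) y ∈ A.maxGenEigenspace w :=
  End.mapsTo_maxGenEigenspace_of_comm
    (((Commute.refl A).smul_right c).add_right ((Commute.one_right A).smul_right d)) w hy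

theorem sub_mem_maxGenEigenspace (A : End ℂ V) (d w : ℂ) {y : V}
    (hy : y ∈ A.maxGenEigenspace w) : (A - d • (1 : End ℂ V)) y ∈ A.maxGenEigenspace w := by
  have := affine_mem_maxGenEigenspace A 1 (-d) w hy
  rwa [one_smul, neg_smul, ← sub_eq_add_neg] at this

theorem orthoOn_finset_sup_left {B : V →ₗ⋆[ℂ] V →ₗ[ℂ] ℂ} {s : Finset ℂ} {E : ℂ → Submodule ℂ V}
    {F : Submodule ℂ V} (h : ∀ z ∈ s, OrthoOn B (E z) F) : OrthoOn B (s.sup E) F := by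
  classical
  induction s using Finset.induction_on with
  | empty =>
    intro x hx y _
    rw [Finset.sup_empty, Submodule.mem_bot] at hx
    simp [hx]
  | insert a s ha ih =>
    intro x hx y hy
    rw [Finset.sup_insert] at hx
    obtain ⟨x₁, h1, x₂, h2, rfl⟩ := Submodule.mem_sup.1 hx
    rw [map_add, LinearMap.add_apply, h a (Finset.mem_insert_self a s) x₁ h1 y hy,
      ih (fun z hz => h z (Finset.mem_insert_of_mem hz)) x₂ h2 y hy, add_zero]

theorem OrthoOn.symm {B : V →ₗ⋆[ℂ] V →ₗ[ℂ] ℂ} (hB : IsHerm B) {E F : Submodule ℂ V}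
    (h : OrthoOn B E F) : OrthoOn B F E :=
  fun x hx y hy => hB.eq_zero_symm (h y hy x hx)

theorem orthoOn_finset_sup_right {B : V →ₗ⋆[ℂ] V →ₗ[ℂ] ℂ} (hB : IsHerm B) {s : Finset ℂ}
    {E : ℂ → Submodule ℂ V} {F : Submodule ℂ V} (h : ∀ z ∈ s, OrthoOn B F (E z)) :
    OrthoOn B F (s.sup E) :=
  (orthoOn_finset_sup_left fun z hz => (h z hz).symm hB).symm hB

theorem star_mul_ne_one_of_norm {z w : ℂ} (h : ‖z‖ * ‖w‖ ≠ 1) : star z * w ≠ 1 := by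
  intro h1
  apply h
  have := congrArg norm h1
  rwa [norm_mul, norm_star, norm_one] at this

theorem eq_of_star_mul_eq_one {z w : ℂ} (hz : ‖z‖ = 1) (h : star z * w = 1) : w = z := by
  have h1 : star z * z = 1 := by
    have := Complex.conj_mul' z
    rw [hz] at this
    simpa using this
  have h2 : star z ≠ 0 := by
    rintro h0
    simp [h0] at h
  exact mul_left_cancel₀ h2 (h.trans h1.symm)

theorem nondegOn_of_orthoOn_compl {B : V →ₗ⋆[ℂ] V →ₗ[ℂ] ℂ} (hn : NondegOn B ⊤)
    {E F : Submodule ℂ V} (h : E ⊔ F = ⊤) (ho : OrthoOn B E F) : NondegOn B E := by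
  intro x hx h0
  refine hn x trivial fun y _ => ?_
  have hy : y ∈ E ⊔ F := h ▸ trivial
  obtain ⟨y₁, h1, y₂, h2, rfl⟩ := Submodule.mem_sup.1 hy
  rw [map_add, h0 y₁ h1, ho x hx y₂ h2, add_zero]

variable [FiniteDimensional ℂ V]

theorem exists_affine_eq (A : End ℂ V) {c d w : ℂ} (h : c * w + d ≠ 0) {y : V}
    (hy : y ∈ A.maxGenEigenspace w) :
    ∃ y' ∈ A.maxGenEigenspace w, (c • A + d • (1 : End ℂ V)) y' = y := by
  let g : A.maxGenEigenspace w →ₗ[ℂ] A.maxGenEigenspace w :=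
    (c • A + d • (1 : End ℂ V)).restrict fun _ hy => affine_mem_maxGenEigenspace A c d w hy
  have hinj : Function.Injective g := by
    rw [← LinearMap.ker_eq_bot, LinearMap.ker_eq_bot']
    intro m hm
    refine Subtype.ext (eq_zero_of_affine_eq_zero h m.2 ?_)
    have := congrArg Subtype.val hm
    simpa [g] using this
  obtain ⟨y', hy'⟩ := LinearMap.injective_iff_surjective.1 hinj ⟨y, hy⟩
  exact ⟨y', y'.2, congrArg Subtype.val hy'⟩

theorem exists_affine_pow_eq (A : End ℂ V) {c d w : ℂ} (h : c * w + d ≠ 0) (k : ℕ) {y : V}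
    (hy : y ∈ A.maxGenEigenspace w) :
    ∃ y' ∈ A.maxGenEigenspace w, ((c • A + d • (1 : End ℂ V)) ^ k) y' = y := by
  induction k generalizing y with
  | zero => exact ⟨y, hy, by simp⟩
  | succ k ih =>
    obtain ⟨y₁, h1, rfl⟩ := exists_affine_eq A h hy
    obtain ⟨y₂, h2, rfl⟩ := ih h1
    exact ⟨y₂, h2, by rw [pow_succ', Module.End.mul_apply]⟩

/-- Generalized eigenspaces of an isometry are orthogonal unless `z̄ w = 1`. -/
theorem orthoOn_maxGenEigenspace {B : V →ₗ⋆[ℂ] V →ₗ[ℂ] ℂ} {A : End ℂ V}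
    (hA : ∀ x y, B (A x) (A y) = B x y) {z w : ℂ} (hzw : star z * w ≠ 1) :
    OrthoOn B (A.maxGenEigenspace z) (A.maxGenEigenspace w) := by
  intro x hx y hy
  obtain ⟨k, hk⟩ := (End.mem_maxGenEigenspace A z x).1 hx
  have hne : -star z * w + 1 ≠ 0 := fun h => hzw (by linear_combination -h)
  have h1 : ∀ (j : ℕ) x y, B (((A - z • (1 : End ℂ V)) ^ j) x) ((A ^ j) y) =
      B x (((-star z • A + (1 : ℂ) • (1 : End ℂ V)) ^ j) y) := by
    intro j
    induction j with
    | zero => simp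
    | succ j ih =>
      intro x y
      rw [pow_succ, pow_succ, Module.End.mul_apply, Module.End.mul_apply, ih, pow_succ,
        Module.End.mul_apply]
      have hc : ((-star z • A + (1 : ℂ) • (1 : End ℂ V)) ^ j) (A y) =
          A (((-star z • A + (1 : ℂ) • (1 : End ℂ V)) ^ j) y) := by
        have : Commute ((-star z • A + (1 : ℂ) • (1 : End ℂ V)) ^ j) A :=
          Commute.pow_left (((Commute.refl A).smul_left _).add_left
            ((Commute.one_left A).smul_left _)) j
        exact LinearMap.congr_fun this y
      have hc' : ((-star z • A + (1 : ℂ) • (1 : End ℂ V)) ^ j)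
          ((-star z • A + (1 : ℂ) • (1 : End ℂ V)) y) =
          (-star z • A + (1 : ℂ) • (1 : End ℂ V))
            (((-star z • A + (1 : ℂ) • (1 : End ℂ V)) ^ j) y) := by
        rw [← Module.End.mul_apply, ← Module.End.mul_apply, ← pow_succ, ← pow_succ']
      rw [hc, hc']
      simp [hA]
      ring
  obtain ⟨y', -, rfl⟩ := exists_affine_pow_eq A hne k hy
  rw [← h1, hk]
  simp

theorem finrank_finset_sup {E : ℂ → Submodule ℂ V} (hE : iSupIndep E) (s : Finset ℂ) :
    finrank ℂ (s.sup E : Submodule ℂ V) = ∑ z ∈ s, finrank ℂ (E z) := by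
  classical
  induction s using Finset.induction_on with
  | empty => simp
  | insert a s ha ih =>
    rw [Finset.sup_insert, finrank_sup_of_disjoint, ih, Finset.sum_insert ha]
    have h := (hE.supIndep' (insert a s)).disjoint_sup_sup (u := {a}) (v := s) (by simp)
      (Finset.subset_insert a s) (by simpa using ha)
    simpa using h

/-- Additivity of the positive index for finite orthogonal sums. -/
theorem posIndex_finset_sup {B : V →ₗ⋆[ℂ] V →ₗ[ℂ] ℂ} (hB : IsHerm B) {E : ℂ → Submodule ℂ V}
    (hE : iSupIndep E) (s : Finset ℂ)
    (ho : ∀ z ∈ s, ∀ w ∈ s, z ≠ w → OrthoOn B (E z) (E w))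
    (hs : ∀ z ∈ s, IsSylvester (qf B) (E z)) :
    posIndex (qf B) (s.sup E) = ∑ z ∈ s, posIndex (qf B) (E z) ∧
      IsSylvester (qf B) (s.sup E) := by
  classical
  induction s using Finset.induction_on with
  | empty =>
    have h := posIndex_add_posIndex_neg_le (qf B) (⊥ : Submodule ℂ V)
    rw [finrank_bot] at h
    simp only [Finset.sup_empty, Finset.sum_empty, IsSylvester]
    exact ⟨by omega, by rw [Finset.sup_empty, finrank_bot]; omega⟩
  | insert a s ha ih =>
    have ih' := ih
      (fun z hz w hw => ho z (Finset.mem_insert_of_mem hz) w (Finset.mem_insert_of_mem hw))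
      (fun z hz => hs z (Finset.mem_insert_of_mem hz))
    have hd := (hE.supIndep' (insert a s)).disjoint_sup_sup (u := {a}) (v := s) (by simp)
      (Finset.subset_insert a s) (by simpa using ha)
    rw [Finset.sup_singleton] at hd
    have h := posIndex_sup hB hd
      (orthoOn_finset_sup_right hB fun z hz => ho a (Finset.mem_insert_self a s) z
        (Finset.mem_insert_of_mem hz) (by rintro rfl; exact ha hz))
      (hs a (Finset.mem_insert_self a s)) ih'.2
    rw [Finset.sup_insert, Finset.sum_insert ha, ← ih'.1]
    exact h

section Decomposition

variable {A : End ℂ V} {S : Finset ℂ} (hS : ∀ z, z ∉ S → A.maxGenEigenspace z = ⊥)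

include hS

theorem finset_sup_maxGenEigenspace : S.sup A.maxGenEigenspace = ⊤ := by
  rw [eq_top_iff, ← End.iSup_maxGenEigenspace_eq_top A]
  refine iSup_le fun z => ?_
  by_cases hz : z ∈ S
  · exact Finset.le_sup (f := A.maxGenEigenspace) hz
  · rw [hS z hz]
    exact bot_le

theorem filter_sup_sup_filter_not (p : ℂ → Prop) [DecidablePred p] :
    (S.filter p).sup A.maxGenEigenspace ⊔ (S.filter fun z => ¬ p z).sup A.maxGenEigenspace = ⊤ := by
  classical
  rw [← Finset.sup_union, Finset.filter_union_filter_not_eq, finset_sup_maxGenEigenspace hS]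

variable {B : V →ₗ⋆[ℂ] V →ₗ[ℂ] ℂ} (hB : IsHerm B) (hn : NondegOn B ⊤)
  (ho : ∀ z w : ℂ, star z * w ≠ 1 → OrthoOn B (A.maxGenEigenspace z) (A.maxGenEigenspace w))

include hB hn ho

theorem nondegOn_maxGenEigenspace {z : ℂ} (hz : ‖z‖ = 1) : NondegOn B (A.maxGenEigenspace z) := by
  classical
  refine nondegOn_of_orthoOn_compl hn
    (F := (S.filter fun w => ¬ w = z).sup A.maxGenEigenspace) ?_ ?_
  · rw [eq_top_iff, ← filter_sup_sup_filter_not hS (fun w => w = z)]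
    refine sup_le_sup (Finset.sup_le fun w hw => ?_) le_rfl
    rw [(Finset.mem_filter.1 hw).2]
  · refine orthoOn_finset_sup_right hB fun w hw => ho z w fun h => ?_
    exact (Finset.mem_filter.1 hw).2 (eq_of_star_mul_eq_one hz h)

/-- The positive index of an `A`-compatible Hermitian form, read off from the generalized
eigenspaces. -/
theorem posIndex_top_eq :
    posIndex (qf B) ⊤ = ∑ z ∈ S.filter (fun z => ‖z‖ < 1), finrank ℂ (A.maxGenEigenspace z) +
      ∑ z ∈ S.filter (fun z => ‖z‖ = 1), posIndex (qf B) (A.maxGenEigenspace z) := by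
  classical
  set E := A.maxGenEigenspace with hE
  have hind : iSupIndep E := A.independent_maxGenEigenspace
  set Ei := (S.filter fun z => ‖z‖ < 1).sup E with hEi
  set Eo := (S.filter fun z => 1 < ‖z‖).sup E with hEo
  set Ec := (S.filter fun z => ‖z‖ = 1).sup E with hEc
  have hdisj : ∀ s t : Finset ℂ, Disjoint s t → Disjoint (s.sup E) (t.sup E) := fun s t hst =>
    (hind.supIndep' (s ∪ t)).disjoint_sup_sup Finset.subset_union_left Finset.subset_union_right hst
  have hio : Ei ⊔ Eo = (S.filter fun z => ¬ ‖z‖ = 1).sup E := by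
    rw [hEi, hEo, ← Finset.sup_union, ← Finset.filter_or]
    congr 1
    exact Finset.filter_congr fun z _ => lt_or_lt_iff_ne
  have htop : Ec ⊔ (Ei ⊔ Eo) = ⊤ := by
    rw [hio]
    exact filter_sup_sup_filter_not hS _
  have hcircle : ∀ z ∈ S.filter (fun z => ‖z‖ = 1), IsSylvester (qf B) (E z) := fun z hz =>
    hB.isSylvester (nondegOn_maxGenEigenspace hS hB hn ho (Finset.mem_filter.1 hz).2)
  have hc := posIndex_finset_sup hB hind (S.filter fun z => ‖z‖ = 1)
    (fun z hz w hw hzw => ho z w fun h =>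
      hzw (eq_of_star_mul_eq_one (Finset.mem_filter.1 hz).2 h).symm) hcircle
  have hoc : OrthoOn B (Ei ⊔ Eo) Ec := by
    rw [hio]
    refine orthoOn_finset_sup_left fun z hz => orthoOn_finset_sup_right hB fun w hw => ?_
    refine ho z w (star_mul_ne_one_of_norm ?_)
    rw [(Finset.mem_filter.1 hw).2, mul_one]
    exact (Finset.mem_filter.1 hz).2
  have hii : OrthoOn B Ei Ei := by
    refine orthoOn_finset_sup_left fun z hz => orthoOn_finset_sup_right hB fun w hw => ?_
    refine ho z w (star_mul_ne_one_of_norm ?_)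
    have h1 := (Finset.mem_filter.1 hz).2
    have h2 := (Finset.mem_filter.1 hw).2
    nlinarith [norm_nonneg z, norm_nonneg w]
  have hoo : OrthoOn B Eo Eo := by
    refine orthoOn_finset_sup_left fun z hz => orthoOn_finset_sup_right hB fun w hw => ?_
    refine ho z w (star_mul_ne_one_of_norm ?_)
    have h1 := (Finset.mem_filter.1 hz).2
    have h2 := (Finset.mem_filter.1 hw).2
    nlinarith [norm_nonneg z, norm_nonneg w]
  have hsio : IsSylvester (qf B) (Ei ⊔ Eo) :=
    hB.isSylvester (nondegOn_of_orthoOn_compl hn (by rw [sup_comm, htop]) hoc)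
  have hdio : Disjoint Ei Eo := by
    refine hdisj _ _ (Finset.disjoint_left.2 fun z h1 h2 => ?_)
    exact lt_asymm (Finset.mem_filter.1 h1).2 (Finset.mem_filter.1 h2).2
  have hiso := posIndex_of_isotropic hdio hii hoo hsio
  have hdc : Disjoint (Ei ⊔ Eo) Ec := by
    rw [hio]
    exact hdisj _ _ (Finset.disjoint_left.2 fun z h1 h2 =>
      (Finset.mem_filter.1 h1).2 (Finset.mem_filter.1 h2).2)
  have hfin := posIndex_sup hB hdc hoc hsio hc.2
  rw [sup_comm, htop] at hfin
  rw [hfin.1, hiso.1, hc.1, finrank_finset_sup hind]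

/-- The generalized eigenspaces for `z` and `1 / z̄` have the same dimension. -/
theorem finrank_maxGenEigenspace_le {z w : ℂ} (hzw : star z * w = 1) :
    finrank ℂ (A.maxGenEigenspace z) ≤ finrank ℂ (A.maxGenEigenspace w) := by
  classical
  let b := finBasis ℂ (A.maxGenEigenspace w)
  let T : A.maxGenEigenspace z →ₗ[ℂ] (Fin (finrank ℂ (A.maxGenEigenspace w)) → ℂ) :=
    LinearMap.pi fun i => (B (b i)).comp (A.maxGenEigenspace z).subtype
  have hinj : Function.Injective T := by
    rw [← LinearMap.ker_eq_bot, LinearMap.ker_eq_bot']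
    intro x hx
    refine Subtype.ext (hn x trivial fun y _ => hB.eq_zero_symm ?_)
    have hw : ∀ y ∈ A.maxGenEigenspace w, B y x = 0 := by
      intro y hy
      have hs := congrArg (A.maxGenEigenspace w).subtype (b.sum_repr ⟨y, hy⟩)
      rw [map_sum] at hs
      change _ = y at hs
      rw [← hs]
      have hx' : ∀ i, B (b i) x = 0 := fun i => congrFun hx i
      simp [hx']
    have hy : y ∈ (S.filter fun u => u = w).sup A.maxGenEigenspace ⊔
        (S.filter fun u => ¬ u = w).sup A.maxGenEigenspace := by
      rw [filter_sup_sup_filter_not hS]; trivial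
    obtain ⟨y₁, h1, y₂, h2, rfl⟩ := Submodule.mem_sup.1 hy
    have h1' : y₁ ∈ A.maxGenEigenspace w := by
      refine (Finset.sup_le fun u hu => ?_ : _ ≤ A.maxGenEigenspace w) h1
      rw [(Finset.mem_filter.1 hu).2]
    have h2' : B y₂ x = 0 := by
      refine orthoOn_finset_sup_left (fun u hu => ho u z fun h => ?_) y₂ h2 x x.2
      refine (Finset.mem_filter.1 hu).2 ?_
      have h3 : star w * z = 1 := by
        have := congrArg star hzw
        simpa [mul_comm] using this
      have h4 : z ≠ 0 := by rintro rfl; simp at h3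
      exact star_injective (mul_right_cancel₀ h4 (h.trans h3.symm))
    rw [map_add, LinearMap.add_apply, hw y₁ h1', h2', add_zero]
  have := LinearMap.finrank_le_finrank_of_injective hinj
  rwa [finrank_fin_fun] at this

end Decomposition

end Spectral

end MaslovType

end

noncomputable section

namespace MaslovType

open Module

/-! ### Cayley-type forms -/

section Twist

variable {V : Type*} [AddCommGroup V] [Module ℂ V]

/-- The form `(x, y) ↦ B (P x) (Q y)`. -/
def twist (B : V →ₗ⋆[ℂ] V →ₗ[ℂ] ℂ) (P Q : End ℂ V) : V →ₗ⋆[ℂ] V →ₗ[ℂ] ℂ :=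
  (B.comp P).compl₂ Q

@[simp]
theorem twist_apply (B : V →ₗ⋆[ℂ] V →ₗ[ℂ] ℂ) (P Q : End ℂ V) (x y : V) :
    twist B P Q x y = B (P x) (Q y) := rfl

/-- For unit numbers `u`, `v`, the Hermitian form `v ū B((A - v²)x, (A - u²)y)`, which degenerates
exactly when `u²` or `v²` is an eigenvalue of the isometry `A`. -/
def cayleyForm (B : V →ₗ⋆[ℂ] V →ₗ[ℂ] ℂ) (A : End ℂ V) (v u : ℂ) : V →ₗ⋆[ℂ] V →ₗ[ℂ] ℂ :=
  (v * star u) • twist B (A - v ^ 2 • (1 : End ℂ V)) (A - u ^ 2 • (1 : End ℂ V))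

theorem cayleyForm_apply {B : V →ₗ⋆[ℂ] V →ₗ[ℂ] ℂ} {A : End ℂ V}
    (hA : ∀ x y, B (A x) (A y) = B x y) {u v : ℂ} (hu : u * star u = 1) (hv : v * star v = 1)
    (x y : V) : cayleyForm B A v u x y = (v * star u + star v * u) * B x y
      - v * u * B (A x) y - star v * star u * B x (A y) := by
  simp only [cayleyForm, LinearMap.smul_apply, twist_apply, LinearMap.sub_apply, map_sub,
    End.one_apply, LinearMap.map_smulₛₗ, map_smul, hA, smul_eq_mul, map_pow, starRingEnd_apply]
  linear_combination (star v * u * B x y * (v * star v) - v * u * B (A x) y) * hu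
    + (star v * u * B x y - star u * star v * B x (A y)) * hv

theorem isHerm_cayleyForm {B : V →ₗ⋆[ℂ] V →ₗ[ℂ] ℂ} (hB : IsHerm B) {A : End ℂ V}
    (hA : ∀ x y, B (A x) (A y) = B x y) {u v : ℂ} (hu : u * star u = 1) (hv : v * star v = 1) :
    IsHerm (cayleyForm B A v u) := by
  intro x y
  rw [cayleyForm_apply hA hu hv, cayleyForm_apply hA hu hv]
  simp only [star_sub, star_add, star_mul', star_star, hB _ _]
  ring

end Twist

theorem continuous_qf {ι : Type*} [Fintype ι] (B : (ι → ℂ) →ₗ⋆[ℂ] (ι → ℂ) →ₗ[ℂ] ℂ) :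
    Continuous (qf B) := by
  classical
  have h : ∀ x, B x x = ∑ i, ∑ j,
      (starRingEnd ℂ) (x i) * (x j * B (Pi.single i 1) (Pi.single j 1)) := by
    intro x
    have hx : x = ∑ i, x i • (Pi.single i 1 : ι → ℂ) := by
      ext j
      simp [Finset.sum_apply, Pi.single_apply]
    conv_lhs => rw [hx]
    simp only [map_sum, LinearMap.sum_apply, LinearMap.map_smulₛₗ, LinearMap.smul_apply, map_smul,
      smul_eq_mul, Finset.mul_sum]
    rw [Finset.sum_comm]
    exact Finset.sum_congr rfl fun i _ => Finset.sum_congr rfl fun j _ => by ring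
  unfold qf
  simp_rw [h]
  fun_prop

variable {ι : Type*} [Fintype ι]

/-- On the generalized eigenspace of `z` the form `cayleyForm B A v u` has the index of the
multiple `κ B`, where `v ū (z - u²) = κ (z - v²)`. -/
theorem posIndex_cayleyForm {B : (ι → ℂ) →ₗ⋆[ℂ] (ι → ℂ) →ₗ[ℂ] ℂ} (hB : IsHerm B)
    {A : End ℂ (ι → ℂ)} {u v z : ℂ} (hF : IsHerm (cayleyForm B A v u)) {κ : ℝ} (hκ : κ ≠ 0)
    (hz : v * star u * (z - u ^ 2) = κ * (z - v ^ 2)) (hzv : z - v ^ 2 ≠ 0)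
    (hn : NondegOn B (A.maxGenEigenspace z)) :
    posIndex (qf (cayleyForm B A v u)) (A.maxGenEigenspace z) =
      posIndex (κ • qf B) (A.maxGenEigenspace z) := by
  set E := A.maxGenEigenspace z with hE
  set P : End ℂ (ι → ℂ) := A - v ^ 2 • (1 : End ℂ (ι → ℂ)) with hP
  have hPinj : ∀ x ∈ E, P x = 0 → x = 0 := by
    intro x hx h0
    refine eq_zero_of_affine_eq_zero (c := 1) (d := -v ^ 2) ?_ hx ?_
    · rwa [one_mul, ← sub_eq_add_neg]
    · rw [← h0, hP]
      simp [sub_eq_add_neg]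
  have hPE : ∀ x ∈ E, P x ∈ E := fun x hx => sub_mem_maxGenEigenspace A _ _ hx
  let G : ℝ → ((ι → ℂ) →ₗ⋆[ℂ] (ι → ℂ) →ₗ[ℂ] ℂ) := fun t =>
    ((1 - t : ℝ) : ℂ) • cayleyForm B A v u + ((t * κ : ℝ) : ℂ) • twist B P P
  have hG : ∀ t, IsHerm (G t) := by
    intro t x y
    have h1 := hF x y
    have h2 := hB (P x) (P y)
    simp only [G, LinearMap.add_apply, LinearMap.smul_apply, smul_eq_mul, star_add, star_mul', h1,
      twist_apply, h2, Complex.star_def, Complex.conj_ofReal] at *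
  have hGn : ∀ t, NondegOn (G t) E := by
    intro t x hx h0
    refine hPinj x hx (hn _ (hPE x hx) fun y hy => ?_)
    let c : ℂ := (1 - t : ℝ) * (v * star u) + (t * κ : ℝ)
    let d : ℂ := -((1 - t : ℝ) * (v * star u) * u ^ 2 + (t * κ : ℝ) * v ^ 2)
    have hcd : c * z + d ≠ 0 := by
      have : c * z + d = κ * (z - v ^ 2) := by
        simp only [c, d]
        push_cast
        linear_combination (1 - (t : ℂ)) * hz
      rw [this]
      exact mul_ne_zero (by exact_mod_cast hκ) hzv
    obtain ⟨y', hy', rfl⟩ := exists_affine_eq A hcd hy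
    rw [← h0 y' hy']
    simp only [G, c, d, hP, cayleyForm, LinearMap.add_apply, LinearMap.smul_apply, twist_apply,
      LinearMap.sub_apply, End.one_apply, map_sub, map_add, map_smul, smul_eq_mul]
    ring
  have hsyl := fun t => (hG t).isSylvester (hGn t)
  have hq : ∀ t x, qf (G t) x = (1 - t) * qf (cayleyForm B A v u) x + t * κ * qf B (P x) := by
    intro t x
    simp only [qf, G, LinearMap.add_apply, LinearMap.smul_apply, smul_eq_mul, Complex.add_re,
      Complex.re_ofReal_mul, twist_apply]
  have hcont : Continuous fun p : ℝ × (ι → ℂ) => qf (G p.1) p.2 := by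
    simp_rw [hq]
    have h1 := continuous_qf (cayleyForm B A v u)
    have h2 := continuous_qf B
    have h3 : Continuous P := P.continuous_of_finiteDimensional
    fun_prop
  have hhom := posIndex_eq_of_homotopy (q := fun t => qf (G t)) hcont (fun t => qf_smul (G t)) E
    fun t _ => hsyl t
  have e0 : qf (G 0) = qf (cayleyForm B A v u) := by ext x; simp [hq]
  have e1 : ∀ x, qf (G 1) x = (κ • qf B) (P x) := by intro x; simp [hq]
  rw [← e0]
  refine hhom.trans ?_
  have h1 : posIndex (qf (G 1)) E ≤ posIndex (κ • qf B) E :=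
    posIndex_linearMap_le P hPinj hPE fun x _ h => by rwa [← e1]
  have h2 : posIndex (-qf (G 1)) E ≤ posIndex (-(κ • qf B)) E :=
    posIndex_linearMap_le P hPinj hPE fun x _ h => by
      rw [Pi.neg_apply, ← e1]
      exact h
  have h3 := hsyl 1
  have h4 := posIndex_add_posIndex_neg_le (κ • qf B) E
  unfold IsSylvester at h3
  omega

/-! ### The Krein form of a symplectic matrix -/

section Krein

variable {n : ℕ}

theorem omega0_eq {R : Type*} [CommRing R] (ξ η : Fin n ⊕ Fin n → R) : omega0 ξ η =
    ∑ j, (ξ (Sum.inr j) * η (Sum.inl j) - ξ (Sum.inl j) * η (Sum.inr j)) := by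
  simp [omega0, J, dotProduct, Matrix.fromBlocks_neg, Matrix.fromBlocks_mulVec, Matrix.neg_mulVec,
    Finset.sum_sub_distrib]
  ring

theorem omega0_mulVec {R : Type*} [CommRing R] {A : Matrix (Fin n ⊕ Fin n) (Fin n ⊕ Fin n) R}
    (hA : A ∈ symplecticGroup (Fin n) R) (ξ η : Fin n ⊕ Fin n → R) :
    omega0 (A *ᵥ ξ) (A *ᵥ η) = omega0 ξ η := by
  have h := SymplecticGroup.mem_iff'.1 hA
  unfold omega0
  rw [dotProduct_mulVec, ← mulVec_transpose, mulVec_mulVec, mulVec_mulVec, Matrix.mul_neg,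
    Matrix.neg_mul, h]

theorem toComplex_mem (M : Sp n) : toComplex M ∈ symplecticGroup (Fin n) ℂ :=
  SymplecticGroup.map_mem M.2 Complex.ofRealHom

theorem star_toComplex_mulVec (M : Sp n) (ξ : Fin n ⊕ Fin n → ℂ) :
    star (toComplex M *ᵥ ξ) = toComplex M *ᵥ star ξ := by
  ext i
  simp [mulVec, dotProduct, toComplex]

/-- The Hermitian form `-i ω₀(x̄, y)`. -/
def kreinB (n : ℕ) : (Fin n ⊕ Fin n → ℂ) →ₗ⋆[ℂ] (Fin n ⊕ Fin n → ℂ) →ₗ[ℂ] ℂ :=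
  LinearMap.mk₂'ₛₗ (starRingEnd ℂ) (RingHom.id ℂ) (fun x y => -Complex.I * omega0 (star x) y)
    (fun x y z => by simp only [omega0, star_add, mulVec_add, add_dotProduct]; ring)
    (fun c x y => by
      simp only [omega0, star_smul, mulVec_smul, smul_dotProduct, smul_eq_mul, Complex.star_def]
      ring)
    (fun x y z => by simp only [omega0, dotProduct_add]; ring)
    (fun c x y => by
      simp only [omega0, dotProduct_smul, smul_eq_mul, RingHom.id_apply]
      ring)

theorem kreinB_apply (x y : Fin n ⊕ Fin n → ℂ) :
    kreinB n x y = -Complex.I * omega0 (star x) y := rfl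

theorem qf_kreinB : qf (kreinB n) = kreinForm := by
  ext x
  simp [qf, kreinB_apply, kreinForm]

theorem isHerm_kreinB : IsHerm (kreinB n) := by
  intro x y
  simp only [kreinB_apply, omega0_eq, star_mul', star_neg, star_sum, star_sub, Pi.star_apply,
    Complex.star_def, Complex.conj_I, Complex.conj_conj, Finset.mul_sum]
  exact Finset.sum_congr rfl fun j _ => by ring

theorem nondegOn_kreinB : NondegOn (kreinB n) ⊤ := by
  intro x _ h
  have h' : ∀ y, omega0 (star x) y = 0 := fun y => by
    have := h y trivial
    rw [kreinB_apply] at this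
    simpa using this
  ext i
  rcases i with j | j
  · have := h' (Pi.single (Sum.inr j) 1)
    simpa [omega0_eq, Pi.single_apply] using this
  · have := h' (Pi.single (Sum.inl j) 1)
    simpa [omega0_eq, Pi.single_apply] using this

/-- A symplectic matrix as an endomorphism of `ℂ²ⁿ`. -/
abbrev toEnd (M : Sp n) : End ℂ (Fin n ⊕ Fin n → ℂ) := Matrix.toLin' (toComplex M)

theorem kreinB_isometry (M : Sp n) (x y : Fin n ⊕ Fin n → ℂ) :
    kreinB n (toEnd M x) (toEnd M y) = kreinB n x y := by
  simp only [kreinB_apply, toEnd, toLin'_apply, star_toComplex_mulVec,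
    omega0_mulVec (toComplex_mem M)]

theorem mPlus_eq_posIndex (M : Sp n) (z : ℂ) :
    mPlus M z = posIndex kreinForm (genEigenspace M z) := rfl

theorem finrank_genEigenspace (M : Sp n) (z : ℂ) :
    finrank ℂ (genEigenspace M z) = (eigenvalues M).count z := by
  rw [genEigenspace, LinearMap.finrank_maxGenEigenspace_eq, charpoly_toLin', eigenvalues,
    Polynomial.count_roots]

theorem genEigenspace_eq_bot {M : Sp n} {z : ℂ} (h : z ∉ eigenvalues M) :
    genEigenspace M z = ⊥ := by
  rw [← Submodule.finrank_eq_zero (R := ℂ), finrank_genEigenspace, Multiset.count_eq_zero]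
  exact h

theorem star_mem_genEigenspace {M : Sp n} {z : ℂ} {ξ : Fin n ⊕ Fin n → ℂ}
    (h : ξ ∈ genEigenspace M z) : star ξ ∈ genEigenspace M (star z) := by
  obtain ⟨k, hk⟩ := (End.mem_maxGenEigenspace _ _ _).1 h
  refine (End.mem_maxGenEigenspace _ _ _).2 ⟨k, ?_⟩
  have key : ∀ j : ℕ,
      ((toEnd M - star z • (1 : End ℂ (Fin n ⊕ Fin n → ℂ))) ^ j) (star ξ) =
        star (((toEnd M - z • (1 : End ℂ (Fin n ⊕ Fin n → ℂ))) ^ j) ξ) := by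
    intro j
    induction j with
    | zero => simp
    | succ j ih =>
      rw [pow_succ', pow_succ', Module.End.mul_apply, Module.End.mul_apply, ih]
      simp [star_toComplex_mulVec]
  exact (key k).trans (by rw [hk, star_zero])

theorem posIndex_star_le {M : Sp n} {z : ℂ} {q q' : (Fin n ⊕ Fin n → ℂ) → ℝ}
    (h : ∀ ξ, 0 < q ξ → 0 < q' (star ξ)) :
    posIndex q (genEigenspace M z) ≤ posIndex q' (genEigenspace M (star z)) :=
  posIndex_map_le (starAddEquiv : (Fin n ⊕ Fin n → ℂ) ≃+ _).toAddMonoidHom starRingAut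
    (fun c ξ => star_smul c ξ) (starAddEquiv : (Fin n ⊕ Fin n → ℂ) ≃+ _).injective
    (fun _ hξ => star_mem_genEigenspace hξ) (fun ξ _ => h ξ)

theorem kreinForm_star (ξ : Fin n ⊕ Fin n → ℂ) : kreinForm (star ξ) = -kreinForm ξ := by
  simp only [kreinForm, omega0_eq, star_star, Complex.im_sum, ← Finset.sum_neg_distrib]
  refine Finset.sum_congr rfl fun j _ => ?_
  simp
  ring

theorem mPlus_star (M : Sp n) (z : ℂ) :
    mPlus M (star z) = posIndex (-kreinForm) (genEigenspace M z) := by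
  refine le_antisymm ?_ ?_
  · have h := posIndex_star_le (M := M) (z := star z) (q := kreinForm) (q' := -kreinForm)
      fun ξ h => by simpa [kreinForm_star] using h
    rwa [star_star] at h
  · exact posIndex_star_le fun ξ h => by simpa [kreinForm_star] using h

theorem count_star (M : Sp n) (z : ℂ) :
    (eigenvalues M).count (star z) = (eigenvalues M).count z := by
  have key : ∀ w, (eigenvalues M).count w ≤ (eigenvalues M).count (star w) := by
    intro w
    rw [← finrank_genEigenspace, ← finrank_genEigenspace]
    have h1 := le_posIndex (q := fun _ => 1) (le_refl (genEigenspace M w))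
      fun _ _ _ => one_pos
    have h2 := posIndex_star_le (M := M) (z := w) (q := fun _ => 1) (q' := fun _ => 1)
      fun _ _ => one_pos
    have h3 := posIndex_add_posIndex_neg_le (fun _ => 1) (genEigenspace M (star w))
    omega
  refine le_antisymm ?_ (key z)
  have := key (star z)
  rwa [star_star] at this

theorem genEigenspace_eq_bot_of_notMem (M : Sp n) (z : ℂ) (h : z ∉ (eigenvalues M).toFinset) :
    (toEnd M).maxGenEigenspace z = ⊥ :=
  genEigenspace_eq_bot fun h' => h (Multiset.mem_toFinset.2 h')

theorem orthoOn_genEigenspace (M : Sp n) (z w : ℂ) (h : star z * w ≠ 1) :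
    OrthoOn (kreinB n) (genEigenspace M z) (genEigenspace M w) :=
  orthoOn_maxGenEigenspace (kreinB_isometry M) h

theorem nondegOn_genEigenspace (M : Sp n) {z : ℂ} (hz : ‖z‖ = 1) :
    NondegOn (kreinB n) (genEigenspace M z) :=
  nondegOn_maxGenEigenspace (genEigenspace_eq_bot_of_notMem M) isHerm_kreinB nondegOn_kreinB
    (orthoOn_genEigenspace M) hz

theorem isSylvester_genEigenspace (M : Sp n) {z : ℂ} (hz : ‖z‖ = 1) :
    IsSylvester kreinForm (genEigenspace M z) := by
  rw [← qf_kreinB]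
  exact isHerm_kreinB.isSylvester (nondegOn_genEigenspace M hz)

theorem mPlus_add_mPlus_star (M : Sp n) {z : ℂ} (hz : ‖z‖ = 1) :
    mPlus M z + mPlus M (star z) = (eigenvalues M).count z := by
  rw [mPlus_star, mPlus_eq_posIndex, ← finrank_genEigenspace]
  exact isSylvester_genEigenspace M hz

theorem count_inv (M : Sp n) {z : ℂ} (hz : z ≠ 0) :
    (eigenvalues M).count z⁻¹ = (eigenvalues M).count z := by
  have key : ∀ w : ℂ, w ≠ 0 → (eigenvalues M).count w ≤ (eigenvalues M).count w⁻¹ := by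
    intro w hw
    have h := finrank_maxGenEigenspace_le (genEigenspace_eq_bot_of_notMem M) isHerm_kreinB
      nondegOn_kreinB (orthoOn_genEigenspace M) (z := w) (w := (star w)⁻¹)
      (mul_inv_cancel₀ (star_ne_zero.2 hw))
    have h' : finrank ℂ (genEigenspace M w) ≤ finrank ℂ (genEigenspace M (star w)⁻¹) := h
    rw [finrank_genEigenspace, finrank_genEigenspace, ← star_inv₀, count_star] at h'
    exact h'
  refine le_antisymm ?_ (key z hz)
  have := key z⁻¹ (inv_ne_zero hz)
  rwa [inv_inv] at this

theorem posIndex_kreinForm_top (n : ℕ) :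
    posIndex (kreinForm : (Fin n ⊕ Fin n → ℂ) → ℝ) ⊤ = n := by
  have h1 : IsSylvester (kreinForm : (Fin n ⊕ Fin n → ℂ) → ℝ) ⊤ := by
    rw [← qf_kreinB]
    exact isHerm_kreinB.isSylvester nondegOn_kreinB
  have h2 : ∀ q q' : (Fin n ⊕ Fin n → ℂ) → ℝ, (∀ ξ, 0 < q ξ → 0 < q' (star ξ)) →
      posIndex q ⊤ ≤ posIndex q' ⊤ := fun q q' h =>
    posIndex_map_le (starAddEquiv : (Fin n ⊕ Fin n → ℂ) ≃+ _).toAddMonoidHom starRingAut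
      (fun c ξ => star_smul c ξ) (starAddEquiv : (Fin n ⊕ Fin n → ℂ) ≃+ _).injective
      (fun _ _ => trivial) (fun ξ _ => h ξ)
  have h3 := h2 kreinForm (-kreinForm) fun ξ h => by simpa [kreinForm_star] using h
  have h4 := h2 (-kreinForm) kreinForm fun ξ h => by simpa [kreinForm_star] using h
  unfold IsSylvester at h1
  rw [finrank_top, finrank_fintype_fun_eq_card, Fintype.card_sum, Fintype.card_fin] at h1
  omega

theorem sum_firstKind (M : Sp n) :
    ∑ z ∈ (eigenvalues M).toFinset.filter (fun z => ‖z‖ < 1), (eigenvalues M).count z +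
      ∑ z ∈ (eigenvalues M).toFinset.filter (fun z => ‖z‖ = 1), mPlus M z = n := by
  have h := posIndex_top_eq (genEigenspace_eq_bot_of_notMem M) isHerm_kreinB nondegOn_kreinB
    (orthoOn_genEigenspace M)
  rw [qf_kreinB, posIndex_kreinForm_top] at h
  rw [Finset.sum_congr rfl fun z _ => (finrank_genEigenspace M z).symm]
  exact h.symm

end Krein

end MaslovType

end

noncomputable section

namespace MaslovType

open Module

variable {n : ℕ}

/-! ### Counting eigenvalues on arcs by the index of the Cayley form -/

theorem exp_sub_exp (a b : ℝ) :
    Complex.exp (Complex.I * a) - Complex.exp (Complex.I * b) =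
      2 * Complex.I * (Real.sin ((a - b) / 2) : ℝ) * Complex.exp (Complex.I * ((a + b) / 2)) := by
  rw [Complex.ofReal_sin, Complex.sin]
  have h1 : Complex.exp (Complex.I * a) = Complex.exp ((((a - b) / 2 : ℝ) : ℂ) * Complex.I) *
      Complex.exp (Complex.I * ((a + b) / 2)) := by
    rw [← Complex.exp_add]; congr 1; push_cast; ring
  have h2 : Complex.exp (Complex.I * b) = Complex.exp (-(((a - b) / 2 : ℝ) : ℂ) * Complex.I) *
      Complex.exp (Complex.I * ((a + b) / 2)) := by
    rw [← Complex.exp_add]; congr 1; push_cast; ring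
  rw [h1, h2]
  linear_combination (-Complex.exp (-(((a - b) / 2 : ℝ) : ℂ) * Complex.I)
    + Complex.exp ((((a - b) / 2 : ℝ) : ℂ) * Complex.I)) *
    Complex.exp (Complex.I * ((a + b) / 2)) * Complex.I_sq

/-- The number `e^{ia}`. -/
abbrev expI (a : ℝ) : ℂ := Complex.exp (Complex.I * a)

theorem expI_mul_star (a : ℝ) : expI a * star (expI a) = 1 := by
  rw [expI, Complex.star_def, ← Complex.exp_conj, ← Complex.exp_add]
  simp

theorem norm_expI (a : ℝ) : ‖expI a‖ = 1 := by
  rw [expI, mul_comm]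
  exact Complex.norm_exp_ofReal_mul_I a

theorem expI_arg {z : ℂ} (hz : ‖z‖ = 1) : expI z.arg = z := by
  have h := Complex.norm_mul_exp_arg_mul_I z
  rw [hz, Complex.ofReal_one, one_mul, mul_comm] at h
  exact h

theorem expI_half_sq (a : ℝ) : expI (a / 2) ^ 2 = expI a := by
  rw [expI, ← Complex.exp_nat_mul]
  congr 1
  push_cast
  ring

theorem mem_eigenvalues {M : Sp n} {z : ℂ} :
    z ∈ eigenvalues M ↔ (scalar (Fin n ⊕ Fin n) z - toComplex M).det = 0 := by
  rw [eigenvalues, Polynomial.mem_roots (charpoly_monic _).ne_zero, Polynomial.IsRoot,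
    eval_charpoly]

theorem continuous_toComplex : Continuous (toComplex : Sp n → _) :=
  Continuous.matrix_map continuous_subtype_val Complex.continuous_ofReal

theorem eventually_notMem_eigenvalues {M : Sp n} {z : ℂ} (h : z ∉ eigenvalues M) :
    ∀ᶠ M' in nhds M, z ∉ eigenvalues M' := by
  simp only [mem_eigenvalues] at *
  have hc : Continuous fun M' : Sp n => (scalar (Fin n ⊕ Fin n) z - toComplex M').det :=
    (continuous_const.sub continuous_toComplex).matrix_det
  exact hc.continuousAt.eventually_ne h

/-- The Cayley form of `M` with base point `e^{iψ}` and running point `e^{iφ}`. -/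
def cayleyAt (M : Sp n) (ψ φ : ℝ) :=
  cayleyForm (kreinB n) (toEnd M) (expI (ψ / 2)) (expI (φ / 2))

theorem isHerm_cayleyAt (M : Sp n) (ψ φ : ℝ) : IsHerm (cayleyAt M ψ φ) :=
  isHerm_cayleyForm isHerm_kreinB (kreinB_isometry M) (expI_mul_star _) (expI_mul_star _)

theorem eq_zero_of_notMem_eigenvalues {M : Sp n} {z : ℂ} (hz : z ∉ eigenvalues M)
    {x : Fin n ⊕ Fin n → ℂ} (hx : (toEnd M - z • (1 : End ℂ (Fin n ⊕ Fin n → ℂ))) x = 0) :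
    x = 0 := by
  have h : x ∈ genEigenspace M z := (End.mem_maxGenEigenspace _ _ _).2 ⟨1, by rwa [pow_one]⟩
  rw [genEigenspace_eq_bot hz] at h
  exact (Submodule.mem_bot ℂ).1 h

theorem nondegOn_cayleyAt {M : Sp n} {ψ φ : ℝ} (hψ : expI ψ ∉ eigenvalues M)
    (hφ : expI φ ∉ eigenvalues M) : NondegOn (cayleyAt M ψ φ) ⊤ := by
  intro x _ h0
  rw [← expI_half_sq] at hψ hφ
  refine eq_zero_of_notMem_eigenvalues hψ (nondegOn_kreinB _ trivial fun y _ => ?_)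
  have hsurj : Function.Surjective
      (toEnd M - expI (φ / 2) ^ 2 • (1 : End ℂ (Fin n ⊕ Fin n → ℂ))) := by
    rw [← LinearMap.injective_iff_surjective, ← LinearMap.ker_eq_bot, LinearMap.ker_eq_bot']
    exact fun m hm => eq_zero_of_notMem_eigenvalues hφ hm
  obtain ⟨y', rfl⟩ := hsurj y
  have h1 := h0 y' trivial
  rw [cayleyAt, cayleyForm, LinearMap.smul_apply, LinearMap.smul_apply, twist_apply,
    smul_eq_mul] at h1
  refine (mul_eq_zero.1 h1).resolve_left (mul_ne_zero (Complex.exp_ne_zero _) ?_)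
  exact star_ne_zero.2 (Complex.exp_ne_zero _)

theorem isSylvester_cayleyAt {M : Sp n} {ψ φ : ℝ} (hψ : expI ψ ∉ eigenvalues M)
    (hφ : expI φ ∉ eigenvalues M) : IsSylvester (qf (cayleyAt M ψ φ)) ⊤ :=
  (isHerm_cayleyAt M ψ φ).isSylvester (nondegOn_cayleyAt hψ hφ)

/-- The signature of the Krein form on the generalized eigenspace of `z`, `‖z‖ = 1`. -/
def kreinSign (M : Sp n) (z : ℂ) : ℤ := mPlus M z - mPlus M (star z)

theorem sin_half_sign {a φ : ℝ} (ha : -Real.pi < a) (ha' : a ≤ Real.pi) (h0 : 0 < φ)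
    (h1 : φ ≤ Real.pi) : (φ < a → 0 < Real.sin ((a - φ) / 2)) ∧
      (a < φ → Real.sin ((a - φ) / 2) < 0) := by
  constructor
  · intro h
    exact Real.sin_pos_of_pos_of_lt_pi (by linarith) (by linarith)
  · intro h
    exact Real.sin_neg_of_neg_of_neg_pi_lt (by linarith) (by linarith)

theorem posIndex_cayleyAt_genEigenspace {M : Sp n} {ψ φ : ℝ} (hψ0 : 0 < ψ) (hψ1 : ψ ≤ Real.pi)
    (hφ0 : 0 < φ) (hφ1 : φ ≤ Real.pi) (hψ : expI ψ ∉ eigenvalues M)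
    (hφ : expI φ ∉ eigenvalues M) {z : ℂ} (hz : ‖z‖ = 1) (hzM : z ∈ eigenvalues M) :
    (posIndex (qf (cayleyAt M ψ φ)) (genEigenspace M z) : ℤ) =
      mPlus M z - (if φ < ψ then 1 else -1) *
        ((if φ ≤ z.arg then 1 else 0) - (if ψ ≤ z.arg then 1 else 0)) * kreinSign M z := by
  set a := z.arg with ha
  have haz : expI a = z := expI_arg hz
  have h1 := Complex.neg_pi_lt_arg z
  have h2 := Complex.arg_le_pi z
  have hne1 : a ≠ ψ := by rintro h; rw [h] at haz; rw [haz] at hψ; exact hψ hzM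
  have hne2 : a ≠ φ := by rintro h; rw [h] at haz; rw [haz] at hφ; exact hφ hzM
  obtain ⟨p1, p2⟩ := sin_half_sign h1 h2 hψ0 hψ1
  obtain ⟨q1, q2⟩ := sin_half_sign h1 h2 hφ0 hφ1
  have hs : Real.sin ((a - ψ) / 2) ≠ 0 := by
    rcases lt_or_gt_of_ne hne1 with h | h
    · exact (p2 h).ne
    · exact (p1 h).ne'
  have hs' : Real.sin ((a - φ) / 2) ≠ 0 := by
    rcases lt_or_gt_of_ne hne2 with h | h
    · exact (q2 h).ne
    · exact (q1 h).ne'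
  set κ : ℝ := Real.sin ((a - φ) / 2) / Real.sin ((a - ψ) / 2) with hκ
  have e1 : z - expI (ψ / 2) ^ 2 = 2 * Complex.I * (Real.sin ((a - ψ) / 2) : ℝ) *
      Complex.exp (Complex.I * ((a + ψ) / 2)) := by
    rw [expI_half_sq, ← exp_sub_exp, ← haz]
  have e2 : z - expI (φ / 2) ^ 2 = 2 * Complex.I * (Real.sin ((a - φ) / 2) : ℝ) *
      Complex.exp (Complex.I * ((a + φ) / 2)) := by
    rw [expI_half_sq, ← exp_sub_exp, ← haz]
  have e3 : expI (ψ / 2) * star (expI (φ / 2)) * Complex.exp (Complex.I * ((a + φ) / 2)) =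
      Complex.exp (Complex.I * ((a + ψ) / 2)) := by
    rw [expI, expI, Complex.star_def, ← Complex.exp_conj, ← Complex.exp_add, ← Complex.exp_add]
    congr 1
    simp only [map_mul, Complex.conj_I, Complex.conj_ofReal]
    push_cast
    ring
  have hsC : ((Real.sin ((a - ψ) / 2) : ℝ) : ℂ) ≠ 0 := by exact_mod_cast hs
  have key := posIndex_cayleyForm isHerm_kreinB (isHerm_cayleyAt M ψ φ) (z := z) (κ := κ)
    (div_ne_zero hs' hs)
    (by
      rw [e1, e2, ← e3, hκ, Complex.ofReal_div]
      field_simp)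
    (by
      rw [e1]
      refine mul_ne_zero (mul_ne_zero (by simp) hsC) (Complex.exp_ne_zero _))
    (nondegOn_genEigenspace M hz)
  have key' : posIndex (qf (cayleyAt M ψ φ)) (genEigenspace M z) =
      posIndex (κ • kreinForm) (genEigenspace M z) := by
    rw [← qf_kreinB]; exact key
  rw [key', kreinSign, mPlus_star, mPlus_eq_posIndex]
  have hpos : 0 < κ → posIndex (κ • kreinForm) (genEigenspace M z) =
      posIndex kreinForm (genEigenspace M z) := fun h =>
    posIndex_congr fun ξ _ => by simp [h]
  have hneg : κ < 0 → posIndex (κ • kreinForm) (genEigenspace M z) =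
      posIndex (-kreinForm) (genEigenspace M z) := fun h =>
    posIndex_congr fun ξ _ => by simp [mul_pos_iff, h, h.not_gt]
  rcases lt_or_gt_of_ne hne1 with h3 | h3 <;> rcases lt_or_gt_of_ne hne2 with h4 | h4
  · rw [hpos (div_pos_of_neg_of_neg (q2 h4) (p2 h3)), if_neg h4.not_ge, if_neg h3.not_ge]
    ring
  · rw [hneg (div_neg_of_pos_of_neg (q1 h4) (p2 h3)), if_pos h4.le, if_neg h3.not_ge,
      if_pos (h4.trans h3)]
    ring
  · rw [hneg (div_neg_of_neg_of_pos (q2 h4) (p1 h3)), if_neg h4.not_ge, if_pos h3.le,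
      if_neg (h3.trans h4).not_gt]
    ring
  · rw [hpos (div_pos (q1 h4) (p1 h3)), if_pos h4.le, if_pos h3.le]
    ring

/-- The eigenvalues on the open upper half of the unit circle. -/
def upper (M : Sp n) : Finset ℂ := (eigenvalues M).toFinset.filter fun z => ‖z‖ = 1 ∧ 0 < z.im

theorem arg_of_mem_upper {M : Sp n} {z : ℂ} (hz : z ∈ upper M) : 0 < z.arg ∧ z.arg < Real.pi := by
  have h := (Finset.mem_filter.1 hz).2.2
  refine ⟨(Complex.arg_nonneg_iff.2 h.le).lt_of_ne fun h0 => ?_,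
    (Complex.arg_le_pi z).lt_of_ne fun h0 => ?_⟩
  · exact h.ne' (Complex.arg_eq_zero_iff.1 h0.symm).2
  · exact h.ne' (Complex.arg_eq_pi_iff.1 h0).2

/-- The signed number of eigenvalues on the arc between `e^{iφ}` and `e^{iψ}`. -/
def arcCount (M : Sp n) (ψ φ : ℝ) : ℝ :=
  ∑ z ∈ upper M, (kreinSign M z : ℝ) *
    ((if φ ≤ z.arg then 1 else 0) - (if ψ ≤ z.arg then 1 else 0))

theorem arcCount_eq {M : Sp n} {ψ φ : ℝ} (hψ0 : 0 < ψ) (hψ1 : ψ ≤ Real.pi)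
    (hφ0 : 0 < φ) (hφ1 : φ ≤ Real.pi) (hψ : expI ψ ∉ eigenvalues M)
    (hφ : expI φ ∉ eigenvalues M) :
    arcCount M ψ φ = (if φ < ψ then 1 else -1) * ((n : ℝ) - posIndex (qf (cayleyAt M ψ φ)) ⊤) := by
  have h1 := posIndex_top_eq (genEigenspace_eq_bot_of_notMem M) (isHerm_cayleyAt M ψ φ)
    (nondegOn_cayleyAt hψ hφ) (fun z w h x hx y hy => by
      rw [cayleyAt, cayleyForm, LinearMap.smul_apply, LinearMap.smul_apply, twist_apply,
        orthoOn_genEigenspace M z w h _ (sub_mem_maxGenEigenspace _ _ _ hx) _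
          (sub_mem_maxGenEigenspace _ _ _ hy), smul_zero])
  have h2 := sum_firstKind M
  rw [Finset.sum_congr rfl fun z _ => (finrank_genEigenspace M z).symm] at h2
  have h3 : (n : ℤ) - posIndex (qf (cayleyAt M ψ φ)) ⊤ =
      ∑ z ∈ (eigenvalues M).toFinset.filter (fun z => ‖z‖ = 1), (if φ < ψ then 1 else -1) *
        ((if φ ≤ z.arg then 1 else 0) - (if ψ ≤ z.arg then 1 else 0)) * kreinSign M z := by
    have h4 : ∀ z ∈ (eigenvalues M).toFinset.filter (fun z => ‖z‖ = 1),
        (if φ < ψ then 1 else -1) *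
        ((if φ ≤ z.arg then 1 else 0) - (if ψ ≤ z.arg then 1 else 0)) * kreinSign M z =
        mPlus M z - (posIndex (qf (cayleyAt M ψ φ)) (genEigenspace M z) : ℤ) := by
      intro z hz
      rw [Finset.mem_filter, Multiset.mem_toFinset] at hz
      rw [posIndex_cayleyAt_genEigenspace hψ0 hψ1 hφ0 hφ1 hψ hφ hz.2 hz.1]
      ring
    rw [Finset.sum_congr rfl h4, Finset.sum_sub_distrib, h1]
    have h2' := congrArg (Nat.cast : ℕ → ℤ) h2
    unfold genEigenspace at h2' ⊢
    push_cast at h2' ⊢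
    linarith
  have h5 : ∑ z ∈ (eigenvalues M).toFinset.filter (fun z => ‖z‖ = 1), (if φ < ψ then 1 else -1) *
        ((if φ ≤ z.arg then 1 else 0) - (if ψ ≤ z.arg then 1 else 0)) * kreinSign M z =
      ∑ z ∈ upper M, (if φ < ψ then 1 else -1) *
        ((if φ ≤ z.arg then 1 else 0) - (if ψ ≤ z.arg then 1 else 0)) * kreinSign M z := by
    symm
    refine Finset.sum_subset ?_ ?_
    · intro z hz
      simp only [upper, Finset.mem_filter] at hz ⊢
      exact ⟨hz.1, hz.2.1⟩
    · intro z hz hzU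
      simp only [upper, Finset.mem_filter, not_and, not_lt] at hz hzU
      have him := hzU hz.1 hz.2
      rcases him.lt_or_eq with him | him
      · have := Complex.arg_neg_iff.2 him
        rw [if_neg (show ¬ φ ≤ z.arg by linarith), if_neg (show ¬ ψ ≤ z.arg by linarith)]
        ring
      · have : kreinSign M z = 0 := by
          have : star z = z := by
            rw [Complex.star_def, Complex.conj_eq_iff_im, him]
          rw [kreinSign, this, sub_self]
        rw [this, mul_zero]
  rw [h5] at h3
  have h6 : ((n : ℝ) - posIndex (qf (cayleyAt M ψ φ)) ⊤) = (if φ < ψ then 1 else -1) *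
      arcCount M ψ φ := by
    have := congrArg (fun k : ℤ => (k : ℝ)) h3
    push_cast at this
    rw [this, arcCount, Finset.mul_sum]
    exact Finset.sum_congr rfl fun z _ => by ring
  rw [h6]
  split_ifs <;> ring

theorem abs_kreinSign_le {M : Sp n} {z : ℂ} (hz : ‖z‖ = 1) :
    |(kreinSign M z : ℝ)| ≤ (eigenvalues M).count z := by
  rw [← mPlus_add_mPlus_star M hz, kreinSign]
  push_cast
  rw [abs_le]
  constructor <;> linarith [(mPlus M z).cast_nonneg (α := ℝ),
    (mPlus M (star z)).cast_nonneg (α := ℝ)]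

theorem abs_arcCount_le (M : Sp n) (ψ φ : ℝ) : |arcCount M ψ φ| ≤ 2 * n := by
  have h1 : |arcCount M ψ φ| ≤ ∑ z ∈ upper M, ((eigenvalues M).count z : ℝ) := by
    refine (Finset.abs_sum_le_sum_abs _ _).trans (Finset.sum_le_sum fun z hz => ?_)
    rw [abs_mul]
    have h2 := abs_kreinSign_le (M := M) (Finset.mem_filter.1 hz).2.1
    have h3 : |(if φ ≤ z.arg then (1 : ℝ) else 0) - (if ψ ≤ z.arg then 1 else 0)| ≤ 1 := by
      split_ifs <;> norm_num
    calc _ ≤ ((eigenvalues M).count z : ℝ) * 1 :=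
          mul_le_mul h2 h3 (abs_nonneg _) (Nat.cast_nonneg _)
      _ = _ := mul_one _
  have h2 : ∑ z ∈ upper M, (eigenvalues M).count z ≤ 2 * n := by
    calc _ ≤ ∑ z ∈ (eigenvalues M).toFinset, (eigenvalues M).count z :=
          Finset.sum_le_sum_of_subset (Finset.filter_subset _ _)
      _ = (eigenvalues M).card := Multiset.toFinset_sum_count_eq _
      _ ≤ (toComplex M).charpoly.natDegree := Polynomial.card_roots' _
      _ = 2 * n := by rw [charpoly_natDegree_eq_dim, Fintype.card_sum, Fintype.card_fin]; ring
  refine h1.trans ?_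
  exact_mod_cast h2

theorem measurable_arcCount (M : Sp n) (ψ : ℝ) : Measurable (arcCount M ψ) := by
  unfold arcCount
  refine Finset.measurable_fun_sum _ fun z _ => ?_
  refine Measurable.const_mul (Measurable.sub_const ?_ _) _
  exact Measurable.ite measurableSet_Iic measurable_const measurable_const

/-- The sum of the angles of the eigenvalues of `M` on the upper half circle, counted with Krein
signature, the angles beyond `ψ` being shifted by `-π`. -/
def angleSum (M : Sp n) (ψ : ℝ) : ℝ :=
  ∑ z ∈ upper M, (kreinSign M z : ℝ) * (z.arg - if ψ ≤ z.arg then Real.pi else 0)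

theorem integral_arcCount (M : Sp n) (ψ : ℝ) :
    ∫ φ in (0 : ℝ)..Real.pi, arcCount M ψ φ = angleSum M ψ := by
  unfold arcCount angleSum
  have hI : ∀ a : ℝ, IntervalIntegrable (fun φ : ℝ => if φ ≤ a then (1 : ℝ) else 0)
      MeasureTheory.volume 0 Real.pi := by
    intro a
    have hA : Antitone fun φ : ℝ => if φ ≤ a then (1 : ℝ) else 0 := by
      intro x y hxy
      dsimp only
      split_ifs <;> linarith
    exact hA.intervalIntegrable
  rw [intervalIntegral.integral_finsetSum fun z _ =>
    ((hI z.arg).sub intervalIntegrable_const).const_mul _]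
  refine Finset.sum_congr rfl fun z hz => ?_
  obtain ⟨h1, h2⟩ := arg_of_mem_upper hz
  rw [intervalIntegral.integral_const_mul, intervalIntegral.integral_sub (hI _)
    intervalIntegrable_const, intervalIntegral.integral_const]
  have h3 := intervalIntegral.integral_indicator (μ := MeasureTheory.volume)
    (f := fun _ : ℝ => (1 : ℝ)) (a₁ := 0) (a₂ := z.arg) (a₃ := Real.pi) ⟨h1.le, h2.le⟩
  have h4 : ∫ φ in (0 : ℝ)..Real.pi, (if φ ≤ z.arg then (1 : ℝ) else 0) = z.arg := by
    rw [intervalIntegral.integral_const] at h3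
    refine Eq.trans ?_ (h3.trans (by simp))
    rfl
  rw [h4]
  congr 2
  split_ifs <;> simp

theorem continuous_qf_cayleyAt (ψ φ : ℝ) :
    Continuous fun p : Sp n × (Fin n ⊕ Fin n → ℂ) => qf (cayleyAt p.1 ψ φ) p.2 := by
  have h : Continuous fun p : Sp n × (Fin n ⊕ Fin n → ℂ) => toComplex p.1 *ᵥ p.2 :=
    Continuous.matrix_mulVec (continuous_toComplex.comp continuous_fst) continuous_snd
  simp only [qf, cayleyAt, cayleyForm, LinearMap.smul_apply, twist_apply, smul_eq_mul,
    kreinB_apply, omega0_eq, LinearMap.sub_apply, toEnd, toLin'_apply, End.one_apply]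
  fun_prop

theorem eventually_arcCount_eq {M : Sp n} {ψ φ : ℝ} (hψ0 : 0 < ψ) (hψ1 : ψ ≤ Real.pi)
    (hφ0 : 0 < φ) (hφ1 : φ ≤ Real.pi) (hψ : expI ψ ∉ eigenvalues M)
    (hφ : expI φ ∉ eigenvalues M) : ∀ᶠ M' in nhds M, arcCount M' ψ φ = arcCount M ψ φ := by
  filter_upwards [eventually_notMem_eigenvalues hψ, eventually_notMem_eigenvalues hφ,
    eventually_posIndex_eq (q := fun M : Sp n => qf (cayleyAt M ψ φ)) (continuous_qf_cayleyAt ψ φ)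
      (fun M => qf_smul _) ⊤ M (isSylvester_cayleyAt hψ hφ)] with M' h1 h2 h3
  rw [arcCount_eq hψ0 hψ1 hφ0 hφ1 hψ hφ, arcCount_eq hψ0 hψ1 hφ0 hφ1 h1 h2, h3]

instance : FirstCountableTopology (Sp n) :=
  haveI : FirstCountableTopology (Matrix (Fin n ⊕ Fin n) (Fin n ⊕ Fin n) ℝ) :=
    inferInstanceAs (FirstCountableTopology (Fin n ⊕ Fin n → Fin n ⊕ Fin n → ℝ))
  Topology.IsInducing.subtypeVal.firstCountableTopology

/-- The angle sum is continuous where its base point is not an eigenvalue. -/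
theorem continuousAt_angleSum {M : Sp n} {ψ : ℝ} (hψ0 : 0 < ψ) (hψ1 : ψ ≤ Real.pi)
    (hψ : expI ψ ∉ eigenvalues M) : ContinuousAt (fun M' : Sp n => angleSum M' ψ) M := by
  simp_rw [← integral_arcCount]
  refine intervalIntegral.continuousAt_of_dominated_interval (bound := fun _ => 2 * n)
    (Filter.Eventually.of_forall fun M' => (measurable_arcCount M' ψ).aestronglyMeasurable)
    (Filter.Eventually.of_forall fun M' => Filter.Eventually.of_forall fun φ _ => ?_)
    intervalIntegrable_const ?_
  · exact abs_arcCount_le M' ψ φ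
  · have hfin : ((upper M).image Complex.arg : Set ℝ).Finite := Finset.finite_toSet _
    filter_upwards [hfin.countable.ae_notMem MeasureTheory.volume,
      (Set.countable_singleton Real.pi).ae_notMem MeasureTheory.volume] with φ hφ hπ hmem
    rw [Set.uIoc_of_le Real.pi_pos.le] at hmem
    have hπ' : φ < Real.pi := hmem.2.lt_of_ne hπ
    have hφM : expI φ ∉ eigenvalues M := by
      intro h
      have harg : (expI φ).arg = φ := by
        rw [expI, mul_comm, Complex.arg_exp_mul_I]
        exact (toIocMod_eq_self _).2 ⟨by linarith [hmem.1, Real.pi_pos], by linarith⟩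
      apply hφ
      rw [Finset.mem_coe, Finset.mem_image]
      refine ⟨expI φ, ?_, harg⟩
      rw [upper, Finset.mem_filter, Multiset.mem_toFinset]
      refine ⟨h, norm_expI φ, ?_⟩
      rw [expI, mul_comm, Complex.exp_ofReal_mul_I_im]
      exact Real.sin_pos_of_pos_of_lt_pi hmem.1 hπ'
    exact (tendsto_const_nhds.congr' ((eventually_arcCount_eq hψ0 hψ1 hmem.1 hmem.2 hψ hφM).mono
      fun M' h => h.symm) : Filter.Tendsto _ (nhds M) (nhds (arcCount M ψ φ)))

end MaslovType

end

noncomputable section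

namespace MaslovType

open Module

variable {n : ℕ}

/-! ### Products over the spectrum -/

/-- The set of eigenvalues. -/
abbrev spec (M : Sp n) : Finset ℂ := (eigenvalues M).toFinset

theorem firstKindMult_eq (M : Sp n) (z : ℂ) : firstKindMult M z =
    if ‖z‖ = 1 then mPlus M z else if ‖z‖ < 1 then (eigenvalues M).count z else 0 := by
  unfold firstKindMult
  by_cases h : z = 1 ∨ z = -1
  · have h1 : ‖z‖ = 1 := by rcases h with rfl | rfl <;> simp
    have h2 : star z = z := by rcases h with rfl | rfl <;> simp
    have h3 := mPlus_add_mPlus_star M h1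
    rw [h2] at h3
    rw [if_pos h, if_pos h1]
    omega
  · rw [if_neg h]

theorem ne_zero_of_mem_spec {M : Sp n} {z : ℂ} (h : z ∈ spec M) : z ≠ 0 := by
  rintro rfl
  rw [Multiset.mem_toFinset, mem_eigenvalues, map_zero, zero_sub, Matrix.det_neg] at h
  refine mul_ne_zero (pow_ne_zero _ (by simp)) ?_ h
  exact (SymplecticGroup.symplectic_det (toComplex_mem M)).ne_zero

theorem mem_spec_iff {M : Sp n} {z : ℂ} : z ∈ spec M ↔ (eigenvalues M).count z ≠ 0 := by
  rw [Multiset.mem_toFinset, Multiset.count_ne_zero]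

theorem star_mem_spec {M : Sp n} {z : ℂ} (h : z ∈ spec M) : star z ∈ spec M := by
  rw [mem_spec_iff] at *
  rwa [count_star]

theorem inv_mem_spec {M : Sp n} {z : ℂ} (h : z ∈ spec M) : z⁻¹ ∈ spec M := by
  have h0 := ne_zero_of_mem_spec h
  rw [mem_spec_iff] at *
  rwa [count_inv M h0]

theorem inv_eq_star {z : ℂ} (hz : ‖z‖ = 1) : z⁻¹ = star z := by
  rw [Complex.inv_def, Complex.normSq_eq_norm_sq, hz]
  simp

theorem firstKindMult_add_inv {M : Sp n} {z : ℂ} (hz : z ∈ spec M) :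
    firstKindMult M z + firstKindMult M z⁻¹ = (eigenvalues M).count z := by
  have h0 := ne_zero_of_mem_spec hz
  have hp : 0 < ‖z‖ := norm_pos_iff.2 h0
  rw [firstKindMult_eq, firstKindMult_eq, norm_inv, count_inv M h0]
  rcases lt_trichotomy ‖z‖ 1 with h | h | h
  · have h1 := (one_lt_inv₀ hp).2 h
    rw [if_neg h.ne, if_pos h, if_neg h1.ne', if_neg h1.not_gt, add_zero]
  · rw [if_pos h, h, inv_one, if_pos rfl, inv_eq_star h, mPlus_add_mPlus_star M h]
  · have h1 := inv_lt_one_of_one_lt₀ h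
    rw [if_neg h.ne', if_neg h.not_gt, if_neg h1.ne, if_pos h1, zero_add]

theorem sum_firstKindMult (M : Sp n) : ∑ z ∈ spec M, firstKindMult M z = n := by
  conv_rhs => rw [← sum_firstKind M]
  rw [Finset.sum_filter, Finset.sum_filter, ← Finset.sum_add_distrib]
  refine Finset.sum_congr rfl fun z _ => ?_
  rw [firstKindMult_eq]
  rcases lt_trichotomy ‖z‖ 1 with h | h | h
  · simp [h, h.ne]
  · simp [h]
  · simp [h.ne', h.not_gt]

theorem prod_pow_count {G : Type*} [CommMonoid G] (M : Sp n) (f : ℂ → G) :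
    ∏ z ∈ spec M, f z ^ (eigenvalues M).count z =
      ∏ z ∈ spec M, (f z * f z⁻¹) ^ firstKindMult M z := by
  simp_rw [mul_pow]
  rw [Finset.prod_mul_distrib]
  have h : ∏ z ∈ spec M, f z⁻¹ ^ firstKindMult M z = ∏ z ∈ spec M, f z ^ firstKindMult M z⁻¹ :=
    Finset.prod_nbij' (fun z => z⁻¹) (fun z => z⁻¹) (fun z hz => inv_mem_spec hz)
      (fun z hz => inv_mem_spec hz) (fun z _ => inv_inv z) (fun z _ => inv_inv z)
      (fun z _ => by rw [inv_inv])
  rw [h, ← Finset.prod_mul_distrib]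
  refine Finset.prod_congr rfl fun z hz => ?_
  rw [← pow_add, firstKindMult_add_inv hz]

/-- Products over the spectrum, grouped in complex conjugate pairs. -/
@[to_additive /-- Sums over the spectrum, grouped in complex conjugate pairs. -/]
theorem prod_spec_eq {G : Type*} [CommMonoid G] (M : Sp n) (f : ℂ → G) :
    ∏ z ∈ spec M, f z = (∏ z ∈ (spec M).filter (fun z => 0 < z.im), f z * f (star z)) *
      ∏ z ∈ (spec M).filter (fun z => z.im = 0), f z := by
  have h1 : ∏ z ∈ (spec M).filter (fun z => 0 < z.im), f (star z) =
      ∏ z ∈ (spec M).filter (fun z => z.im < 0), f z := by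
    refine Finset.prod_nbij' star star ?_ ?_ (fun z _ => star_star z) (fun z _ => star_star z)
      (fun z _ => rfl)
    · intro z hz
      rw [Finset.mem_filter] at *
      exact ⟨star_mem_spec hz.1, by simpa using hz.2⟩
    · intro z hz
      rw [Finset.mem_filter] at *
      exact ⟨star_mem_spec hz.1, by simpa using hz.2⟩
  rw [Finset.prod_mul_distrib, h1, Finset.prod_filter, Finset.prod_filter, Finset.prod_filter,
    ← Finset.prod_mul_distrib, ← Finset.prod_mul_distrib]
  refine Finset.prod_congr rfl fun z _ => ?_
  rcases lt_trichotomy z.im 0 with h | h | h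
  · simp [h, h.ne, h.not_gt]
  · simp [h]
  · simp [h, h.ne', h.not_gt]

theorem firstKindMult_star {M : Sp n} {z : ℂ} (hz : ‖z‖ ≠ 1) :
    firstKindMult M (star z) = firstKindMult M z := by
  rw [firstKindMult_eq, firstKindMult_eq, norm_star, if_neg hz, if_neg hz, count_star]

theorem mZero_eq (M : Sp n) :
    mZero M = ∑ z ∈ (spec M).filter (fun z => z.im = 0 ∧ z.re < 0), firstKindMult M z := by
  unfold mZero
  have h1 : ((eigenvalues M).filter fun z => z.im = 0 ∧ z.re < 0).card =
      ∑ z ∈ (spec M).filter (fun z => z.im = 0 ∧ z.re < 0), (eigenvalues M).count z := by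
    rw [← Multiset.toFinset_sum_count_eq, Multiset.toFinset_filter]
    exact Finset.sum_congr rfl fun z hz => Multiset.count_filter_of_pos (Finset.mem_filter.1 hz).2
  have h2 : ∑ z ∈ (spec M).filter (fun z => z.im = 0 ∧ z.re < 0), firstKindMult M z⁻¹ =
      ∑ z ∈ (spec M).filter (fun z => z.im = 0 ∧ z.re < 0), firstKindMult M z := by
    have key : ∀ z ∈ (spec M).filter (fun z => z.im = 0 ∧ z.re < 0),
        z⁻¹ ∈ (spec M).filter (fun z => z.im = 0 ∧ z.re < 0) := by
      intro z hz
      rw [Finset.mem_filter] at *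
      refine ⟨inv_mem_spec hz.1, by simp [hz.2.1], ?_⟩
      rw [Complex.inv_re]
      exact div_neg_of_neg_of_pos hz.2.2 (Complex.normSq_pos.2 (ne_zero_of_mem_spec hz.1))
    exact Finset.sum_nbij' (fun z => z⁻¹) (fun z => z⁻¹) key key (fun z _ => inv_inv z)
      (fun z _ => inv_inv z) (fun z _ => rfl)
  have h3 : ∑ z ∈ (spec M).filter (fun z => z.im = 0 ∧ z.re < 0), (eigenvalues M).count z =
      ∑ z ∈ (spec M).filter (fun z => z.im = 0 ∧ z.re < 0), firstKindMult M z +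
      ∑ z ∈ (spec M).filter (fun z => z.im = 0 ∧ z.re < 0), firstKindMult M z⁻¹ := by
    rw [← Finset.sum_add_distrib]
    exact Finset.sum_congr rfl fun z hz => (firstKindMult_add_inv (Finset.mem_filter.1 hz).1).symm
  omega

theorem div_norm_of_im_eq_zero {z : ℂ} (h0 : z ≠ 0) (h : z.im = 0) :
    z / (‖z‖ : ℂ) = if z.re < 0 then -1 else 1 := by
  have hz : z = (z.re : ℂ) := Complex.ext rfl (by simp [h])
  have hr : z.re ≠ 0 := by rintro h'; rw [h'] at hz; exact h0 (by simpa using hz)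
  rw [hz, Complex.norm_real, Complex.ofReal_re]
  split_ifs with hlt
  · rw [Real.norm_of_nonpos hlt.le, Complex.ofReal_neg, div_neg, div_self (by exact_mod_cast hr)]
  · rw [Real.norm_of_nonneg (not_lt.1 hlt), div_self (by exact_mod_cast hr)]

/-- `ρ(M)` is the product of the normalized eigenvalues of the first kind. -/
theorem rho_eq_prod (M : Sp n) :
    rho M = ∏ z ∈ spec M, (z / (‖z‖ : ℂ)) ^ firstKindMult M z := by
  have h1 : ∏ z ∈ (spec M).filter (fun z => ‖z‖ = 1 ∧ z ≠ 1 ∧ z ≠ -1), z ^ mPlus M z =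
      ∏ z ∈ (spec M).filter (fun z => 0 < z.im), (z / (‖z‖ : ℂ)) ^ firstKindMult M z *
        (star z / (‖star z‖ : ℂ)) ^ firstKindMult M (star z) := by
    rw [Finset.prod_filter, prod_spec_eq]
    have h2 : ∏ z ∈ (spec M).filter (fun z => z.im = 0),
        (if ‖z‖ = 1 ∧ z ≠ 1 ∧ z ≠ -1 then z ^ mPlus M z else 1) = 1 := by
      refine Finset.prod_eq_one fun z hz => if_neg ?_
      rintro ⟨h1, h2, h3⟩
      have h4 := div_norm_of_im_eq_zero (ne_zero_of_mem_spec (Finset.mem_filter.1 hz).1)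
        (Finset.mem_filter.1 hz).2
      rw [h1, Complex.ofReal_one, div_one] at h4
      split_ifs at h4
      · exact h3 h4
      · exact h2 h4
    rw [h2, mul_one]
    refine Finset.prod_congr rfl fun z hz => ?_
    have him := (Finset.mem_filter.1 hz).2
    by_cases hn : ‖z‖ = 1
    · have hne : z ≠ 1 ∧ z ≠ -1 := by
        constructor <;> rintro rfl <;> simp at him
      have hne' : star z ≠ 1 ∧ star z ≠ -1 := by
        refine ⟨fun h => hne.1 ?_, fun h => hne.2 ?_⟩
        · simpa using congrArg star h
        · simpa using congrArg star h
      rw [if_pos ⟨hn, hne⟩, if_pos ⟨by rwa [norm_star], hne'⟩, firstKindMult_eq, firstKindMult_eq,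
        norm_star, if_pos hn, if_pos hn, hn, Complex.ofReal_one, div_one, div_one]
    · rw [if_neg (fun h => hn h.1), if_neg (fun h => hn (by rw [← h.1, norm_star])),
        firstKindMult_star hn, ← mul_pow, norm_star, div_mul_div_comm, Complex.star_def,
        Complex.mul_conj', ← sq (‖z‖ : ℂ), div_self, one_pow, one_mul]
      have := norm_ne_zero_iff.2 (ne_zero_of_mem_spec (Finset.mem_filter.1 hz).1)
      exact pow_ne_zero _ (by exact_mod_cast this)
  have h3 : ∏ z ∈ (spec M).filter (fun z => z.im = 0), (z / (‖z‖ : ℂ)) ^ firstKindMult M z =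
      (-1) ^ mZero M := by
    rw [mZero_eq, ← Finset.prod_pow_eq_pow_sum, ← Finset.filter_filter,
      Finset.prod_filter (s := (spec M).filter fun z => z.im = 0)]
    refine Finset.prod_congr rfl fun z hz => ?_
    rw [div_norm_of_im_eq_zero (ne_zero_of_mem_spec (Finset.mem_filter.1 hz).1)
      (Finset.mem_filter.1 hz).2]
    split_ifs <;> simp
  rw [rho, h1, prod_spec_eq M fun z => (z / (‖z‖ : ℂ)) ^ firstKindMult M z, h3, mul_comm]

theorem eval_det_eq_prod (M : Sp n) (w : ℂ) :
    (scalar (Fin n ⊕ Fin n) w - toComplex M).det =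
      ∏ z ∈ spec M, (w - z) ^ (eigenvalues M).count z := by
  rw [← eval_charpoly, (IsAlgClosed.splits _).eval_eq_prod_roots_of_monic (charpoly_monic _),
    Finset.prod_multiset_map_count]
  rfl

/-- The normalized characteristic function `w̄ⁿ det(w - M)`, `w = e^{iψ}`. -/
def charFun (M : Sp n) (ψ : ℝ) : ℂ :=
  star (expI ψ) ^ n * (scalar (Fin n ⊕ Fin n) (expI ψ) - toComplex M).det

theorem charFun_ne_zero {M : Sp n} {ψ : ℝ} (hψ : expI ψ ∉ eigenvalues M) : charFun M ψ ≠ 0 := by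
  rw [mem_eigenvalues] at hψ
  exact mul_ne_zero (pow_ne_zero _ (star_ne_zero.2 (Complex.exp_ne_zero _))) hψ

theorem continuous_charFun (ψ : ℝ) : Continuous fun M : Sp n => charFun M ψ :=
  continuous_const.mul (continuous_const.sub continuous_toComplex).matrix_det

theorem charFun_eq_prod (M : Sp n) (ψ : ℝ) :
    charFun M ψ = ∏ z ∈ spec M, (2 * Real.cos ψ - (z + z⁻¹)) ^ firstKindMult M z := by
  have h1 : star (expI ψ) ^ n = ∏ z ∈ spec M, star (expI ψ) ^ firstKindMult M z := by
    rw [Finset.prod_pow_eq_pow_sum, sum_firstKindMult]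
  have h2 : 2 * (Real.cos ψ : ℂ) = expI ψ + star (expI ψ) := by
    rw [Complex.star_def, Complex.add_conj, expI, mul_comm Complex.I, Complex.exp_ofReal_mul_I_re]
    push_cast
    ring
  rw [charFun, eval_det_eq_prod, prod_pow_count, h1, ← Finset.prod_mul_distrib]
  refine Finset.prod_congr rfl fun z hz => ?_
  rw [← mul_pow, h2]
  congr 1
  have h3 := mul_inv_cancel₀ (ne_zero_of_mem_spec hz)
  linear_combination (expI ψ - z - z⁻¹) * expI_mul_star ψ + star (expI ψ) * h3

theorem two_mul_cos_sub_ne_zero {M : Sp n} {ψ : ℝ} (hψ : expI ψ ∉ eigenvalues M) {z : ℂ}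
    (hz : z ∈ spec M) : 2 * (Real.cos ψ : ℂ) - (z + z⁻¹) ≠ 0 := by
  have h2 : 2 * (Real.cos ψ : ℂ) = expI ψ + star (expI ψ) := by
    rw [Complex.star_def, Complex.add_conj, expI, mul_comm Complex.I, Complex.exp_ofReal_mul_I_re]
    push_cast
    ring
  have h3 := mul_inv_cancel₀ (ne_zero_of_mem_spec hz)
  have h4 : 2 * (Real.cos ψ : ℂ) - (z + z⁻¹) =
      star (expI ψ) * ((expI ψ - z) * (expI ψ - z⁻¹)) := by
    rw [h2]
    linear_combination -((expI ψ - z - z⁻¹) * expI_mul_star ψ + star (expI ψ) * h3)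
  rw [h4]
  refine mul_ne_zero (star_ne_zero.2 (Complex.exp_ne_zero _)) (mul_ne_zero ?_ ?_)
  · exact sub_ne_zero.2 fun h => hψ (h ▸ Multiset.mem_toFinset.1 hz)
  · exact sub_ne_zero.2 fun h => hψ (h ▸ Multiset.mem_toFinset.1 (inv_mem_spec hz))

/-- The unit number by which an eigenvalue of the first kind contributes to `ρ(M)`, after the sign
of its factor in the characteristic function has been taken out. -/
def unitFactor (ψ : ℝ) (z : ℂ) : ℂ :=
  z / (‖z‖ : ℂ) * (-(2 * Real.cos ψ - (z + z⁻¹)) / (‖2 * (Real.cos ψ : ℂ) - (z + z⁻¹)‖ : ℂ))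

theorem unitFactor_mul_star {ψ : ℝ} {z : ℂ} (h0 : z ≠ 0)
    (hg : 2 * (Real.cos ψ : ℂ) - (z + z⁻¹) ≠ 0) : unitFactor ψ z * unitFactor ψ (star z) = 1 := by
  have e : 2 * (Real.cos ψ : ℂ) - (star z + (star z)⁻¹) =
      star (2 * (Real.cos ψ : ℂ) - (z + z⁻¹)) := by
    simp only [Complex.star_def, map_sub, map_add, map_mul, map_inv₀, Complex.conj_ofReal,
      map_ofNat]
  unfold unitFactor
  rw [e]
  set g := 2 * (Real.cos ψ : ℂ) - (z + z⁻¹)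
  have h1 : z * star z = (‖z‖ : ℂ) ^ 2 := Complex.mul_conj' z
  have h2 : g * star g = (‖g‖ : ℂ) ^ 2 := Complex.mul_conj' g
  have h3 : (‖z‖ : ℂ) ≠ 0 := by exact_mod_cast norm_ne_zero_iff.2 h0
  have h4 : (‖g‖ : ℂ) ≠ 0 := by exact_mod_cast norm_ne_zero_iff.2 hg
  rw [norm_star, norm_star]
  field_simp
  linear_combination g * star g * h1 + (‖z‖ : ℂ) ^ 2 * h2

theorem unitFactor_of_pos {ψ r : ℝ} {z : ℂ} (hr : r ≠ 0)
    (hg : 2 * (Real.cos ψ : ℂ) - (z + z⁻¹) = r) :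
    unitFactor ψ z = z / (‖z‖ : ℂ) * (if 0 < r then -1 else 1) := by
  unfold unitFactor
  have hrC : (r : ℂ) ≠ 0 := by exact_mod_cast hr
  rw [hg, Complex.norm_real]
  congr 1
  split_ifs with h
  · rw [Real.norm_of_nonneg h.le, neg_div, div_self hrC]
  · rw [Real.norm_of_nonpos (not_lt.1 h), Complex.ofReal_neg, neg_div_neg_eq, div_self hrC]

theorem unitFactor_of_im_eq_zero {ψ : ℝ} {z : ℂ} (h0 : z ≠ 0) (him : z.im = 0)
    (hg : 2 * (Real.cos ψ : ℂ) - (z + z⁻¹) ≠ 0) : unitFactor ψ z = 1 := by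
  have hz : z = (z.re : ℂ) := Complex.ext rfl (by simp [him])
  set x := z.re with hx
  have hx0 : x ≠ 0 := by rintro h'; rw [h'] at hz; exact h0 (by simpa using hz)
  have e : 2 * (Real.cos ψ : ℂ) - (z + z⁻¹) = ((2 * Real.cos ψ - (x + x⁻¹) : ℝ) : ℂ) := by
    rw [hz]; push_cast; ring
  have hr : 2 * Real.cos ψ - (x + x⁻¹) ≠ 0 := by
    intro h; rw [e, h] at hg; exact hg (by simp)
  rw [unitFactor_of_pos hr e, div_norm_of_im_eq_zero h0 him, ← hx]
  have hxi : x * x⁻¹ = 1 := mul_inv_cancel₀ hx0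
  rcases lt_or_gt_of_ne hx0 with h | h
  · have h1 : x + x⁻¹ ≤ -2 := by
      have := inv_lt_zero.2 h
      nlinarith [sq_nonneg (x + 1), sq_nonneg (x⁻¹ + 1)]
    have h2 : 0 < 2 * Real.cos ψ - (x + x⁻¹) :=
      lt_of_le_of_ne (by linarith [Real.neg_one_le_cos ψ]) hr.symm
    rw [if_pos h, if_pos h2]; norm_num
  · have h1 : 2 ≤ x + x⁻¹ := by
      have := inv_pos.2 h
      nlinarith [sq_nonneg (x - 1), sq_nonneg (x⁻¹ - 1)]
    rw [if_neg h.not_gt, if_neg (by linarith [Real.cos_le_one ψ])]; norm_num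

theorem unitFactor_upper {M : Sp n} {ψ : ℝ} (hψ0 : 0 < ψ) (hψ1 : ψ ≤ Real.pi)
    (hψ : expI ψ ∉ eigenvalues M) {z : ℂ} (hz : z ∈ upper M) :
    unitFactor ψ z = Complex.exp (Complex.I *
      ((z.arg - if ψ ≤ z.arg then Real.pi else 0 : ℝ) : ℂ)) := by
  obtain ⟨h1, h2⟩ := arg_of_mem_upper hz
  obtain ⟨hzM, hn, -⟩ := Finset.mem_filter.1 hz
  have hza := expI_arg hn
  have e : 2 * (Real.cos ψ : ℂ) - (z + z⁻¹) =
      ((2 * Real.cos ψ - 2 * Real.cos z.arg : ℝ) : ℂ) := by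
    rw [inv_eq_star hn, Complex.star_def, Complex.add_conj,
      Complex.cos_arg (ne_zero_of_mem_spec hzM),
      hn, div_one]
    push_cast; ring
  have hr : 2 * Real.cos ψ - 2 * Real.cos z.arg ≠ 0 := by
    have hg := two_mul_cos_sub_ne_zero hψ hzM
    rw [e] at hg
    exact_mod_cast hg
  rw [unitFactor_of_pos hr e, hn, Complex.ofReal_one, div_one]
  by_cases hle : ψ ≤ z.arg
  · have h3 : Real.cos z.arg ≤ Real.cos ψ :=
      Real.cos_le_cos_of_nonneg_of_le_pi hψ0.le h2.le hle
    rw [if_pos hle, if_pos (lt_of_le_of_ne (by linarith) hr.symm), Complex.ofReal_sub, mul_sub,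
      Complex.exp_sub, mul_comm Complex.I (Real.pi : ℂ), Complex.exp_pi_mul_I]
    rw [show Complex.exp (Complex.I * (z.arg : ℂ)) = z from hza]
    ring
  · have h3 : Real.cos ψ ≤ Real.cos z.arg :=
      Real.cos_le_cos_of_nonneg_of_le_pi h1.le hψ1 (not_le.1 hle).le
    rw [if_neg hle, if_neg (by linarith), sub_zero, mul_one]
    exact hza.symm

/-- The formula for `ρ` by the angle sum: near `M`, the first factor is locally constant. -/
theorem rho_eq {M : Sp n} {ψ : ℝ} (hψ0 : 0 < ψ) (hψ1 : ψ ≤ Real.pi)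
    (hψ : expI ψ ∉ eigenvalues M) :
    rho M = (-1) ^ n * (‖charFun M ψ‖ / charFun M ψ) *
      Complex.exp (Complex.I * (angleSum M ψ : ℂ)) := by
  have hg := fun z (hz : z ∈ spec M) => two_mul_cos_sub_ne_zero hψ hz
  have h1 : ∏ z ∈ spec M, unitFactor ψ z ^ firstKindMult M z =
      rho M * ((-1) ^ n * (charFun M ψ / ‖charFun M ψ‖)) := by
    have e1 : ((-1 : ℂ)) ^ n = ∏ z ∈ spec M, (-1 : ℂ) ^ firstKindMult M z := by
      rw [Finset.prod_pow_eq_pow_sum, sum_firstKindMult]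
    rw [rho_eq_prod, charFun_eq_prod, norm_prod, Complex.ofReal_prod, e1, ← Finset.prod_div_distrib,
      ← Finset.prod_mul_distrib, ← Finset.prod_mul_distrib]
    refine Finset.prod_congr rfl fun z _ => ?_
    rw [norm_pow, Complex.ofReal_pow, ← div_pow, ← mul_pow, ← mul_pow, unitFactor]
    congr 2
    ring
  have h2 : ∏ z ∈ spec M, unitFactor ψ z ^ firstKindMult M z =
      Complex.exp (Complex.I * (angleSum M ψ : ℂ)) := by
    rw [prod_spec_eq M fun z => unitFactor ψ z ^ firstKindMult M z]
    have e1 : ∏ z ∈ (spec M).filter (fun z => z.im = 0), unitFactor ψ z ^ firstKindMult M z = 1 :=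
      Finset.prod_eq_one fun z hz => by
        rw [Finset.mem_filter] at hz
        rw [unitFactor_of_im_eq_zero (ne_zero_of_mem_spec hz.1) hz.2 (hg z hz.1), one_pow]
    rw [e1, mul_one]
    have e2 : ∏ z ∈ (spec M).filter (fun z => 0 < z.im), unitFactor ψ z ^ firstKindMult M z *
        unitFactor ψ (star z) ^ firstKindMult M (star z) =
        ∏ z ∈ upper M, unitFactor ψ z ^ firstKindMult M z *
        unitFactor ψ (star z) ^ firstKindMult M (star z) := by
      symm
      refine Finset.prod_subset (fun z hz => ?_) (fun z hz hz' => ?_)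
      · simp only [upper, Finset.mem_filter] at hz ⊢
        exact ⟨hz.1, hz.2.2⟩
      · simp only [upper, Finset.mem_filter, not_and] at hz hz'
        rw [firstKindMult_star (fun h => hz' hz.1 h hz.2), ← mul_pow,
          unitFactor_mul_star (ne_zero_of_mem_spec hz.1) (hg z hz.1), one_pow]
    rw [e2, angleSum, Complex.ofReal_sum, Finset.mul_sum, Complex.exp_sum]
    refine Finset.prod_congr rfl fun z hz => ?_
    have hzM := (Finset.mem_filter.1 hz).1
    have hn := (Finset.mem_filter.1 hz).2.1
    have e3 : unitFactor ψ (star z) = (unitFactor ψ z)⁻¹ :=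
      (inv_eq_of_mul_eq_one_right (unitFactor_mul_star (ne_zero_of_mem_spec hzM) (hg z hzM))).symm
    rw [e3, unitFactor_upper hψ0 hψ1 hψ hz, firstKindMult_eq, firstKindMult_eq, norm_star,
      if_pos hn,
      if_pos hn, ← Complex.exp_neg, ← Complex.exp_nat_mul, ← Complex.exp_nat_mul, ← Complex.exp_add]
    congr 1
    rw [kreinSign]
    push_cast
    ring
  rw [h2] at h1
  have hc : charFun M ψ ≠ 0 := charFun_ne_zero hψ
  have hc' : (‖charFun M ψ‖ : ℂ) ≠ 0 := by exact_mod_cast norm_ne_zero_iff.2 hc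
  have h3 : ((-1 : ℂ) ^ n) * (-1) ^ n = 1 := by rw [← mul_pow]; norm_num
  rw [h1]
  field_simp
  linear_combination (-rho M) * h3

theorem exists_notMem_eigenvalues (M : Sp n) :
    ∃ ψ : ℝ, 0 < ψ ∧ ψ ≤ Real.pi ∧ expI ψ ∉ eigenvalues M := by
  by_contra! h
  have hinf : (Set.Ioc 0 Real.pi).Infinite := Set.Ioc_infinite Real.pi_pos
  refine hinf (Set.Finite.of_injOn (f := expI) (t := (spec M : Set ℂ)) ?_ ?_
    (Finset.finite_toSet _))
  · intro ψ hψ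
    exact Multiset.mem_toFinset.2 (h ψ hψ.1 hψ.2)
  · intro a ha b hb hab
    have harg : ∀ c ∈ Set.Ioc 0 Real.pi, (expI c).arg = c := by
      intro c hc
      rw [expI, mul_comm, Complex.arg_exp_mul_I]
      exact (toIocMod_eq_self _).2 ⟨by linarith [hc.1, Real.pi_pos], by linarith [hc.2]⟩
    rw [← harg a ha, ← harg b hb, hab]

/-- **Continuity of the Salamon–Zehnder map.** -/
theorem continuous_rho : Continuous (rho : Sp n → ℂ) := by
  rw [continuous_iff_continuousAt]
  intro M
  obtain ⟨ψ, h0, h1, hψ⟩ := exists_notMem_eigenvalues M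
  have hev : (fun M' : Sp n => (-1) ^ n * (‖charFun M' ψ‖ / charFun M' ψ) *
      Complex.exp (Complex.I * (angleSum M' ψ : ℂ))) =ᶠ[nhds M] rho := by
    filter_upwards [eventually_notMem_eigenvalues hψ] with M' hM'
    exact (rho_eq h0 h1 hM').symm
  refine ContinuousAt.congr ?_ hev
  have hc := (continuous_charFun (n := n) ψ).continuousAt (x := M)
  have hc' : ContinuousAt (fun M' : Sp n => (‖charFun M' ψ‖ : ℂ)) M :=
    Complex.continuous_ofReal.continuousAt.comp hc.norm
  have ha : ContinuousAt (fun M' : Sp n => (angleSum M' ψ : ℂ)) M :=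
    Complex.continuous_ofReal.continuousAt.comp (continuousAt_angleSum h0 h1 hψ)
  exact (continuousAt_const.mul (hc'.div hc (charFun_ne_zero hψ))).mul
    (Complex.continuous_exp.continuousAt.comp (continuousAt_const.mul ha))

theorem norm_rho (M : Sp n) : ‖rho M‖ = 1 := by
  obtain ⟨ψ, h0, h1, hψ⟩ := exists_notMem_eigenvalues M
  have hc := norm_ne_zero_iff.2 (charFun_ne_zero hψ)
  rw [rho_eq h0 h1 hψ, norm_mul, norm_mul, norm_div, norm_pow, norm_neg, norm_one, one_pow,
    Complex.norm_real, norm_norm, div_self hc, mul_comm Complex.I, Complex.norm_exp_ofReal_mul_I]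
  norm_num

end MaslovType

end

noncomputable section

namespace MaslovType

open Module

variable {n : ℕ}

/-! ### Path-connectedness of the symplectic group -/

section Omega

variable {R : Type*} [CommRing R]

theorem omega0_add_left (x y z : Fin n ⊕ Fin n → R) :
    omega0 (x + y) z = omega0 x z + omega0 y z := by
  simp only [omega0, mulVec_add, add_dotProduct]

theorem omega0_add_right (x y z : Fin n ⊕ Fin n → R) :
    omega0 x (y + z) = omega0 x y + omega0 x z := by
  simp only [omega0, dotProduct_add]

theorem omega0_sub_left (x y z : Fin n ⊕ Fin n → R) :
    omega0 (x - y) z = omega0 x z - omega0 y z := by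
  simp only [omega0, mulVec_sub, sub_dotProduct]

theorem omega0_smul_left (c : R) (x y : Fin n ⊕ Fin n → R) : omega0 (c • x) y = c * omega0 x y := by
  simp only [omega0, mulVec_smul, smul_dotProduct, smul_eq_mul]

theorem omega0_smul_right (c : R) (x y : Fin n ⊕ Fin n → R) :
    omega0 x (c • y) = c * omega0 x y := by
  simp only [omega0, dotProduct_smul, smul_eq_mul]

theorem omega0_swap (x y : Fin n ⊕ Fin n → R) : omega0 x y = -omega0 y x := by
  rw [omega0_eq, omega0_eq, ← Finset.sum_neg_distrib]
  exact Finset.sum_congr rfl fun j _ => by ring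

theorem omega0_self (x : Fin n ⊕ Fin n → R) : omega0 x x = 0 := by
  rw [omega0_eq]
  exact Finset.sum_eq_zero fun j _ => by ring

theorem mem_symplecticGroup_of_omega0 {A : Matrix (Fin n ⊕ Fin n) (Fin n ⊕ Fin n) R}
    (h : ∀ x y, omega0 (A *ᵥ x) (A *ᵥ y) = omega0 x y) : A ∈ symplecticGroup (Fin n) R := by
  rw [SymplecticGroup.mem_iff', ← neg_inj]
  have h1 : ∀ x y, ((-(Aᵀ * J (Fin n) R * A)) *ᵥ x) ⬝ᵥ y = ((-J (Fin n) R) *ᵥ x) ⬝ᵥ y := by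
    intro x y
    have := h x y
    unfold omega0 at this
    rwa [dotProduct_mulVec, ← mulVec_transpose, mulVec_mulVec, mulVec_mulVec, Matrix.mul_neg,
      Matrix.neg_mul] at this
  refine Matrix.ext_of_mulVec_single fun i => ?_
  ext j
  have := h1 (Pi.single i 1) (Pi.single j 1)
  simpa using this

end Omega

theorem exists_omega0_ne_zero {u : Fin n ⊕ Fin n → ℝ} (hu : u ≠ 0) : ∃ y, omega0 u y ≠ 0 := by
  by_contra! h
  apply hu
  ext i
  rcases i with j | j
  · simpa [omega0_eq, Pi.single_apply] using h (Pi.single (Sum.inr j) 1)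
  · simpa [omega0_eq, Pi.single_apply] using h (Pi.single (Sum.inl j) 1)

/-- The matrix of the map `x ↦ x + c ω₀(v, x) v`. -/
def transvectionMatrix (v : Fin n ⊕ Fin n → ℝ) (c : ℝ) : Matrix (Fin n ⊕ Fin n) (Fin n ⊕ Fin n) ℝ :=
  1 + c • vecMulVec v ((-J (Fin n) ℝ) *ᵥ v)

theorem transvectionMatrix_mulVec (v : Fin n ⊕ Fin n → ℝ) (c : ℝ) (x : Fin n ⊕ Fin n → ℝ) :
    transvectionMatrix v c *ᵥ x = x + (c * omega0 v x) • v := by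
  rw [transvectionMatrix, add_mulVec, one_mulVec, smul_mulVec, vecMulVec_mulVec, omega0]
  simp [smul_smul]

/-- The symplectic transvection `x ↦ x + c ω₀(v, x) v`. -/
def symplecticTransvection (v : Fin n ⊕ Fin n → ℝ) (c : ℝ) : Sp n :=
  ⟨transvectionMatrix v c, mem_symplecticGroup_of_omega0 fun x y => by
    simp only [transvectionMatrix_mulVec, omega0_add_left, omega0_add_right, omega0_smul_left,
      omega0_smul_right, omega0_self]
    rw [omega0_swap x v]
    ring⟩

theorem joined_transvection_mul (v : Fin n ⊕ Fin n → ℝ) (c : ℝ) (M : Sp n) :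
    Joined M (symplecticTransvection v c * M) := by
  have hc : Continuous fun t : unitInterval => symplecticTransvection v ((t : ℝ) * c) := by
    refine Continuous.subtype_mk ?_ _
    unfold transvectionMatrix
    fun_prop
  refine ⟨⟨⟨fun t => symplecticTransvection v ((t : ℝ) * c) * M, by fun_prop⟩, ?_, ?_⟩⟩
  · refine Subtype.ext ?_
    simp [symplecticTransvection, transvectionMatrix]
  · simp

/-- The fixed space of a symplectic matrix. -/
def fixedSpace (M : Sp n) : Submodule ℝ (Fin n ⊕ Fin n → ℝ) where
  carrier := {x | (M : Matrix _ _ ℝ) *ᵥ x = x}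
  add_mem' hx hy := by
    rw [Set.mem_ofPred_eq] at *
    rw [mulVec_add, hx, hy]
  zero_mem' := mulVec_zero _
  smul_mem' c x hx := by
    rw [Set.mem_ofPred_eq] at *
    rw [mulVec_smul, hx]

theorem omega0_sub_of_mem_fixedSpace {M : Sp n} (x : Fin n ⊕ Fin n → ℝ) {y : Fin n ⊕ Fin n → ℝ}
    (hy : y ∈ fixedSpace M) : omega0 ((M : Matrix _ _ ℝ) *ᵥ x - x) y = 0 := by
  have hy' : (M : Matrix _ _ ℝ) *ᵥ y = y := hy
  rw [omega0_sub_left]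
  nth_rewrite 1 [← hy']
  rw [omega0_mulVec M.2, sub_self]

theorem transvection_mul_mulVec (v : Fin n ⊕ Fin n → ℝ) (c : ℝ) (M : Sp n)
    (x : Fin n ⊕ Fin n → ℝ) : ((symplecticTransvection v c * M : Sp n) : Matrix _ _ ℝ) *ᵥ x =
      (M : Matrix _ _ ℝ) *ᵥ x + (c * omega0 v ((M : Matrix _ _ ℝ) *ᵥ x)) • v := by
  rw [← transvectionMatrix_mulVec, mulVec_mulVec]
  rfl

theorem fixedSpace_le_transvection (M : Sp n) (x : Fin n ⊕ Fin n → ℝ) (c : ℝ) :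
    fixedSpace M ≤ fixedSpace (symplecticTransvection ((M : Matrix _ _ ℝ) *ᵥ x - x) c * M) := by
  intro y hy
  have hy' : (M : Matrix _ _ ℝ) *ᵥ y = y := hy
  change _ *ᵥ y = y
  rw [transvection_mul_mulVec, hy', omega0_sub_of_mem_fixedSpace x hy]
  simp

theorem exists_joined_fixedSpace_lt_of_ne_zero {M : Sp n} {x : Fin n ⊕ Fin n → ℝ}
    (hx : omega0 x ((M : Matrix _ _ ℝ) *ᵥ x) ≠ 0) :
    ∃ M', Joined M M' ∧ fixedSpace M < fixedSpace M' := by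
  set v := (M : Matrix _ _ ℝ) *ᵥ x - x with hv
  set s := omega0 v ((M : Matrix _ _ ℝ) *ᵥ x) with hs
  have hs' : s = -omega0 x ((M : Matrix _ _ ℝ) *ᵥ x) := by
    rw [hs, hv, omega0_sub_left, omega0_self, zero_sub]
  have hs0 : s ≠ 0 := by rw [hs']; exact neg_ne_zero.2 hx
  refine ⟨symplecticTransvection v (-s⁻¹) * M, joined_transvection_mul _ _ _,
    lt_of_le_of_ne (fixedSpace_le_transvection M x _) fun h => ?_⟩
  have hmem : x ∈ fixedSpace (symplecticTransvection v (-s⁻¹) * M) := by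
    change _ *ᵥ x = x
    rw [transvection_mul_mulVec, ← hs, neg_mul, inv_mul_cancel₀ hs0, hv]
    module
  rw [← h] at hmem
  have : (M : Matrix _ _ ℝ) *ᵥ x = x := hmem
  rw [this, omega0_self] at hx
  exact hx rfl

theorem exists_joined_fixedSpace_lt {M : Sp n} (hM : M ≠ 1) :
    ∃ M', Joined M M' ∧ fixedSpace M < fixedSpace M' := by
  by_cases h : ∃ x : Fin n ⊕ Fin n → ℝ, omega0 x ((M : Matrix _ _ ℝ) *ᵥ x) ≠ 0
  · obtain ⟨x, hx⟩ := h
    exact exists_joined_fixedSpace_lt_of_ne_zero hx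
  push Not at h
  obtain ⟨x, hx⟩ : ∃ x : Fin n ⊕ Fin n → ℝ, (M : Matrix _ _ ℝ) *ᵥ x - x ≠ 0 := by
    by_contra! h0
    refine hM (Subtype.ext (Matrix.ext_of_mulVec_single fun i => ?_))
    change _ = (1 : Matrix (Fin n ⊕ Fin n) (Fin n ⊕ Fin n) ℝ) *ᵥ _
    rw [sub_eq_zero.1 (h0 _), one_mulVec]
  set u := (M : Matrix _ _ ℝ) *ᵥ x - x with hu
  obtain ⟨y, hy⟩ := exists_omega0_ne_zero hx
  have hpol : omega0 x ((M : Matrix _ _ ℝ) *ᵥ y) = omega0 ((M : Matrix _ _ ℝ) *ᵥ x) y := by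
    have h1 := h (x + y)
    rw [mulVec_add, omega0_add_left, omega0_add_right, omega0_add_right, h x, h y] at h1
    rw [omega0_swap ((M : Matrix _ _ ℝ) *ᵥ x) y]
    linarith
  have h1 : omega0 u ((M : Matrix _ _ ℝ) *ᵥ y) = -omega0 u y := by
    rw [hu, omega0_sub_left, omega0_sub_left, omega0_mulVec M.2, hpol]
    ring
  have h2 : omega0 y (((symplecticTransvection u 1 * M : Sp n) : Matrix _ _ ℝ) *ᵥ y) ≠ 0 := by
    rw [transvection_mul_mulVec, omega0_add_right, omega0_smul_right, h y, h1, omega0_swap y u]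
    simpa using hy
  obtain ⟨M', h3, h4⟩ := exists_joined_fixedSpace_lt_of_ne_zero h2
  exact ⟨M', (joined_transvection_mul u 1 M).trans h3,
    (fixedSpace_le_transvection M x 1).trans_lt h4⟩

theorem joined_one (M : Sp n) : Joined M 1 := by
  induction hk : 2 * n - finrank ℝ (fixedSpace M) using Nat.strong_induction_on generalizing M with
  | _ k ih =>
    by_cases hM : M = 1
    · rw [hM]
    · obtain ⟨M', h1, h2⟩ := exists_joined_fixedSpace_lt hM
      have h3 := Submodule.finrank_lt_finrank_of_lt h2
      have h4 := Submodule.finrank_le (fixedSpace M')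
      rw [finrank_fintype_fun_eq_card, Fintype.card_sum, Fintype.card_fin] at h4
      exact h1.trans (ih _ (by omega) M' rfl)

/-- The symplectic group is path-connected. -/
theorem joined_symplectic (M N : Sp n) : Joined M N := (joined_one M).trans (joined_one N).symm

end MaslovType

end

noncomputable section

namespace MaslovType

open Module unitInterval

variable {n : ℕ}

/-! ### Rotation numbers -/

theorem exists_lift {A : Type*} [TopologicalSpace A] [SimplyConnectedSpace A]
    [LocallyPathConnectedSpace A] [Nonempty A] (f : C(A, Sp n)) :
    ∃ α : C(A, ℝ), ∀ a, rho (f a) = Complex.exp (Complex.I * Real.pi * (α a : ℂ)) := by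
  let g : C(A, Circle) := ⟨fun a => ⟨rho (f a), mem_sphere_zero_iff_norm.2 (norm_rho _)⟩,
    Continuous.subtype_mk (continuous_rho.comp f.continuous) _⟩
  obtain ⟨a₀⟩ := ‹Nonempty A›
  obtain ⟨F, ⟨-, hF⟩, -⟩ := Circle.isCoveringMap_exp.existsUnique_continuousMap_lifts g a₀
    (g a₀ : ℂ).arg (Circle.exp_arg _)
  refine ⟨⟨fun a => F a / Real.pi, by fun_prop⟩, fun a => ?_⟩
  have h := congrArg (Subtype.val) (congrFun hF a)
  have h1 : rho (f a) = Complex.exp (F a * Complex.I) := by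
    rw [← Circle.coe_exp]
    exact h.symm
  rw [h1]
  congr 1
  have hπ : (Real.pi : ℂ) ≠ 0 := by exact_mod_cast Real.pi_ne_zero
  simp only [ContinuousMap.coe_mk]
  push_cast
  field_simp

/-- Two lifts of the same circle-valued map on a connected space differ by a constant. -/
theorem lift_sub_eq {A : Type*} [TopologicalSpace A] [PreconnectedSpace A] {α β : A → ℝ}
    (hα : Continuous α) (hβ : Continuous β) {c : ℂ}
    (h : ∀ a, Complex.exp (Complex.I * Real.pi * (α a : ℂ)) =
      c * Complex.exp (Complex.I * Real.pi * (β a : ℂ))) (a b : A) : α b - α a = β b - β a := by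
  have hπ := Real.pi_ne_zero
  have hexp : ∀ x : ℝ, ((Circle.exp (Real.pi * x) : Circle) : ℂ) =
      Complex.exp (Complex.I * Real.pi * (x : ℂ)) := by
    intro x
    rw [Circle.coe_exp]
    congr 1
    push_cast
    ring
  have key := Circle.isCoveringMap_exp.eq_of_comp_eq (g₁ := fun x => Real.pi * (α x + β a))
    (g₂ := fun x => Real.pi * (β x + α a)) (by fun_prop) (by fun_prop) (by
      ext x
      simp only [Function.comp_apply, mul_add, Circle.exp_add, Circle.coe_mul, hexp, h]
      ring) a (by ring)
  have := mul_left_cancel₀ hπ (congrFun key b)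
  linarith

theorem exists_hasRotationNumber (Φ : SpPath n) : ∃ d, HasRotationNumber Φ d := by
  obtain ⟨α, hα⟩ := exists_lift (A := ℝ) (Φ.comp ⟨Set.projIcc 0 1 zero_le_one, continuous_projIcc⟩)
  refine ⟨_, ⟨fun t => α t, by fun_prop⟩, fun t => ?_, rfl⟩
  have := hα t
  simpa [Set.projIcc_val] using this

theorem HasRotationNumber.unique {Φ : SpPath n} {d d' : ℝ} (h : HasRotationNumber Φ d)
    (h' : HasRotationNumber Φ d') : d = d' := by
  obtain ⟨α, hα, rfl⟩ := h
  obtain ⟨β, hβ, rfl⟩ := h'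
  exact lift_sub_eq α.continuous β.continuous (c := 1)
    (fun t => by rw [← hα, ← hβ, one_mul]) 0 1

/-- The rotation number of a symplectic path. -/
def rotationNumber (Φ : SpPath n) : ℝ := (exists_hasRotationNumber Φ).choose

theorem hasRotationNumber (Φ : SpPath n) : HasRotationNumber Φ (rotationNumber Φ) :=
  (exists_hasRotationNumber Φ).choose_spec

theorem HasRotationNumber.eq {Φ : SpPath n} {d : ℝ} (h : HasRotationNumber Φ d) :
    rotationNumber Φ = d := (hasRotationNumber Φ).unique h

theorem exp_rotationNumber (Φ : SpPath n) :
    Complex.exp (Complex.I * Real.pi * (rotationNumber Φ : ℂ)) * rho (Φ 0) = rho (Φ 1) := by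
  obtain ⟨α, hα, h⟩ := hasRotationNumber Φ
  rw [← h, hα, hα, ← Complex.exp_add]
  congr 1
  push_cast
  ring

/-- The rotation numbers along the sides of a square of symplectic matrices. -/
theorem rotationNumber_square {H : C(I × I, Sp n)} {P₀ P₁ Q₀ Q₁ : SpPath n}
    (hP₀ : ∀ t, H (0, t) = P₀ t) (hP₁ : ∀ t, H (1, t) = P₁ t)
    (hQ₀ : ∀ s, H (s, 0) = Q₀ s) (hQ₁ : ∀ s, H (s, 1) = Q₁ s) :
    rotationNumber P₁ + rotationNumber Q₀ = rotationNumber P₀ + rotationNumber Q₁ := by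
  let r : C(ℝ × ℝ, I × I) := ⟨fun p => (Set.projIcc 0 1 zero_le_one p.1,
    Set.projIcc 0 1 zero_le_one p.2), by fun_prop⟩
  obtain ⟨α, hα⟩ := exists_lift (H.comp r)
  have hα' : ∀ s t : I, rho (H (s, t)) =
      Complex.exp (Complex.I * Real.pi * (α ((s : ℝ), (t : ℝ)) : ℂ)) := by
    intro s t
    simpa [r, Set.projIcc_val] using hα ((s : ℝ), (t : ℝ))
  have h1 : HasRotationNumber P₀ (α (0, 1) - α (0, 0)) :=
    ⟨⟨fun t => α (0, (t : ℝ)), by fun_prop⟩, fun t => by rw [← hP₀, hα']; rfl, rfl⟩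
  have h2 : HasRotationNumber P₁ (α (1, 1) - α (1, 0)) :=
    ⟨⟨fun t => α (1, (t : ℝ)), by fun_prop⟩, fun t => by rw [← hP₁, hα']; rfl, rfl⟩
  have h3 : HasRotationNumber Q₀ (α (1, 0) - α (0, 0)) :=
    ⟨⟨fun t => α ((t : ℝ), 0), by fun_prop⟩, fun t => by rw [← hQ₀, hα']; rfl, rfl⟩
  have h4 : HasRotationNumber Q₁ (α (1, 1) - α (0, 1)) :=
    ⟨⟨fun t => α ((t : ℝ), 1), by fun_prop⟩, fun t => by rw [← hQ₁, hα']; rfl, rfl⟩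
  rw [h1.eq, h2.eq, h3.eq, h4.eq]
  ring

theorem rotationNumber_const {Φ : SpPath n} (h : ∀ t, Φ t = Φ 0) : rotationNumber Φ = 0 := by
  obtain ⟨α, hα, -⟩ := hasRotationNumber Φ
  refine HasRotationNumber.eq ⟨⟨fun _ => α 0, continuous_const⟩, fun t => ?_, sub_self _⟩
  rw [h, hα 0]
  rfl

theorem rotationNumber_homotopic {Φ Ψ : SpPath n} (h : ContinuousMap.HomotopicRel Φ Ψ {0, 1}) :
    rotationNumber Φ = rotationNumber Ψ := by
  obtain ⟨H⟩ := h
  have h0 : ∀ s, H (s, 0) = Φ 0 := fun s => H.eq_fst s (by simp)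
  have h1 : ∀ s, H (s, 1) = Φ 1 := fun s => H.eq_fst s (by simp)
  have := rotationNumber_square (H := H.toContinuousMap) (P₀ := Φ) (P₁ := Ψ)
    (Q₀ := ContinuousMap.const I (Φ 0)) (Q₁ := ContinuousMap.const I (Φ 1))
    (fun t => H.apply_zero t) (fun t => H.apply_one t) (fun s => h0 s) (fun s => h1 s)
  rw [rotationNumber_const (Φ := ContinuousMap.const I (Φ 0)) (fun _ => rfl),
    rotationNumber_const (Φ := ContinuousMap.const I (Φ 1)) (fun _ => rfl)] at this
  linarith

theorem piece_apply (Φ : SpPath n) {a b : ℝ} (t s : I)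
    (h : (s : ℝ) = (1 - (t : ℝ)) * a + (t : ℝ) * b) : piece Φ a b t = Φ s := by
  simp only [piece, ContinuousMap.coe_mk, ← h, Set.projIcc_val]

/-- A lift of a path restricts to lifts of its pieces. -/
theorem hasRotationNumber_piece {Φ : SpPath n} {α : C(I, ℝ)}
    (hα : ∀ t, rho (Φ t) = Complex.exp (Complex.I * Real.pi * (α t : ℂ))) (a b : I) :
    HasRotationNumber (piece Φ a b) (α b - α a) := by
  refine ⟨⟨fun t => α (Set.projIcc 0 1 zero_le_one ((1 - (t : ℝ)) * a + (t : ℝ) * b)),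
    by fun_prop⟩, fun t => hα _, ?_⟩
  simp [Set.projIcc_val]

theorem rotationNumber_piece_add (Φ : SpPath n) (a b c : I) :
    rotationNumber (piece Φ a b) + rotationNumber (piece Φ b c) =
      rotationNumber (piece Φ a c) := by
  obtain ⟨α, hα, -⟩ := hasRotationNumber Φ
  rw [(hasRotationNumber_piece hα a b).eq, (hasRotationNumber_piece hα b c).eq,
    (hasRotationNumber_piece hα a c).eq]
  ring

theorem piece_zero_one (Φ : SpPath n) : piece Φ 0 1 = Φ := by
  ext1 t
  exact piece_apply Φ t t (by ring)

end MaslovType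

end

noncomputable section

namespace MaslovType

open Module unitInterval

variable {n : ℕ}

/-! ### Normalized eigenvalues of the first kind -/

theorem rho_eq_normalizedFirstKind_prod (M : Sp n) : rho M = (normalizedFirstKind M).prod := by
  rw [rho_eq_prod, normalizedFirstKind, Multiset.prod_sum]
  simp only [Multiset.prod_replicate]

theorem card_normalizedFirstKind (M : Sp n) : (normalizedFirstKind M).card = n := by
  rw [normalizedFirstKind, Multiset.card_sum]
  simp only [Multiset.card_replicate]
  exact sum_firstKindMult M

theorem norm_of_mem_normalizedFirstKind {M : Sp n} {w : ℂ} (h : w ∈ normalizedFirstKind M) :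
    ‖w‖ = 1 := by
  rw [normalizedFirstKind, Multiset.mem_sum] at h
  obtain ⟨z, hz, hw⟩ := h
  rw [Multiset.eq_of_mem_replicate hw, norm_div, Complex.norm_real, norm_norm, div_self]
  exact norm_ne_zero_iff.2 (ne_zero_of_mem_spec hz)

/-! ### Block rotations -/

theorem blockRotation_mulVec_inl (a : Fin n → ℝ) (x : Fin n ⊕ Fin n → ℝ) (j : Fin n) :
    (blockRotation a *ᵥ x) (Sum.inl j) =
      Real.cos (a j) * x (Sum.inl j) - Real.sin (a j) * x (Sum.inr j) := by
  rw [blockRotation, fromBlocks_mulVec]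
  simp [mulVec_diagonal, sub_eq_add_neg]

theorem blockRotation_mulVec_inr (a : Fin n → ℝ) (x : Fin n ⊕ Fin n → ℝ) (j : Fin n) :
    (blockRotation a *ᵥ x) (Sum.inr j) =
      Real.sin (a j) * x (Sum.inl j) + Real.cos (a j) * x (Sum.inr j) := by
  rw [blockRotation, fromBlocks_mulVec]
  simp [mulVec_diagonal]

theorem blockRotation_mem (a : Fin n → ℝ) : blockRotation a ∈ symplecticGroup (Fin n) ℝ := by
  refine mem_symplecticGroup_of_omega0 fun x y => ?_
  simp only [omega0_eq, blockRotation_mulVec_inl, blockRotation_mulVec_inr]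
  refine Finset.sum_congr rfl fun j _ => ?_
  linear_combination (x (Sum.inr j) * y (Sum.inl j) - x (Sum.inl j) * y (Sum.inr j)) *
    Real.cos_sq_add_sin_sq (a j)

/-- The block rotation as a symplectic matrix. -/
def rot (a : Fin n → ℝ) : Sp n := ⟨blockRotation a, blockRotation_mem a⟩

theorem continuous_rot : Continuous (rot : (Fin n → ℝ) → Sp n) := by
  refine Continuous.subtype_mk ?_ _
  unfold blockRotation
  refine Continuous.matrix_fromBlocks ?_ ?_ ?_ ?_
  all_goals first
    | refine Continuous.neg ?_
    | skip
  all_goals exact Continuous.matrix_diagonal (by fun_prop)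

theorem toComplex_rot (a : Fin n → ℝ) : toComplex (rot a) = fromBlocks
    (diagonal fun j => (Real.cos (a j) : ℂ)) (-diagonal fun j => (Real.sin (a j) : ℂ))
    (diagonal fun j => (Real.sin (a j) : ℂ)) (diagonal fun j => (Real.cos (a j) : ℂ)) := by
  change (blockRotation a).map _ = _
  rw [blockRotation, fromBlocks_map]
  congr 1 <;> (ext i j; by_cases h : i = j <;> simp [h])

theorem expI_eq (x : ℝ) : expI x = (Real.cos x : ℂ) + (Real.sin x : ℂ) * Complex.I := by
  rw [expI, mul_comm, Complex.exp_mul_I, Complex.ofReal_cos, Complex.ofReal_sin]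

/-- The embedding of `ℂᵏ` as a sum of eigenlines of Krein positive type. -/
def positiveEmbedding (p : Fin n → Prop) [DecidablePred p] :
    ({j // p j} → ℂ) →ₗ[ℂ] (Fin n ⊕ Fin n → ℂ) where
  toFun c := Sum.elim (fun j => if h : p j then c ⟨j, h⟩ else 0)
    (fun j => if h : p j then -Complex.I * c ⟨j, h⟩ else 0)
  map_add' c d := by
    ext i
    rcases i with j | j <;> by_cases h : p j <;> simp [h]
    ring
  map_smul' r c := by
    ext i
    rcases i with j | j <;> by_cases h : p j <;> simp [h]
    ring

theorem card_le_mPlus_rot (a : Fin n → ℝ) (z : ℂ) [DecidablePred fun j => expI (a j) = z] :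
    Fintype.card {j // expI (a j) = z} ≤ mPlus (rot a) z := by
  set L := positiveEmbedding (n := n) fun j => expI (a j) = z with hL
  have hl : ∀ c (j : {j // expI (a j) = z}), L c (Sum.inl j) = c j := fun c j => by
    simp [hL, positiveEmbedding, j.2]
  have hinj : Function.Injective L := by
    intro c d h
    ext j
    rw [← hl c, ← hl d, h]
  have hr := LinearMap.finrank_range_of_inj hinj
  rw [finrank_fintype_fun_eq_card] at hr
  rw [← hr]
  refine le_posIndex ?_ ?_
  · rintro _ ⟨c, rfl⟩
    refine (End.mem_maxGenEigenspace _ _ _).2 ⟨1, ?_⟩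
    rw [pow_one, LinearMap.sub_apply, LinearMap.smul_apply, End.one_apply, sub_eq_zero,
      toLin'_apply, toComplex_rot, fromBlocks_mulVec]
    ext i
    rcases i with j | j <;> by_cases h : expI (a j) = z
    · have hz : z = Real.cos (a j) + Real.sin (a j) * Complex.I := h.symm.trans (expI_eq _)
      simp only [hL, positiveEmbedding, LinearMap.coe_mk, AddHom.coe_mk, Sum.elim_inl,
        Pi.add_apply, neg_mulVec, Pi.neg_apply, mulVec_diagonal, Function.comp_apply,
        Sum.elim_inr, h, dite_true, Pi.smul_apply, smul_eq_mul]
      linear_combination (-c ⟨j, h⟩) * hz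
    · simp [hL, positiveEmbedding, h, mulVec_diagonal]
    · have hz : z = Real.cos (a j) + Real.sin (a j) * Complex.I := h.symm.trans (expI_eq _)
      simp only [hL, positiveEmbedding, LinearMap.coe_mk, AddHom.coe_mk, Sum.elim_inl,
        Pi.add_apply, mulVec_diagonal, Function.comp_apply,
        Sum.elim_inr, h, dite_true, Pi.smul_apply, smul_eq_mul]
      linear_combination Complex.I * c ⟨j, h⟩ * hz +
        (Real.sin (a j) : ℂ) * c ⟨j, h⟩ * Complex.I_sq
    · simp [hL, positiveEmbedding, h, mulVec_diagonal]
  · rintro _ ⟨c, rfl⟩ h0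
    have hk : kreinForm (L c) = ∑ j : Fin n, 2 * Complex.normSq (L c (Sum.inl j)) := by
      rw [kreinForm, omega0_eq, Complex.im_sum]
      refine Finset.sum_congr rfl fun j _ => ?_
      by_cases h : expI (a j) = z
      · simp [hL, positiveEmbedding, h, Complex.normSq_apply]
        ring
      · simp [hL, positiveEmbedding, h]
    rw [hk]
    have hc : c ≠ 0 := by rintro rfl; exact h0 (map_zero L)
    obtain ⟨j, hj⟩ := Function.ne_iff.1 hc
    refine Finset.sum_pos' (fun i _ => mul_nonneg zero_le_two (Complex.normSq_nonneg _))
      ⟨j, Finset.mem_univ _, mul_pos two_pos (Complex.normSq_pos.2 ?_)⟩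
    rw [hl]
    exact hj

theorem count_map_expI (a : Fin n → ℝ) (z : ℂ) [DecidablePred fun j => expI (a j) = z] :
    (Multiset.map (fun j => expI (a j)) Finset.univ.val).count z =
      Fintype.card {j // expI (a j) = z} := by
  classical
  rw [Multiset.count_map, Fintype.card_subtype, Finset.card_def, Finset.filter_val]
  congr 1
  refine (Multiset.filter_congr fun j _ => eq_comm).trans ?_
  congr

/-- The eigenvalues of the first kind of a block rotation. -/
theorem firstKindMult_rot (a : Fin n → ℝ) {z : ℂ} (hz : z ∈ spec (rot a)) :
    firstKindMult (rot a) z = (Multiset.map (fun j => expI (a j)) Finset.univ.val).count z := by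
  classical
  have hle : ∀ z, (Multiset.map (fun j => expI (a j)) Finset.univ.val).count z ≤
      firstKindMult (rot a) z := by
    intro z
    by_cases hz : ‖z‖ = 1
    · rw [firstKindMult_eq, if_pos hz, count_map_expI]
      exact card_le_mPlus_rot a z
    · rw [Multiset.count_eq_zero_of_notMem]
      · exact Nat.zero_le _
      · intro h
        obtain ⟨j, -, rfl⟩ := Multiset.mem_map.1 h
        exact hz (norm_expI _)
  have hsum : ∑ z ∈ spec (rot a), (Multiset.map (fun j => expI (a j)) Finset.univ.val).count z =
      ∑ z ∈ spec (rot a), firstKindMult (rot a) z := by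
    rw [sum_firstKindMult]
    have hsub : (Multiset.map (fun j => expI (a j)) Finset.univ.val).toFinset ⊆ spec (rot a) := by
      intro z hz
      rw [Multiset.mem_toFinset, ← Multiset.count_pos] at hz
      rw [mem_spec_iff]
      have h1 := hz.trans_le (hle z)
      rw [firstKindMult_eq] at h1
      split_ifs at h1 with h2 h3
      · rw [← mPlus_add_mPlus_star _ h2]
        omega
      · omega
      · omega
    rw [← Finset.sum_subset hsub fun z _ hz => Multiset.count_eq_zero_of_notMem fun h =>
      hz (Multiset.mem_toFinset.2 h), Multiset.toFinset_sum_count_eq]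
    simp
  exact ((Finset.sum_eq_sum_iff_of_le fun z _ => hle z).1 hsum z hz).symm

theorem normalizedFirstKind_rot (a : Fin n → ℝ) :
    normalizedFirstKind (rot a) = Multiset.map (fun j => expI (a j)) Finset.univ.val := by
  classical
  have h1 : normalizedFirstKind (rot a) = ∑ z ∈ spec (rot a),
      Multiset.replicate ((Multiset.map (fun j => expI (a j)) Finset.univ.val).count z) z := by
    refine Finset.sum_congr rfl fun z hz => ?_
    rw [firstKindMult_rot a hz]
    by_cases h : z ∈ Multiset.map (fun j => expI (a j)) Finset.univ.val
    · obtain ⟨j, -, rfl⟩ := Multiset.mem_map.1 h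
      rw [norm_expI, Complex.ofReal_one, div_one]
    · rw [Multiset.count_eq_zero_of_notMem h, Multiset.replicate_zero, Multiset.replicate_zero]
  have hle : ∑ z ∈ spec (rot a),
      Multiset.replicate ((Multiset.map (fun j => expI (a j)) Finset.univ.val).count z) z ≤
      Multiset.map (fun j => expI (a j)) Finset.univ.val := by
    rw [Multiset.le_iff_count]
    intro w
    rw [Multiset.count_sum']
    simp only [Multiset.count_replicate]
    rw [Finset.sum_ite_eq']
    split_ifs <;> simp
  rw [h1]
  refine Multiset.eq_of_le_of_card_le hle ?_
  rw [← h1, card_normalizedFirstKind]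
  simp

theorem rho_rot (a : Fin n → ℝ) : rho (rot a) = Complex.exp (Complex.I * ((∑ j, a j : ℝ) : ℂ)) := by
  rw [rho_eq_normalizedFirstKind_prod, normalizedFirstKind_rot, Complex.ofReal_sum, Finset.mul_sum,
    Complex.exp_sum]
  rfl

theorem exists_normalForm (M : Sp n) : ∃ a : Fin n → ℝ, IsNormalForm M (rot a) := by
  set l := (normalizedFirstKind M).toList with hl
  have hlen : l.length = n := by rw [hl, Multiset.length_toList, card_normalizedFirstKind]
  let f : Fin n → ℂ := fun j => l.get (j.cast hlen.symm)
  have hf : Multiset.map f Finset.univ.val = normalizedFirstKind M := by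
    rw [Fin.univ_val_map]
    have h1 : List.ofFn f = l := by
      refine List.ext_get (by simp [hlen]) fun i h1 h2 => ?_
      simp [f]
    rw [h1, hl, Multiset.coe_toList]
  refine ⟨fun j => (f j).arg, _, rfl, ?_⟩
  rw [← hf]
  refine Multiset.map_congr rfl fun j _ => expI_arg (norm_of_mem_normalizedFirstKind (M := M) ?_)
  rw [← hf]
  exact Multiset.mem_map_of_mem f (Finset.mem_univ_val j)

theorem IsNormalForm.rho_eq {M O : Sp n} (h : IsNormalForm M O) : rho O = rho M := by
  obtain ⟨a, ha, h⟩ := h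
  have hO : O = rot a := Subtype.ext ha
  rw [rho_eq_normalizedFirstKind_prod, rho_eq_normalizedFirstKind_prod, ← h, hO,
    normalizedFirstKind_rot]

end MaslovType

end

noncomputable section

namespace MaslovType

open Module unitInterval

/-! ### Complexification -/

section Complexification

variable {κ κ' : Type*}

/-- A real vector, viewed as a complex vector. -/
def ofRealVec (a : κ → ℝ) : κ → ℂ := fun i => (a i : ℂ)

theorem exists_eq_ofRealVec_add (x : κ → ℂ) :
    ∃ a b : κ → ℝ, x = ofRealVec a + Complex.I • ofRealVec b := by
  refine ⟨fun i => (x i).re, fun i => (x i).im, ?_⟩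
  ext i
  simp only [ofRealVec, Pi.add_apply, Pi.smul_apply, smul_eq_mul]
  rw [mul_comm, Complex.re_add_im]

variable [Fintype κ] [DecidableEq κ]

/-- The complex linear extension of a real linear map. -/
def complexify (f : (κ → ℝ) →ₗ[ℝ] (κ' → ℝ)) : (κ → ℂ) →ₗ[ℂ] (κ' → ℂ) :=
  toLin' ((LinearMap.toMatrix' f).map fun x : ℝ => (x : ℂ))

theorem complexify_ofRealVec (f : (κ → ℝ) →ₗ[ℝ] (κ' → ℝ)) (a : κ → ℝ) :
    complexify f (ofRealVec a) = ofRealVec (f a) := by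
  ext i
  have h := congrFun (LinearMap.toMatrix'_mulVec f a) i
  simp only [complexify, toLin'_apply, ofRealVec, ← h, mulVec, dotProduct, map_apply]
  push_cast
  rfl

theorem star_complexify (f : (κ → ℝ) →ₗ[ℝ] (κ' → ℝ)) (x : κ → ℂ) :
    star (complexify f x) = complexify f (star x) := by
  ext i
  simp [complexify, mulVec, dotProduct]

theorem toComplex_mulVec_ofRealVec {n : ℕ} (M : Sp n) (a : Fin n ⊕ Fin n → ℝ) :
    toComplex M *ᵥ ofRealVec a = ofRealVec ((M : Matrix _ _ ℝ) *ᵥ a) := by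
  ext i
  simp only [toComplex, ofRealVec, mulVec, dotProduct, map_apply]
  push_cast
  rfl

theorem omega0_ofRealVec {n : ℕ} (a b : Fin n ⊕ Fin n → ℝ) :
    omega0 (ofRealVec a) (ofRealVec b) = ((omega0 a b : ℝ) : ℂ) := by
  simp only [omega0_eq, ofRealVec]
  push_cast
  rfl

end Complexification

/-! ### Symplectic direct sums -/

section PosIndexMap

variable {V V' : Type*} [AddCommGroup V] [Module ℂ V] [FiniteDimensional ℂ V]
  [AddCommGroup V'] [Module ℂ V'] [FiniteDimensional ℂ V']

theorem IsSylvester.map {q : V → ℝ} {q' : V' → ℝ} {E : Submodule ℂ V} (h : IsSylvester q E)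
    (f : V →ₗ[ℂ] V') (hinj : Function.Injective f) (hq : ∀ ξ, q' (f ξ) = q ξ) :
    posIndex q' (E.map f) = posIndex q E ∧ IsSylvester q' (E.map f) := by
  have h0 : ∀ ξ ∈ E, f ξ = 0 → ξ = 0 := fun ξ _ hξ => hinj (hξ.trans (map_zero f).symm)
  have h1 : posIndex q E ≤ posIndex q' (E.map f) :=
    posIndex_linearMap_le f h0 (fun ξ hξ => Submodule.mem_map_of_mem hξ)
      fun ξ _ hp => by rwa [hq]
  have h2 : posIndex (-q) E ≤ posIndex (-q') (E.map f) :=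
    posIndex_linearMap_le f h0 (fun ξ hξ => Submodule.mem_map_of_mem hξ)
      fun ξ _ hp => by
        rw [Pi.neg_apply, hq]
        exact hp
  have h3 := posIndex_add_posIndex_neg_le q' (E.map f)
  have h4 : finrank ℂ (E.map f) = finrank ℂ E :=
    (Submodule.equivMapOfInjective f hinj E).symm.finrank_eq
  unfold IsSylvester at *
  omega

end PosIndexMap

/-- `M` is the symplectic direct sum of `M₁` and `M₂` with respect to the embeddings `L₁`, `L₂`. -/
structure IsDirectSum {n n₁ n₂ : ℕ} (M : Sp n) (M₁ : Sp n₁) (M₂ : Sp n₂)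
    (L₁ : (Fin n₁ ⊕ Fin n₁ → ℂ) →ₗ[ℂ] (Fin n ⊕ Fin n → ℂ))
    (L₂ : (Fin n₂ ⊕ Fin n₂ → ℂ) →ₗ[ℂ] (Fin n ⊕ Fin n → ℂ)) : Prop where
  omega_left : ∀ x y, omega0 (L₁ x) (L₁ y) = omega0 x y
  omega_right : ∀ x y, omega0 (L₂ x) (L₂ y) = omega0 x y
  ortho : ∀ x y, omega0 (L₁ x) (L₂ y) = 0
  star_left : ∀ x, star (L₁ x) = L₁ (star x)
  star_right : ∀ x, star (L₂ x) = L₂ (star x)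
  cover : ∀ v, ∃ x y, v = L₁ x + L₂ y
  map_left : ∀ x, toComplex M *ᵥ L₁ x = L₁ (toComplex M₁ *ᵥ x)
  map_right : ∀ x, toComplex M *ᵥ L₂ x = L₂ (toComplex M₂ *ᵥ x)

theorem eq_zero_of_omega0_eq_zero {n : ℕ} {x : Fin n ⊕ Fin n → ℂ} (h : ∀ y, omega0 x y = 0) :
    x = 0 := by
  have := nondegOn_kreinB (star x) trivial fun y _ => by
    rw [kreinB_apply, star_star, h, mul_zero]
  simpa using congrArg star this

namespace IsDirectSum

variable {n n₁ n₂ : ℕ} {M : Sp n} {M₁ : Sp n₁} {M₂ : Sp n₂}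
  {L₁ : (Fin n₁ ⊕ Fin n₁ → ℂ) →ₗ[ℂ] (Fin n ⊕ Fin n → ℂ)}
  {L₂ : (Fin n₂ ⊕ Fin n₂ → ℂ) →ₗ[ℂ] (Fin n ⊕ Fin n → ℂ)}

theorem eq_zero_of_add_eq_zero (h : IsDirectSum M M₁ M₂ L₁ L₂) {x : Fin n₁ ⊕ Fin n₁ → ℂ}
    {y : Fin n₂ ⊕ Fin n₂ → ℂ} (h0 : L₁ x + L₂ y = 0) : x = 0 ∧ y = 0 := by
  have hx : x = 0 := eq_zero_of_omega0_eq_zero fun w => by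
    have h1 : omega0 (L₁ x + L₂ y) (L₁ w) = 0 := by rw [h0]; simp [omega0]
    rw [omega0_add_left, h.omega_left, omega0_swap (L₂ y), h.ortho, neg_zero, add_zero] at h1
    exact h1
  refine ⟨hx, eq_zero_of_omega0_eq_zero fun w => ?_⟩
  rw [hx, map_zero, zero_add] at h0
  rw [← h.omega_right, h0]
  simp [omega0]

theorem injective_left (h : IsDirectSum M M₁ M₂ L₁ L₂) : Function.Injective L₁ := by
  rw [← LinearMap.ker_eq_bot, LinearMap.ker_eq_bot']
  exact fun x hx => (h.eq_zero_of_add_eq_zero (y := 0) (by rw [hx, map_zero, add_zero])).1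

theorem injective_right (h : IsDirectSum M M₁ M₂ L₁ L₂) : Function.Injective L₂ := by
  rw [← LinearMap.ker_eq_bot, LinearMap.ker_eq_bot']
  exact fun y hy => (h.eq_zero_of_add_eq_zero (x := 0) (by rw [hy, map_zero, add_zero])).2

theorem pow_left (h : IsDirectSum M M₁ M₂ L₁ L₂) (z : ℂ) (k : ℕ) (x) :
    ((toEnd M - z • (1 : End ℂ (Fin n ⊕ Fin n → ℂ))) ^ k) (L₁ x) =
      L₁ (((toEnd M₁ - z • (1 : End ℂ (Fin n₁ ⊕ Fin n₁ → ℂ))) ^ k) x) := by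
  induction k with
  | zero => simp
  | succ k ih =>
    rw [pow_succ', pow_succ', Module.End.mul_apply, Module.End.mul_apply, ih]
    simp [h.map_left]

theorem pow_right (h : IsDirectSum M M₁ M₂ L₁ L₂) (z : ℂ) (k : ℕ) (x) :
    ((toEnd M - z • (1 : End ℂ (Fin n ⊕ Fin n → ℂ))) ^ k) (L₂ x) =
      L₂ (((toEnd M₂ - z • (1 : End ℂ (Fin n₂ ⊕ Fin n₂ → ℂ))) ^ k) x) := by
  induction k with
  | zero => simp
  | succ k ih =>
    rw [pow_succ', pow_succ', Module.End.mul_apply, Module.End.mul_apply, ih]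
    simp [h.map_right]

theorem genEigenspace_eq (h : IsDirectSum M M₁ M₂ L₁ L₂) (z : ℂ) : genEigenspace M z =
    (genEigenspace M₁ z).map L₁ ⊔ (genEigenspace M₂ z).map L₂ := by
  refine le_antisymm (fun v hv => ?_) (sup_le ?_ ?_)
  · obtain ⟨k, hk⟩ := (End.mem_maxGenEigenspace _ _ _).1 hv
    obtain ⟨x, y, rfl⟩ := h.cover v
    rw [map_add, h.pow_left, h.pow_right] at hk
    obtain ⟨h1, h2⟩ := h.eq_zero_of_add_eq_zero hk
    exact Submodule.add_mem_sup
      (Submodule.mem_map_of_mem ((End.mem_maxGenEigenspace _ _ _).2 ⟨k, h1⟩))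
      (Submodule.mem_map_of_mem ((End.mem_maxGenEigenspace _ _ _).2 ⟨k, h2⟩))
  · rintro _ ⟨x, hx, rfl⟩
    obtain ⟨k, hk⟩ := (End.mem_maxGenEigenspace _ _ _).1 hx
    exact (End.mem_maxGenEigenspace _ _ _).2 ⟨k, by rw [h.pow_left, hk, map_zero]⟩
  · rintro _ ⟨x, hx, rfl⟩
    obtain ⟨k, hk⟩ := (End.mem_maxGenEigenspace _ _ _).1 hx
    exact (End.mem_maxGenEigenspace _ _ _).2 ⟨k, by rw [h.pow_right, hk, map_zero]⟩

theorem disjoint_map (h : IsDirectSum M M₁ M₂ L₁ L₂) (E₁ E₂) :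
    Disjoint (Submodule.map L₁ E₁) (Submodule.map L₂ E₂) := by
  rw [Submodule.disjoint_def]
  rintro v ⟨x, -, rfl⟩ ⟨y, -, hy⟩
  have := (h.eq_zero_of_add_eq_zero (x := x) (y := -y) (by rw [map_neg, hy, add_neg_cancel])).1
  rw [this, map_zero]

theorem count_eq (h : IsDirectSum M M₁ M₂ L₁ L₂) (z : ℂ) : (eigenvalues M).count z =
    (eigenvalues M₁).count z + (eigenvalues M₂).count z := by
  rw [← finrank_genEigenspace, ← finrank_genEigenspace, ← finrank_genEigenspace, h.genEigenspace_eq,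
    finrank_sup_of_disjoint (h.disjoint_map _ _),
    (Submodule.equivMapOfInjective L₁ h.injective_left _).finrank_eq,
    (Submodule.equivMapOfInjective L₂ h.injective_right _).finrank_eq]

theorem mPlus_eq (h : IsDirectSum M M₁ M₂ L₁ L₂) {z : ℂ} (hz : ‖z‖ = 1) :
    mPlus M z = mPlus M₁ z + mPlus M₂ z := by
  have h1 := (isSylvester_genEigenspace M₁ hz).map L₁ h.injective_left (q' := kreinForm)
    fun x => by rw [kreinForm, kreinForm, h.star_left, h.omega_left]
  have h2 := (isSylvester_genEigenspace M₂ hz).map L₂ h.injective_right (q' := kreinForm)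
    fun x => by rw [kreinForm, kreinForm, h.star_right, h.omega_right]
  rw [← qf_kreinB] at h1 h2
  have h3 := posIndex_sup isHerm_kreinB (h.disjoint_map (genEigenspace M₁ z) (genEigenspace M₂ z))
    (by
      rintro _ ⟨x, -, rfl⟩ _ ⟨y, -, rfl⟩
      rw [kreinB_apply, h.star_left, h.ortho, mul_zero]) h1.2 h2.2
  rw [mPlus_eq_posIndex, h.genEigenspace_eq, ← qf_kreinB, h3.1, h1.1, h2.1]
  rfl

theorem firstKindMult_eq_add (h : IsDirectSum M M₁ M₂ L₁ L₂) (z : ℂ) :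
    firstKindMult M z = firstKindMult M₁ z + firstKindMult M₂ z := by
  rw [firstKindMult_eq, firstKindMult_eq, firstKindMult_eq]
  split_ifs with h1 h2
  · exact h.mPlus_eq h1
  · exact h.count_eq z
  · rfl

theorem normalizedFirstKind_eq (h : IsDirectSum M M₁ M₂ L₁ L₂) :
    normalizedFirstKind M = normalizedFirstKind M₁ + normalizedFirstKind M₂ := by
  classical
  have key : ∀ {m : ℕ} (N : Sp m) (S : Finset ℂ), spec N ⊆ S → normalizedFirstKind N =
      ∑ z ∈ S, Multiset.replicate (firstKindMult N z) (z / (‖z‖ : ℂ)) := by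
    intro m N S hS
    refine Finset.sum_subset hS fun z _ hz => ?_
    have h0 : (eigenvalues N).count z = 0 := by
      rw [mem_spec_iff, not_not] at hz
      exact hz
    have h1 : firstKindMult N z = 0 := by
      rw [firstKindMult_eq]
      split_ifs with h2 h3
      · have := mPlus_add_mPlus_star N h2
        omega
      · exact h0
      · rfl
    rw [h1, Multiset.replicate_zero]
  rw [key M (spec M ∪ (spec M₁ ∪ spec M₂)) Finset.subset_union_left,
    key M₁ (spec M ∪ (spec M₁ ∪ spec M₂))
      (Finset.subset_union_left.trans Finset.subset_union_right),
    key M₂ (spec M ∪ (spec M₁ ∪ spec M₂))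
      (Finset.subset_union_right.trans Finset.subset_union_right),
    ← Finset.sum_add_distrib]
  refine Finset.sum_congr rfl fun z _ => ?_
  rw [h.firstKindMult_eq_add, Multiset.replicate_add]

theorem rho_eq (h : IsDirectSum M M₁ M₂ L₁ L₂) : rho M = rho M₁ * rho M₂ := by
  rw [rho_eq_normalizedFirstKind_prod, rho_eq_normalizedFirstKind_prod,
    rho_eq_normalizedFirstKind_prod, h.normalizedFirstKind_eq, Multiset.prod_add]

end IsDirectSum

/-- A real symplectic splitting gives a direct sum decomposition over `ℂ`. -/
theorem isDirectSum_complexify {n n₁ n₂ : ℕ} {M : Sp n} {M₁ : Sp n₁} {M₂ : Sp n₂}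
    {f₁ : (Fin n₁ ⊕ Fin n₁ → ℝ) →ₗ[ℝ] (Fin n ⊕ Fin n → ℝ)}
    {f₂ : (Fin n₂ ⊕ Fin n₂ → ℝ) →ₗ[ℝ] (Fin n ⊕ Fin n → ℝ)}
    (h1 : ∀ x y, omega0 (f₁ x) (f₁ y) = omega0 x y) (h2 : ∀ x y, omega0 (f₂ x) (f₂ y) = omega0 x y)
    (h12 : ∀ x y, omega0 (f₁ x) (f₂ y) = 0) (hc : ∀ v, ∃ x y, v = f₁ x + f₂ y)
    (hM₁ : ∀ x, (M : Matrix _ _ ℝ) *ᵥ f₁ x = f₁ ((M₁ : Matrix _ _ ℝ) *ᵥ x))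
    (hM₂ : ∀ x, (M : Matrix _ _ ℝ) *ᵥ f₂ x = f₂ ((M₂ : Matrix _ _ ℝ) *ᵥ x)) :
    IsDirectSum M M₁ M₂ (complexify f₁) (complexify f₂) where
  omega_left x y := by
    obtain ⟨a, b, rfl⟩ := exists_eq_ofRealVec_add x
    obtain ⟨c, d, rfl⟩ := exists_eq_ofRealVec_add y
    simp only [map_add, map_smul, complexify_ofRealVec, omega0_add_left, omega0_add_right,
      omega0_smul_left, omega0_smul_right, omega0_ofRealVec, h1]
  omega_right x y := by
    obtain ⟨a, b, rfl⟩ := exists_eq_ofRealVec_add x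
    obtain ⟨c, d, rfl⟩ := exists_eq_ofRealVec_add y
    simp only [map_add, map_smul, complexify_ofRealVec, omega0_add_left, omega0_add_right,
      omega0_smul_left, omega0_smul_right, omega0_ofRealVec, h2]
  ortho x y := by
    obtain ⟨a, b, rfl⟩ := exists_eq_ofRealVec_add x
    obtain ⟨c, d, rfl⟩ := exists_eq_ofRealVec_add y
    simp [map_add, map_smul, complexify_ofRealVec, omega0_add_left, omega0_add_right,
      omega0_smul_left, omega0_smul_right, omega0_ofRealVec, h12]
  star_left := star_complexify f₁
  star_right := star_complexify f₂
  cover v := by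
    obtain ⟨a, b, rfl⟩ := exists_eq_ofRealVec_add v
    obtain ⟨x, y, rfl⟩ := hc a
    obtain ⟨x', y', rfl⟩ := hc b
    refine ⟨ofRealVec x + Complex.I • ofRealVec x', ofRealVec y + Complex.I • ofRealVec y', ?_⟩
    have hadd : ∀ a b : Fin n ⊕ Fin n → ℝ, ofRealVec (a + b) = ofRealVec a + ofRealVec b := by
      intro a b; ext i; simp [ofRealVec]
    simp only [map_add, map_smul, complexify_ofRealVec, hadd]
    module
  map_left x := by
    obtain ⟨a, b, rfl⟩ := exists_eq_ofRealVec_add x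
    simp only [map_add, map_smul, complexify_ofRealVec, mulVec_add, mulVec_smul,
      toComplex_mulVec_ofRealVec, hM₁]
  map_right x := by
    obtain ⟨a, b, rfl⟩ := exists_eq_ofRealVec_add x
    simp only [map_add, map_smul, complexify_ofRealVec, mulVec_add, mulVec_smul,
      toComplex_mulVec_ofRealVec, hM₂]

end MaslovType

end

noncomputable section

namespace MaslovType

open Module unitInterval

variable {n : ℕ}

/-! ### The degenerate cycle and the global perturbation -/

theorem ofReal_det_scalar_sub (M : Sp n) (x : ℝ) :
    (scalar (Fin n ⊕ Fin n) (x : ℂ) - toComplex M).det =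
      ((scalar (Fin n ⊕ Fin n) x - (M : Matrix _ _ ℝ)).det : ℝ) := by
  have h : scalar (Fin n ⊕ Fin n) (x : ℂ) - toComplex M =
      Complex.ofRealHom.mapMatrix (scalar (Fin n ⊕ Fin n) x - (M : Matrix _ _ ℝ)) := by
    ext i j
    by_cases h : i = j <;> simp [toComplex, scalar_apply, h]
  rw [h, ← RingHom.map_det]
  rfl

theorem mem_cycle_iff {M : Sp n} :
    M ∈ cycle n ↔ (1 : ℂ) ∈ eigenvalues M ∨ (-1 : ℂ) ∈ eigenvalues M := by
  have h1 := ofReal_det_scalar_sub M 1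
  have h2 := ofReal_det_scalar_sub M (-1)
  rw [Complex.ofReal_one] at h1
  rw [Complex.ofReal_neg, Complex.ofReal_one] at h2
  rw [mem_eigenvalues, mem_eigenvalues, h1, h2, Complex.ofReal_eq_zero, Complex.ofReal_eq_zero,
    map_one, map_neg, map_one]
  rfl

theorem expI_pi : expI Real.pi = -1 := by
  rw [expI, mul_comm, Complex.exp_pi_mul_I]

theorem expI_im (a : ℝ) : (expI a).im = Real.sin a := by
  rw [expI, mul_comm, Complex.exp_ofReal_mul_I_im]

theorem expI_re (a : ℝ) : (expI a).re = Real.cos a := by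
  rw [expI, mul_comm, Complex.exp_ofReal_mul_I_re]

theorem sin_eq_zero_iff_expI {a : ℝ} : Real.sin a = 0 ↔ expI a = 1 ∨ expI a = -1 := by
  constructor
  · intro h
    rcases Real.sin_eq_zero_iff_cos_eq.1 h with h1 | h1
    · left
      rw [expI_eq, h, h1]; simp
    · right
      rw [expI_eq, h, h1]; simp
  · rw [← expI_im]
    rintro (h | h) <;> simp [h]

theorem mem_map_of_mem_spec_rot {a : Fin n → ℝ} {z : ℂ} (hz : z ∈ spec (rot a))
    (h : firstKindMult (rot a) z ≠ 0) : ∃ j, expI (a j) = z := by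
  rw [firstKindMult_rot a hz] at h
  obtain ⟨j, -, hj⟩ := Multiset.mem_map.1 (Multiset.count_ne_zero.1 h)
  exact ⟨j, hj⟩

theorem expI_mem_spec_rot (a : Fin n → ℝ) (j : Fin n) : expI (a j) ∈ spec (rot a) := by
  have h : expI (a j) ∈ normalizedFirstKind (rot a) := by
    rw [normalizedFirstKind_rot]
    exact Multiset.mem_map_of_mem (fun j => expI (a j)) (Finset.mem_univ_val j)
  rw [normalizedFirstKind, Multiset.mem_sum] at h
  obtain ⟨z, hz, hw⟩ := h
  have h0 : firstKindMult (rot a) z ≠ 0 := by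
    intro h0
    rw [h0] at hw
    simp at hw
  obtain ⟨i, rfl⟩ := mem_map_of_mem_spec_rot hz h0
  rw [Multiset.eq_of_mem_replicate hw, norm_expI, Complex.ofReal_one, div_one]
  exact hz

theorem rot_mem_cycle_iff {a : Fin n → ℝ} : rot a ∈ cycle n ↔ ∃ j, Real.sin (a j) = 0 := by
  have key : ∀ z : ℂ, ‖z‖ = 1 → star z = z → z ∈ eigenvalues (rot a) → ∃ j, expI (a j) = z := by
    intro z hz hs h
    have h1 : z ∈ spec (rot a) := Multiset.mem_toFinset.2 h
    refine mem_map_of_mem_spec_rot h1 ?_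
    have h2 := mPlus_add_mPlus_star (rot a) hz
    have h3 := mem_spec_iff.1 h1
    rw [hs] at h2
    rw [firstKindMult_eq, if_pos hz]
    omega
  rw [mem_cycle_iff]
  constructor
  · rintro (h | h)
    · obtain ⟨j, hj⟩ := key 1 (by simp) (by simp) h
      exact ⟨j, sin_eq_zero_iff_expI.2 (Or.inl hj)⟩
    · obtain ⟨j, hj⟩ := key (-1) (by simp) (by simp) h
      exact ⟨j, sin_eq_zero_iff_expI.2 (Or.inr hj)⟩
  · rintro ⟨j, hj⟩
    have h := Multiset.mem_toFinset.1 (expI_mem_spec_rot a j)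
    rcases sin_eq_zero_iff_expI.1 hj with hj | hj
    · exact Or.inl (hj ▸ h)
    · exact Or.inr (hj ▸ h)

open scoped Matrix.Norms.Operator in
theorem exp_smul_J (t : ℝ) : NormedSpace.exp (t • J (Fin n) ℝ) =
    Real.cos t • (1 : Matrix (Fin n ⊕ Fin n) (Fin n ⊕ Fin n) ℝ) + Real.sin t • J (Fin n) ℝ := by
  let f : ℂ →ₐ[ℝ] Matrix (Fin n ⊕ Fin n) (Fin n ⊕ Fin n) ℝ :=
    Complex.lift ⟨J (Fin n) ℝ, J_squared (Fin n) ℝ⟩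
  have hI : f Complex.I = J (Fin n) ℝ := Complex.liftAux_apply_I _ (J_squared (Fin n) ℝ)
  have hf : Continuous f := LinearMap.continuous_of_finiteDimensional f.toLinearMap
  have h := NormedSpace.map_exp f hf (t • Complex.I)
  rw [map_smul, hI] at h
  refine h.symm.trans ?_
  rw [← hI, ← Complex.exp_eq_exp_ℂ, Complex.real_smul, Complex.exp_mul_I, ← map_one f,
    ← map_smul, ← map_smul, ← map_add]
  congr 1
  simp [Complex.real_smul]

theorem rotation_eq (n : ℕ) (θ : ℝ) : rotation n θ = rot fun _ => -θ := by
  refine Subtype.ext ?_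
  change NormedSpace.exp ((-θ) • J (Fin n) ℝ) = blockRotation fun _ => -θ
  rw [exp_smul_J]
  ext i j
  rcases i with i | i <;> rcases j with j | j <;> by_cases h : i = j <;>
    simp [J, blockRotation, fromBlocks, h, one_apply]

theorem rot_mul_rot (a b : Fin n → ℝ) : rot a * rot b = rot (a + b) := by
  refine Subtype.ext ?_
  change blockRotation a * blockRotation b = blockRotation (a + b)
  rw [blockRotation, blockRotation, fromBlocks_multiply, blockRotation]
  simp only [neg_mul, mul_neg, diagonal_mul_diagonal, diagonal_add, Pi.add_apply,
    Real.cos_add, Real.sin_add]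
  congr 1
  all_goals
    ext i j
    by_cases h : i = j <;> simp [h] <;> ring

theorem expI_eq_of_rot_eq {a b : Fin n → ℝ} (h : rot a = rot b) (j : Fin n) :
    expI (a j) = expI (b j) := by
  have h' : blockRotation a = blockRotation b := congrArg Subtype.val h
  have h1 := congrFun (congrFun h' (Sum.inl j)) (Sum.inl j)
  have h2 := congrFun (congrFun h' (Sum.inr j)) (Sum.inl j)
  simp only [blockRotation, fromBlocks_apply₁₁, fromBlocks_apply₂₁, diagonal_apply_eq] at h1 h2
  rw [expI_eq, expI_eq, h1, h2]

/-! ### The rotation number of a path off the degenerate cycle -/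

theorem rotationNumber_of_notMem_cycle {β : SpPath n} (h : ∀ t, β t ∉ cycle n) :
    rotationNumber β = (angleSum (β 1) Real.pi - angleSum (β 0) Real.pi) / Real.pi := by
  have hπ := Real.pi_ne_zero
  have hπ' : (Real.pi : ℂ) ≠ 0 := by exact_mod_cast hπ
  have hmem : ∀ t, expI Real.pi ∉ eigenvalues (β t) := fun t ht =>
    h t (mem_cycle_iff.2 (Or.inr (expI_pi ▸ ht)))
  have hreal : ∀ M : Sp n, ∃ x : ℝ, charFun M Real.pi = x := by
    intro M
    refine ⟨(-1) ^ n * (scalar (Fin n ⊕ Fin n) (-1) - (M : Matrix _ _ ℝ)).det, ?_⟩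
    rw [charFun, expI_pi, star_neg, star_one, Complex.ofReal_mul, ← ofReal_det_scalar_sub]
    push_cast
    rfl
  obtain ⟨α, hα, hd⟩ := hasRotationNumber β
  have hc : Continuous fun t => angleSum (β t) Real.pi := continuous_iff_continuousAt.2 fun t =>
    ContinuousAt.comp (g := fun M : Sp n => angleSum M Real.pi)
      (continuousAt_angleSum Real.pi_pos le_rfl (hmem t)) β.continuous.continuousAt
  have key := lift_sub_eq (α := fun t => 2 * α t)
    (β := fun t => 2 * (angleSum (β t) Real.pi / Real.pi)) (c := 1) (by fun_prop) (by fun_prop) (by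
      intro t
      have h1 := rho_eq Real.pi_pos le_rfl (hmem t)
      obtain ⟨x, hx⟩ := hreal (β t)
      have hx0 := charFun_ne_zero (hmem t)
      rw [hx] at h1 hx0
      rw [hα] at h1
      have h2 : ((-1 : ℂ) ^ n * (‖(x : ℂ)‖ / x)) ^ 2 = 1 := by
        rw [mul_pow, ← pow_mul, mul_comm n, pow_mul, neg_one_sq, one_pow, one_mul, div_pow,
          Complex.norm_real, Real.norm_eq_abs, ← Complex.ofReal_pow, sq_abs, Complex.ofReal_pow]
        exact div_self (pow_ne_zero 2 hx0)
      have h3 : ∀ (x : ℂ), Complex.exp (Complex.I * Real.pi * (2 * x)) =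
          Complex.exp (Complex.I * Real.pi * x) ^ 2 := by
        intro x
        rw [← Complex.exp_nat_mul]
        congr 1
        push_cast
        ring
      have h4 : Complex.I * (Real.pi : ℂ) * ((angleSum (β t) Real.pi / Real.pi : ℝ) : ℂ) =
          Complex.I * (angleSum (β t) Real.pi : ℂ) := by
        push_cast
        field_simp
      rw [one_mul, Complex.ofReal_mul, Complex.ofReal_mul, Complex.ofReal_ofNat, h3, h3, h1, h4,
        mul_pow, h2, one_mul]) 0 1
  rw [← hd]
  field_simp at key ⊢
  linarith

theorem angleSum_rot {a : Fin n → ℝ} (h : ∀ j, Real.sin (a j) ≠ 0) :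
    angleSum (rot a) Real.pi = ∑ j, (expI (a j)).arg := by
  classical
  set s := Multiset.map (fun j => expI (a j)) Finset.univ.val with hs
  have h1 : ∑ j, (expI (a j)).arg = (s.map Complex.arg).sum := by
    rw [hs, Multiset.map_map]
    rfl
  have hsub : s.toFinset ⊆ spec (rot a) := fun z hz => by
    obtain ⟨j, -, rfl⟩ := Multiset.mem_map.1 (Multiset.mem_toFinset.1 hz)
    exact expI_mem_spec_rot a j
  rw [h1, Finset.sum_multiset_map_count, Finset.sum_subset hsub fun z _ hz => by
    rw [Multiset.count_eq_zero_of_notMem fun h => hz (Multiset.mem_toFinset.2 h), zero_smul]]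
  rw [Finset.sum_congr rfl fun z hz => by rw [hs, ← firstKindMult_rot a hz], sum_spec_eq]
  have h2 : ∑ z ∈ (spec (rot a)).filter (fun z => z.im = 0),
      firstKindMult (rot a) z • z.arg = 0 := by
    refine Finset.sum_eq_zero fun z hz => ?_
    obtain ⟨hz1, hz2⟩ := Finset.mem_filter.1 hz
    by_contra hne
    obtain ⟨j, rfl⟩ := mem_map_of_mem_spec_rot hz1 fun h0 => hne (by rw [h0, zero_smul])
    exact h j (by rwa [← expI_im])
  rw [h2, add_zero, angleSum]
  have hup : upper (rot a) ⊆ (spec (rot a)).filter (fun z => 0 < z.im) := fun z hz => by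
    obtain ⟨hz1, hz2⟩ := Finset.mem_filter.1 hz
    exact Finset.mem_filter.2 ⟨hz1, hz2.2⟩
  rw [← Finset.sum_subset hup]
  · refine Finset.sum_congr rfl fun z hz => ?_
    obtain ⟨hz1, hz2⟩ := arg_of_mem_upper hz
    have hn := (Finset.mem_filter.1 hz).2.1
    have hn' : ‖star z‖ = 1 := by rw [norm_star, hn]
    rw [if_neg (not_le.2 hz2), firstKindMult_eq, firstKindMult_eq, if_pos hn, if_pos hn', kreinSign,
      Complex.star_def, Complex.arg_conj, if_neg hz2.ne]
    simp only [nsmul_eq_mul]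
    push_cast
    ring
  · intro z hz hz'
    obtain ⟨hz1, hz2⟩ := Finset.mem_filter.1 hz
    have hn : ‖z‖ ≠ 1 := fun hn => hz' (Finset.mem_filter.2 ⟨hz1, hn, hz2⟩)
    have h3 : ∀ w ∈ spec (rot a), ‖w‖ ≠ 1 → firstKindMult (rot a) w = 0 := by
      intro w hw hw'
      by_contra hne
      obtain ⟨j, rfl⟩ := mem_map_of_mem_spec_rot hw hne
      exact hw' (norm_expI _)
    rw [h3 z hz1 hn, h3 _ (star_mem_spec hz1) (by rwa [norm_star]), zero_smul, zero_smul, add_zero]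

end MaslovType

end

noncomputable section

namespace MaslovType

open Module unitInterval

variable {n : ℕ}

/-! ### Angles modulo `π` -/

theorem expI_eq_iff {a b : ℝ} : expI a = expI b ↔ ∃ k : ℤ, a = b + 2 * Real.pi * k := by
  rw [expI, expI, Complex.exp_eq_exp_iff_exists_int]
  refine exists_congr fun k => ⟨fun h => ?_, fun h => ?_⟩
  · have h1 : Complex.I * (a : ℂ) = Complex.I * ((b + 2 * Real.pi * k : ℝ) : ℂ) := by
      rw [h]; push_cast; ring
    exact_mod_cast mul_left_cancel₀ Complex.I_ne_zero h1
  · rw [h]; push_cast; ring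

theorem rot_eq_of_expI_eq {a b : Fin n → ℝ} (h : ∀ j, expI (a j) = expI (b j)) : rot a = rot b := by
  have hc : (fun j => Real.cos (a j)) = fun j => Real.cos (b j) := by
    ext j; rw [← expI_re, h, expI_re]
  have hs : (fun j => Real.sin (a j)) = fun j => Real.sin (b j) := by
    ext j; rw [← expI_im, h, expI_im]
  refine Subtype.ext ?_
  change blockRotation a = blockRotation b
  rw [blockRotation, blockRotation, hc, hs]

theorem fract_eq_of_expI_eq {a b : ℝ} (h : expI a = expI b) :
    Int.fract (a / Real.pi) = Int.fract (b / Real.pi) := by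
  obtain ⟨k, rfl⟩ := expI_eq_iff.1 h
  have hπ := Real.pi_ne_zero
  rw [show (b + 2 * Real.pi * k) / Real.pi = b / Real.pi + ((2 * k : ℤ) : ℝ) by
    push_cast; field_simp]
  exact Int.fract_add_intCast _ _

theorem arg_expI_of_pos {a : ℝ} (h : 0 < Real.sin a) :
    0 < (expI a).arg ∧ (expI a).arg < Real.pi := by
  rw [← expI_im] at h
  refine ⟨(Complex.arg_nonneg_iff.2 h.le).lt_of_ne fun h0 => ?_,
    (Complex.arg_le_pi _).lt_of_ne fun h0 => ?_⟩
  · exact h.ne' (Complex.arg_eq_zero_iff.1 h0.symm).2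
  · exact h.ne' (Complex.arg_eq_pi_iff.1 h0).2

theorem arg_expI_of_neg {a : ℝ} (h : Real.sin a < 0) :
    -Real.pi < (expI a).arg ∧ (expI a).arg < 0 := by
  rw [← expI_im] at h
  exact ⟨Complex.neg_pi_lt_arg _, Complex.arg_neg_iff.2 h⟩

theorem fract_arg_expI (a : ℝ) : Int.fract ((expI a).arg / Real.pi) = Int.fract (a / Real.pi) :=
  fract_eq_of_expI_eq (expI_arg (norm_expI a))

theorem arg_expI_eq_of_pos {a : ℝ} (h : 0 < Real.sin a) :
    (expI a).arg = Real.pi * Int.fract (a / Real.pi) := by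
  obtain ⟨h1, h2⟩ := arg_expI_of_pos h
  have h3 : Int.fract ((expI a).arg / Real.pi) = (expI a).arg / Real.pi :=
    Int.fract_eq_self.2 ⟨(div_pos h1 Real.pi_pos).le, (div_lt_one Real.pi_pos).2 h2⟩
  rw [← fract_arg_expI, h3, mul_div_cancel₀ _ Real.pi_ne_zero]

theorem arg_expI_eq_of_neg {a : ℝ} (h : Real.sin a < 0) :
    (expI a).arg = Real.pi * Int.fract (a / Real.pi) - Real.pi := by
  obtain ⟨h1, h2⟩ := arg_expI_of_neg h
  have h3 : Int.fract ((expI a).arg / Real.pi) = (expI a).arg / Real.pi + 1 := by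
    refine Int.fract_eq_iff.2 ⟨?_, ?_, -1, by push_cast; ring⟩
    · have : -1 < (expI a).arg / Real.pi := by rw [lt_div_iff₀ Real.pi_pos]; linarith
      linarith
    · have := div_neg_of_neg_of_pos h2 Real.pi_pos
      linarith
  rw [← fract_arg_expI, h3, mul_add, mul_div_cancel₀ _ Real.pi_ne_zero]
  ring

/-- The angle of `w` in units of `π`, reduced modulo `1` to the interval `(0, 1]`. -/
def angleHeight (w : ℂ) : ℝ := w.arg / Real.pi - ⌈w.arg / Real.pi⌉ + 1

theorem angleHeight_pos (w : ℂ) : 0 < angleHeight w := by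
  have := Int.ceil_lt_add_one (w.arg / Real.pi)
  unfold angleHeight
  linarith

theorem angleHeight_le_one (w : ℂ) : angleHeight w ≤ 1 := by
  have := Int.le_ceil (w.arg / Real.pi)
  unfold angleHeight
  linarith

theorem exists_int_angleHeight (a : ℝ) :
    ∃ k : ℤ, a / Real.pi = angleHeight (expI a) + k := by
  obtain ⟨k, hk⟩ := expI_eq_iff.1 (expI_arg (norm_expI a)).symm
  refine ⟨2 * k + ⌈(expI a).arg / Real.pi⌉ - 1, ?_⟩
  have h1 : a / Real.pi = (expI a).arg / Real.pi + 2 * k := by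
    rw [div_add' _ _ _ Real.pi_ne_zero]
    congr 1
    linarith
  rw [h1, angleHeight]
  push_cast
  ring

theorem sin_eq_zero_iff_div {x : ℝ} : Real.sin x = 0 ↔ ∃ k : ℤ, x / Real.pi = k := by
  rw [Real.sin_eq_zero_iff]
  exact exists_congr fun k => by rw [div_eq_iff Real.pi_ne_zero, eq_comm]

theorem sin_sub_ne_zero {a θ : ℝ} (h0 : 0 < θ) (h1 : θ < Real.pi * angleHeight (expI a)) :
    Real.sin (a - θ) ≠ 0 := by
  intro h
  obtain ⟨k, hk⟩ := sin_eq_zero_iff_div.1 h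
  obtain ⟨m, hm⟩ := exists_int_angleHeight a
  rw [sub_div, hm] at hk
  have h2 := div_pos h0 Real.pi_pos
  have h3 : θ / Real.pi < angleHeight (expI a) := (div_lt_iff₀' Real.pi_pos).2 h1
  have h4 := angleHeight_le_one (expI a)
  have h5 : (0 : ℝ) < ((k - m : ℤ) : ℝ) := by push_cast; linarith
  have h6 : ((k - m : ℤ) : ℝ) < 1 := by push_cast; linarith
  have h7 : 0 < k - m := by exact_mod_cast h5
  have h8 : k - m < 1 := by exact_mod_cast h6
  omega

theorem fract_sub_div_pi {a θ : ℝ} (h0 : 0 ≤ θ) (h1 : θ < Real.pi * angleHeight (expI a))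
    (h : Real.sin (a - θ) ≠ 0) :
    Int.fract ((a - θ) / Real.pi) = angleHeight (expI a) - θ / Real.pi := by
  obtain ⟨m, hm⟩ := exists_int_angleHeight a
  have h2 := div_nonneg h0 Real.pi_pos.le
  have h3 : θ / Real.pi < angleHeight (expI a) := (div_lt_iff₀' Real.pi_pos).2 h1
  have h4 := angleHeight_le_one (expI a)
  refine Int.fract_eq_iff.2 ⟨by linarith, lt_of_le_of_ne (by linarith) fun h5 => h ?_, m, ?_⟩
  · refine sin_eq_zero_iff_div.2 ⟨m + 1, ?_⟩
    rw [sub_div, hm]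
    push_cast
    linarith
  · rw [sub_div, hm]
    ring

theorem exp_angleHeight {w : ℂ} (hw : ‖w‖ = 1) :
    Complex.exp (2 * Complex.I * Real.pi * (angleHeight w : ℂ)) = w ^ 2 := by
  obtain ⟨k, hk⟩ := exists_int_angleHeight w.arg
  rw [expI_arg hw] at hk
  conv_rhs => rw [← expI_arg hw, expI, ← Complex.exp_nat_mul]
  rw [Complex.exp_eq_exp_iff_exists_int]
  refine ⟨-k, ?_⟩
  have h : angleHeight w = w.arg / Real.pi - k := by linarith
  have hπ : (Real.pi : ℂ) ≠ 0 := by exact_mod_cast Real.pi_ne_zero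
  rw [h]
  push_cast
  field_simp
  ring

/-! ### Extensions -/

/-- The rotation number of an extension. -/
theorem IsExtension.rotationNumber_eq {Ψ β : SpPath n} (h : IsExtension Ψ β) {a b : Fin n → ℝ}
    (ha : Ψ 0 = rot a) (hb : Ψ 1 = rot b) : rotationNumber β =
      ∑ j, Int.fract (a j / Real.pi) - ∑ j, Int.fract (b j / Real.pi) := by
  obtain ⟨hβ, h0, a', b', w, ha', hb', hw', hw⟩ := h
  have ha'' : Ψ 0 = rot a' := Subtype.ext ha'
  have hb'' : Ψ 1 = rot b' := Subtype.ext hb'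
  have hw'' : β 1 = rot w := Subtype.ext hw'
  have hea := expI_eq_of_rot_eq (ha.symm.trans ha'')
  have heb := expI_eq_of_rot_eq (hb.symm.trans hb'')
  have hnw : ∀ j, Real.sin (w j) ≠ 0 := fun j hj =>
    hβ 1 (hw'' ▸ rot_mem_cycle_iff.2 ⟨j, hj⟩)
  have hnb : ∀ j, Real.sin (b' j) ≠ 0 := fun j hj =>
    hβ 0 (h0 ▸ hb'' ▸ rot_mem_cycle_iff.2 ⟨j, hj⟩)
  rw [rotationNumber_of_notMem_cycle hβ, h0, hb'', hw'', angleSum_rot hnw, angleSum_rot hnb,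
    ← Finset.sum_sub_distrib, ← Finset.sum_sub_distrib, Finset.sum_div]
  refine Finset.sum_congr rfl fun j _ => ?_
  rw [fract_eq_of_expI_eq (hea j), fract_eq_of_expI_eq (heb j), div_eq_iff Real.pi_ne_zero]
  have hfw : Int.fract (w j / Real.pi) = Int.fract (a' j / Real.pi) := by
    rcases hw j with ⟨-, h⟩ | ⟨-, h⟩
    · rw [h]
    · rw [h, add_div, div_self Real.pi_ne_zero, Int.fract_add_one]
  have hsign : 0 < Real.sin (w j) * Real.sin (b' j) := by
    rcases hw j with ⟨h1, h⟩ | ⟨h1, h⟩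
    · rwa [h]
    · rw [h, Real.sin_add_pi]
      linarith
  rcases (hnb j).lt_or_gt with hb0 | hb0
  · have hw0 : Real.sin (w j) < 0 := neg_of_mul_pos_left hsign hb0.le
    rw [arg_expI_eq_of_neg hb0, arg_expI_eq_of_neg hw0, hfw]
    ring
  · have hw0 : 0 < Real.sin (w j) := pos_of_mul_pos_left hsign hb0.le
    rw [arg_expI_eq_of_pos hb0, arg_expI_eq_of_pos hw0, hfw]
    ring

theorem exists_isExtension {Ψ : SpPath n} {a b : Fin n → ℝ} (ha : Ψ 0 = rot a) (hb : Ψ 1 = rot b)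
    (h0 : Ψ 0 ∉ cycle n) (h1 : Ψ 1 ∉ cycle n) : ∃ β, IsExtension Ψ β := by
  have hna : ∀ j, Real.sin (a j) ≠ 0 := fun j hj => h0 (ha ▸ rot_mem_cycle_iff.2 ⟨j, hj⟩)
  have hnb : ∀ j, Real.sin (b j) ≠ 0 := fun j hj => h1 (hb ▸ rot_mem_cycle_iff.2 ⟨j, hj⟩)
  obtain ⟨w, hw⟩ : ∃ w : Fin n → ℝ, ∀ j, (0 < Real.sin (a j) * Real.sin (b j) ∧ w j = a j) ∨
      (Real.sin (a j) * Real.sin (b j) < 0 ∧ w j = a j + Real.pi) := by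
    refine ⟨fun j => if 0 < Real.sin (a j) * Real.sin (b j) then a j else a j + Real.pi,
      fun j => ?_⟩
    by_cases h : 0 < Real.sin (a j) * Real.sin (b j)
    · exact Or.inl ⟨h, if_pos h⟩
    · exact Or.inr ⟨(not_lt.1 h).lt_of_ne (mul_ne_zero (hna j) (hnb j)), if_neg h⟩
  have hsign : ∀ j, 0 < Real.sin (w j) * Real.sin (b j) := by
    intro j
    rcases hw j with ⟨h1, h⟩ | ⟨h1, h⟩
    · rwa [h]
    · rw [h, Real.sin_add_pi]
      linarith
  let β : SpPath n := ⟨fun t => rot fun j =>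
    (1 - (t : ℝ)) * (expI (b j)).arg + (t : ℝ) * (expI (w j)).arg,
    continuous_rot.comp (by fun_prop)⟩
  have hβ0 : β 0 = rot b := rot_eq_of_expI_eq fun j => by
    simp [expI_arg (norm_expI _)]
  have hβ1 : β 1 = rot w := rot_eq_of_expI_eq fun j => by
    simp [expI_arg (norm_expI _)]
  refine ⟨β, fun t ht => ?_, hβ0.trans hb.symm, a, b, w, congrArg Subtype.val ha,
    congrArg Subtype.val hb, congrArg Subtype.val hβ1, hw⟩
  obtain ⟨j, hj⟩ := rot_mem_cycle_iff.1 ht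
  have ht0 : 0 ≤ (t : ℝ) := t.2.1
  have ht1 : 0 ≤ 1 - (t : ℝ) := sub_nonneg.2 t.2.2
  rcases (hnb j).lt_or_gt with hb0 | hb0
  · have hw0 : Real.sin (w j) < 0 := neg_of_mul_pos_left (hsign j) hb0.le
    have := convex_Ioo _ _ (arg_expI_of_neg hb0) (arg_expI_of_neg hw0) ht1 ht0 (by ring)
    exact (Real.sin_neg_of_neg_of_neg_pi_lt this.2 this.1).ne hj
  · have hw0 : 0 < Real.sin (w j) := pos_of_mul_pos_left (hsign j) hb0.le
    have := convex_Ioo _ _ (arg_expI_of_pos hb0) (arg_expI_of_pos hw0) ht1 ht0 (by ring)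
    exact (Real.sin_pos_of_pos_of_lt_pi this.1 this.2).ne' hj

/-! ### Orthogonalizations -/

theorem rotationNumber_rot_line (a v : Fin n → ℝ) {Φ : SpPath n}
    (h : ∀ t, Φ t = rot (a + (t : ℝ) • v)) : rotationNumber Φ = (∑ j, v j) / Real.pi := by
  have hπ : (Real.pi : ℂ) ≠ 0 := by exact_mod_cast Real.pi_ne_zero
  refine HasRotationNumber.eq ⟨⟨fun t => (∑ j, a j + t * ∑ j, v j) / Real.pi, by fun_prop⟩,
    fun t => ?_, ?_⟩
  · rw [h, rho_rot]
    congr 1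
    simp only [Pi.add_apply, Pi.smul_apply, smul_eq_mul, Finset.sum_add_distrib, ← Finset.mul_sum,
      ContinuousMap.coe_mk]
    push_cast
    field_simp
  · simp
    ring

/-- The global perturbation does not change the rotation number of a path between rotations. -/
theorem rotationNumber_perturb (θ : ℝ) {Ψ : SpPath n} {a b : Fin n → ℝ} (ha : Ψ 0 = rot a)
    (hb : Ψ 1 = rot b) : rotationNumber (perturb θ Ψ) = rotationNumber Ψ := by
  let H : C(I × I, Sp n) := ⟨fun p => rot (fun _ => (p.1 : ℝ) * (-θ)) * Ψ p.2,
    (continuous_rot.comp (by fun_prop)).mul (by fun_prop)⟩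
  let Q : (Fin n → ℝ) → SpPath n := fun a => ⟨fun t => rot (a + (t : ℝ) • fun _ => -θ),
    continuous_rot.comp (by fun_prop)⟩
  have key := rotationNumber_square (H := H) (P₀ := Ψ) (P₁ := perturb θ Ψ) (Q₀ := Q a) (Q₁ := Q b)
    (fun t => by
      have h1 : rot (fun _ : Fin n => (0 : ℝ)) = 1 := by
        refine mul_left_cancel (a := rot fun _ : Fin n => (0 : ℝ)) ?_
        rw [rot_mul_rot, mul_one]
        congr 1
        ext j
        simp
      simp [H, h1])
    (fun t => by simp [H, perturb, rotation_eq])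
    (fun s => by
      simp only [H, ContinuousMap.coe_mk, ha, rot_mul_rot, Q]
      congr 1
      ext j
      simp [add_comm])
    (fun s => by
      simp only [H, ContinuousMap.coe_mk, hb, rot_mul_rot, Q]
      congr 1
      ext j
      simp [add_comm])
  rw [rotationNumber_rot_line a _ (Φ := Q a) (fun t => rfl),
    rotationNumber_rot_line b _ (Φ := Q b) (fun t => rfl)] at key
  linarith

theorem IsOrthogonalization.rotationNumber_eq {Φ Ψ : SpPath n} (h : IsOrthogonalization Φ Ψ) :
    rotationNumber Ψ = rotationNumber Φ := by
  obtain ⟨h1, -, h2, -, h3⟩ := h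
  have e1 := rotationNumber_piece_add Ψ 0 ⟨1 / 3, by norm_num, by norm_num⟩
    ⟨2 / 3, by norm_num, by norm_num⟩
  have e2 := rotationNumber_piece_add Ψ 0 ⟨2 / 3, by norm_num, by norm_num⟩ 1
  simp only [Set.Icc.coe_zero, Set.Icc.coe_one] at e1 e2
  rw [piece_zero_one] at e2
  rw [h1, h2.eq] at e1
  rw [h3.eq] at e2
  linarith

/-- Every symplectic matrix is joined to a normal form by a path with rotation number `0`. -/
theorem exists_path_normalForm (M : Sp n) :
    ∃ γ : SpPath n, IsNormalForm M (γ 0) ∧ γ 1 = M ∧ rotationNumber γ = 0 := by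
  obtain ⟨a, ha⟩ := exists_normalForm M
  obtain ⟨p⟩ := joined_symplectic (rot a) M
  set P : SpPath n := p.toContinuousMap with hP
  have hP0 : P 0 = rot a := p.source
  have hP1 : P 1 = M := p.target
  rcases Nat.eq_zero_or_pos n with rfl | hn
  · exact ⟨P, hP0 ▸ ha, hP1, rotationNumber_const fun t =>
      Subtype.ext (Matrix.ext fun i => by rcases i with i | i <;> exact i.elim0)⟩
  have hexp := exp_rotationNumber P
  rw [hP0, hP1, ha.rho_eq] at hexp
  have hρ : rho M ≠ 0 := norm_ne_zero_iff.1 (by rw [norm_rho]; exact one_ne_zero)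
  obtain ⟨k, hk⟩ := Complex.exp_eq_one_iff.1 (mul_right_cancel₀ hρ (hexp.trans (one_mul _).symm))
  have hk' : Real.pi * rotationNumber P = 2 * Real.pi * k := by
    have : Complex.I * ((Real.pi * rotationNumber P : ℝ) : ℂ) =
        Complex.I * ((2 * Real.pi * k : ℝ) : ℂ) := by
      push_cast
      linear_combination hk
    exact_mod_cast mul_left_cancel₀ Complex.I_ne_zero this
  set v : Fin n → ℝ := Pi.single ⟨0, hn⟩ (Real.pi * rotationNumber P) with hv
  have hrot0 : ∀ x : Fin n → ℝ, rot ((0 : ℝ) • x) = 1 := fun x => by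
    refine mul_left_cancel (a := rot ((0 : ℝ) • x)) ?_
    rw [rot_mul_rot, mul_one, zero_smul, add_zero]
  let H : C(I × I, Sp n) := ⟨fun q => rot (((q.1 : ℝ) * (1 - (q.2 : ℝ))) • v) * P q.2,
    (continuous_rot.comp (by fun_prop)).mul (by fun_prop)⟩
  let γ : SpPath n := ⟨fun t => H (1, t), by fun_prop⟩
  have hγ0 : γ 0 = rot a := by
    have h : γ 0 = rot (v + a) := by simp [γ, H, hP0, rot_mul_rot]
    rw [h]
    refine rot_eq_of_expI_eq fun j => expI_eq_iff.2 ?_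
    by_cases hj : j = ⟨0, hn⟩
    · refine ⟨k, ?_⟩
      rw [hj, Pi.add_apply, hv, Pi.single_eq_same, hk', add_comm]
    · exact ⟨0, by rw [Pi.add_apply, hv, Pi.single_eq_of_ne hj]; simp⟩
  have hH1 : ∀ s, H (s, 1) = M := fun s => by
    simp only [H, ContinuousMap.coe_mk, Set.Icc.coe_one, sub_self, mul_zero, hrot0, one_mul, hP1]
  refine ⟨γ, hγ0 ▸ ha, hH1 1, ?_⟩
  let Q : SpPath n := ⟨fun s => rot (a + (s : ℝ) • v), continuous_rot.comp (by fun_prop)⟩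
  have key := rotationNumber_square (H := H) (P₀ := P) (P₁ := γ) (Q₀ := Q)
    (Q₁ := ContinuousMap.const I M)
    (fun t => by
      simp only [H, ContinuousMap.coe_mk, Set.Icc.coe_zero, zero_mul, hrot0, one_mul])
    (fun t => rfl)
    (fun s => by
      simp only [H, ContinuousMap.coe_mk, Set.Icc.coe_zero, sub_zero, mul_one, hP0, rot_mul_rot, Q,
        add_comm])
    (fun s => hH1 s)
  rw [rotationNumber_rot_line a v (Φ := Q) (fun t => rfl),
    rotationNumber_const (Φ := ContinuousMap.const I M) (fun _ => rfl), hv,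
    Finset.sum_pi_single', if_pos (Finset.mem_univ _), mul_div_cancel_left₀ _ Real.pi_ne_zero]
    at key
  linarith

theorem exists_isOrthogonalization (Φ : SpPath n) : ∃ Ψ, IsOrthogonalization Φ Ψ := by
  obtain ⟨γ₀, hn₀, he₀, hr₀⟩ := exists_path_normalForm (Φ 0)
  obtain ⟨γ₁, hn₁, he₁, hr₁⟩ := exists_path_normalForm (Φ 1)
  let c : ℝ → I := Set.projIcc 0 1 zero_le_one
  have hc : Continuous c := continuous_projIcc
  have hc0 : ∀ x : ℝ, x ≤ 0 → c x = 0 := fun x hx => Set.projIcc_of_le_left _ hx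
  have hc1 : ∀ x : ℝ, 1 ≤ x → c x = 1 := fun x hx => Set.projIcc_of_right_le _ hx
  have hct : ∀ (t : I) (x : ℝ), x = t → c x = t := fun t x hx => by
    rw [hx]
    exact Set.projIcc_val _ t
  let Ψ : SpPath n := ⟨fun t => γ₀ (c (3 * t)) * (Φ 0)⁻¹ * Φ (c (3 * t - 1)) * (Φ 1)⁻¹ *
    γ₁ (c (3 - 3 * t)), by fun_prop⟩
  have hleft : ∀ t : I, (t : ℝ) ≤ 1 / 3 → Ψ t = γ₀ (c (3 * t)) := fun t ht => by
    simp only [Ψ, ContinuousMap.coe_mk]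
    rw [hc0 (3 * t - 1) (by linarith), hc1 (3 - 3 * t) (by linarith), he₁]
    simp
  have hmid : ∀ t : I, 1 / 3 ≤ (t : ℝ) → (t : ℝ) ≤ 2 / 3 → Ψ t = Φ (c (3 * t - 1)) :=
    fun t ht ht' => by
      simp only [Ψ, ContinuousMap.coe_mk]
      rw [hc1 (3 * t) (by linarith), hc1 (3 - 3 * t) (by linarith), he₁, he₀]
      simp
  have hright : ∀ t : I, 2 / 3 ≤ (t : ℝ) → Ψ t = γ₁ (c (3 - 3 * t)) := fun t ht => by
    simp only [Ψ, ContinuousMap.coe_mk]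
    rw [hc1 (3 * t) (by linarith), hc1 (3 * t - 1) (by linarith), he₀]
    simp
  have hb : ∀ t : I, 0 ≤ (t : ℝ) ∧ (t : ℝ) ≤ 1 := fun t => t.2
  have hp0 : piece Ψ 0 (1 / 3) = γ₀ := by
    ext1 t
    have ht := hb t
    rw [piece_apply Ψ t ⟨t / 3, by linarith, by linarith⟩ (by simp only; ring),
      hleft _ (by simp only; linarith), hct t _ (by simp only; ring)]
  have hp1 : piece Ψ (1 / 3) (2 / 3) = Φ := by
    ext1 t
    have ht := hb t
    rw [piece_apply Ψ t ⟨(1 + t) / 3, by linarith, by linarith⟩ (by simp only; ring),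
      hmid _ (by simp only; linarith) (by simp only; linarith), hct t _ (by simp only; ring)]
  have hp2 : ∀ t, piece Ψ (2 / 3) 1 t = γ₁ (σ t) := fun t => by
    have ht := hb t
    rw [piece_apply Ψ t ⟨(2 + t) / 3, by linarith, by linarith⟩ (by simp only; ring),
      hright _ (by simp only; linarith), hct (σ t) _ (by simp only [coe_symm_eq]; ring)]
  refine ⟨Ψ, hp1, ?_, ?_, ?_, ?_⟩
  · rw [hleft 0 (by norm_num), hct 0 _ (by simp)]
    exact hn₀
  · rw [hp0, ← hr₀]
    exact hasRotationNumber γ₀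
  · rw [hright 1 (by norm_num), hct 0 _ (by simp)]
    exact hn₁
  · obtain ⟨α, hα, hd⟩ := hasRotationNumber γ₁
    refine ⟨⟨fun t => α (σ t), by fun_prop⟩, fun t => by rw [hp2, hα]; rfl, ?_⟩
    simp only [ContinuousMap.coe_mk, symm_zero, symm_one]
    linarith

end MaslovType

end

noncomputable section

namespace MaslovType

open Module unitInterval

variable {n : ℕ}

/-! ### The index -/

/-- The sum of the reduced angles of the eigenvalues of the first kind. -/
def height (M : Sp n) : ℝ := ((normalizedFirstKind M).map angleHeight).sum

theorem exp_height (M : Sp n) :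
    Complex.exp (2 * Complex.I * Real.pi * (height M : ℂ)) = rho M ^ 2 := by
  have key : ∀ s : Multiset ℂ, (∀ w ∈ s, ‖w‖ = 1) →
      Complex.exp (2 * Complex.I * Real.pi * ((s.map angleHeight).sum : ℂ)) = s.prod ^ 2 := by
    intro s
    induction s using Multiset.induction_on with
    | empty => simp
    | cons w s ih =>
      intro h
      rw [Multiset.map_cons, Multiset.sum_cons, Multiset.prod_cons, Complex.ofReal_add, mul_add,
        Complex.exp_add, mul_pow, ih fun w hw => h w (Multiset.mem_cons_of_mem hw),
        exp_angleHeight (h w (Multiset.mem_cons_self w s))]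
  rw [rho_eq_normalizedFirstKind_prod]
  exact key _ fun w hw => norm_of_mem_normalizedFirstKind hw

theorem exists_int_index (Φ : SpPath n) :
    ∃ k : ℤ, (k : ℝ) = rotationNumber Φ - height (Φ 1) + height (Φ 0) := by
  have h1 := exp_rotationNumber Φ
  have h2 : Complex.exp (2 * Complex.I * Real.pi *
      ((rotationNumber Φ - height (Φ 1) + height (Φ 0) : ℝ) : ℂ)) = 1 := by
    have h3 : 2 * Complex.I * Real.pi *
        ((rotationNumber Φ - height (Φ 1) + height (Φ 0) : ℝ) : ℂ) =
        (Complex.I * Real.pi * rotationNumber Φ + Complex.I * Real.pi * rotationNumber Φ) +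
          2 * Complex.I * Real.pi * height (Φ 0) - 2 * Complex.I * Real.pi * height (Φ 1) := by
      push_cast
      ring
    have hρ : rho (Φ 1) ≠ 0 := norm_ne_zero_iff.1 (by rw [norm_rho]; exact one_ne_zero)
    rw [h3, Complex.exp_sub, Complex.exp_add, Complex.exp_add, exp_height, exp_height,
      div_eq_one_iff_eq (pow_ne_zero 2 hρ), ← h1]
    ring
  obtain ⟨k, hk⟩ := Complex.exp_eq_one_iff.1 h2
  refine ⟨k, ?_⟩
  have h4 : (2 * Real.pi * Complex.I : ℂ) ≠ 0 := by simp [Real.pi_ne_zero]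
  have h5 : (2 * Real.pi * Complex.I : ℂ) *
      ((rotationNumber Φ - height (Φ 1) + height (Φ 0) : ℝ) : ℂ) =
      (2 * Real.pi * Complex.I : ℂ) * ((k : ℝ) : ℂ) := by
    rw [Complex.ofReal_intCast]
    linear_combination hk
  exact_mod_cast (mul_left_cancel₀ h4 h5).symm

/-- The Maslov-type index. -/
def maslovIndex (Φ : SpPath n) : ℤ := (exists_int_index Φ).choose

theorem maslovIndex_eq (Φ : SpPath n) :
    (maslovIndex Φ : ℝ) = rotationNumber Φ - height (Φ 1) + height (Φ 0) :=
  (exists_int_index Φ).choose_spec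

theorem exists_pos_le_angleHeight (M : Sp n) :
    ∃ ε : ℝ, 0 < ε ∧ ∀ w ∈ normalizedFirstKind M, ε ≤ Real.pi * angleHeight w := by
  have key : ∀ s : Multiset ℂ, ∃ ε : ℝ, 0 < ε ∧ ∀ w ∈ s, ε ≤ Real.pi * angleHeight w := by
    intro s
    induction s using Multiset.induction_on with
    | empty => exact ⟨1, one_pos, by simp⟩
    | cons w s ih =>
      obtain ⟨ε, h0, h⟩ := ih
      refine ⟨min ε (Real.pi * angleHeight w),
        lt_min h0 (mul_pos Real.pi_pos (angleHeight_pos w)), fun v hv => ?_⟩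
      rcases Multiset.mem_cons.1 hv with rfl | hv
      · exact min_le_right _ _
      · exact (min_le_left _ _).trans (h v hv)
  exact key _

theorem height_eq_sum {M : Sp n} {a : Fin n → ℝ}
    (h : Multiset.map (fun j => expI (a j)) Finset.univ.val = normalizedFirstKind M) :
    height M = ∑ j, angleHeight (expI (a j)) := by
  rw [height, ← h, Multiset.map_map]
  rfl

/-- The perturbed normal forms avoid the degenerate cycle, and their angles are known. -/
theorem perturbed_normalForm {M : Sp n} {a : Fin n → ℝ} {ε θ : ℝ}
    (h : Multiset.map (fun j => expI (a j)) Finset.univ.val = normalizedFirstKind M)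
    (hε : ∀ w ∈ normalizedFirstKind M, ε ≤ Real.pi * angleHeight w) (h0 : 0 ≤ θ) (hθ : θ < ε) :
    (0 < θ → rot (fun j => a j - θ) ∉ cycle n) ∧
    (rot (fun j => a j - θ) ∉ cycle n →
      ∑ j, Int.fract ((a j - θ) / Real.pi) = height M - n * (θ / Real.pi)) := by
  have hlt : ∀ j, θ < Real.pi * angleHeight (expI (a j)) := fun j =>
    hθ.trans_le (hε _ (h ▸ Multiset.mem_map_of_mem (fun j => expI (a j)) (Finset.mem_univ_val j)))
  refine ⟨fun h1 h2 => ?_, fun h1 => ?_⟩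
  · obtain ⟨j, hj⟩ := rot_mem_cycle_iff.1 h2
    exact sin_sub_ne_zero h1 (hlt j) hj
  · rw [height_eq_sum h, Finset.sum_congr rfl fun j _ => fract_sub_div_pi h0 (hlt j)
      fun hj => h1 (rot_mem_cycle_iff.2 ⟨j, hj⟩), Finset.sum_sub_distrib]
    simp

theorem perturb_apply_rot (θ : ℝ) {Ψ : SpPath n} {t : I} {a : Fin n → ℝ} (h : Ψ t = rot a) :
    perturb θ Ψ t = rot fun j => a j - θ := by
  change rotation n θ * Ψ t = _
  rw [rotation_eq, h, rot_mul_rot]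
  congr 1
  ext j
  simp [sub_eq_neg_add]

theorem maslovIndex_construction (Φ : SpPath n) : ∃ ε : ℝ, 0 < ε ∧ ∀ θ : ℝ, 0 ≤ θ → θ < ε →
    ∀ Ψ, IsOrthogonalization Φ Ψ →
      (0 < θ → perturb θ Ψ 0 ∉ cycle n ∧ perturb θ Ψ 1 ∉ cycle n) ∧
      (perturb θ Ψ 0 ∉ cycle n → perturb θ Ψ 1 ∉ cycle n →
        (∃ β, IsExtension (perturb θ Ψ) β) ∧
        ∀ β, IsExtension (perturb θ Ψ) β → ∃ d₁ d₂ : ℝ,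
          HasRotationNumber (perturb θ Ψ) d₁ ∧ HasRotationNumber β d₂ ∧
          (maslovIndex Φ : ℝ) = d₁ + d₂) := by
  obtain ⟨ε₀, hε₀, h₀⟩ := exists_pos_le_angleHeight (Φ 0)
  obtain ⟨ε₁, hε₁, h₁⟩ := exists_pos_le_angleHeight (Φ 1)
  refine ⟨min ε₀ ε₁, lt_min hε₀ hε₁, fun θ hθ0 hθ Ψ hΨ => ?_⟩
  obtain ⟨a, ha, hna⟩ := hΨ.2.1
  obtain ⟨b, hb, hnb⟩ := hΨ.2.2.2.1
  have ha' : Ψ 0 = rot a := Subtype.ext ha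
  have hb' : Ψ 1 = rot b := Subtype.ext hb
  obtain ⟨a1, a2⟩ := perturbed_normalForm hna h₀ hθ0 (hθ.trans_le (min_le_left _ _))
  obtain ⟨b1, b2⟩ := perturbed_normalForm hnb h₁ hθ0 (hθ.trans_le (min_le_right _ _))
  have ha'' := perturb_apply_rot θ ha'
  have hb'' := perturb_apply_rot θ hb'
  refine ⟨fun h => ⟨ha'' ▸ a1 h, hb'' ▸ b1 h⟩, fun hca hcb =>
    ⟨exists_isExtension ha'' hb'' hca hcb, fun β hβ =>
      ⟨_, _, hasRotationNumber _, hasRotationNumber _, ?_⟩⟩⟩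
  rw [ha''] at hca
  rw [hb''] at hcb
  rw [hβ.rotationNumber_eq ha'' hb'', a2 hca, b2 hcb, rotationNumber_perturb θ ha' hb',
    hΨ.rotationNumber_eq, maslovIndex_eq]
  ring

theorem maslovIndex_homotopic {Φ Ψ : SpPath n} (h : ContinuousMap.HomotopicRel Φ Ψ {0, 1}) :
    maslovIndex Φ = maslovIndex Ψ := by
  have h0 : Φ 0 = Ψ 0 := by
    obtain ⟨H⟩ := h
    exact (H.eq_fst 0 (x := 0) (by simp)).symm.trans (H.eq_snd 0 (by simp))
  have h1 : Φ 1 = Ψ 1 := by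
    obtain ⟨H⟩ := h
    exact (H.eq_fst 0 (x := 1) (by simp)).symm.trans (H.eq_snd 0 (by simp))
  have : (maslovIndex Φ : ℝ) = maslovIndex Ψ := by
    rw [maslovIndex_eq, maslovIndex_eq, rotationNumber_homotopic h, h0, h1]
  exact_mod_cast this

theorem maslovIndex_catenation (Φ : SpPath n) {a : ℝ} (h0 : 0 < a) (h1 : a < 1) :
    maslovIndex Φ = maslovIndex (piece Φ 0 a) + maslovIndex (piece Φ a 1) := by
  have key := rotationNumber_piece_add Φ 0 ⟨a, h0.le, h1.le⟩ 1
  simp only [Set.Icc.coe_zero, Set.Icc.coe_one, piece_zero_one] at key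
  have e0 : piece Φ 0 a 0 = Φ 0 := piece_apply Φ 0 0 (by simp)
  have e1 : piece Φ 0 a 1 = Φ ⟨a, h0.le, h1.le⟩ := piece_apply Φ 1 _ (by simp)
  have e2 : piece Φ a 1 0 = Φ ⟨a, h0.le, h1.le⟩ := piece_apply Φ 0 _ (by simp)
  have e3 : piece Φ a 1 1 = Φ 1 := piece_apply Φ 1 1 (by simp)
  have : (maslovIndex Φ : ℝ) = maslovIndex (piece Φ 0 a) + maslovIndex (piece Φ a 1) := by
    rw [maslovIndex_eq, maslovIndex_eq, maslovIndex_eq, e0, e1, e2, e3, ← key]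
    ring
  exact_mod_cast this

theorem maslovIndex_directSum {n₁ n₂ : ℕ} {Φ : SpPath n} {Φ₁ : SpPath n₁} {Φ₂ : SpPath n₂}
    {L₁ : (Fin n₁ ⊕ Fin n₁ → ℂ) →ₗ[ℂ] (Fin n ⊕ Fin n → ℂ)}
    {L₂ : (Fin n₂ ⊕ Fin n₂ → ℂ) →ₗ[ℂ] (Fin n ⊕ Fin n → ℂ)}
    (h : ∀ t, IsDirectSum (Φ t) (Φ₁ t) (Φ₂ t) L₁ L₂) :
    maslovIndex Φ = maslovIndex Φ₁ + maslovIndex Φ₂ := by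
  have hh : ∀ t, height (Φ t) = height (Φ₁ t) + height (Φ₂ t) := fun t => by
    rw [height, (h t).normalizedFirstKind_eq, Multiset.map_add, Multiset.sum_add]
    rfl
  obtain ⟨α₁, hα₁, hd₁⟩ := hasRotationNumber Φ₁
  obtain ⟨α₂, hα₂, hd₂⟩ := hasRotationNumber Φ₂
  have hr : HasRotationNumber Φ (rotationNumber Φ₁ + rotationNumber Φ₂) := by
    refine ⟨α₁ + α₂, fun t => ?_, ?_⟩
    · rw [(h t).rho_eq, hα₁, hα₂, ← Complex.exp_add, ContinuousMap.add_apply]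
      congr 1
      push_cast
      ring
    · rw [← hd₁, ← hd₂, ContinuousMap.add_apply, ContinuousMap.add_apply]
      ring
  have : (maslovIndex Φ : ℝ) = maslovIndex Φ₁ + maslovIndex Φ₂ := by
    rw [maslovIndex_eq, maslovIndex_eq, maslovIndex_eq, hr.eq, hh, hh]
    ring
  exact_mod_cast this

end MaslovType

end

/-- The Maslov-type index of paths of symplectic matrices: it is an integer, given by
`μ(Φ) = Δ(Φ^#_θ) + Δ(β)` for every orthogonalization `Φ^#`, every sufficiently small perturbation
angle `θ` and every extension `β`; it is homotopy invariant, additive under catenation, and additive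
for symplectic direct sums. -/
theorem theorem1p1 :
    ∃ μ : (n : ℕ) → MaslovType.SpPath n → ℤ,
      -- the construction can be carried out, and its result does not depend on the choices
      (∀ (n : ℕ) (Φ : MaslovType.SpPath n),
        (∃ Ψ, MaslovType.IsOrthogonalization Φ Ψ) ∧
        ∃ ε : ℝ, 0 < ε ∧ ∀ θ : ℝ, 0 ≤ θ → θ < ε →
          ∀ Ψ, MaslovType.IsOrthogonalization Φ Ψ →
            (0 < θ → MaslovType.perturb θ Ψ 0 ∉ MaslovType.cycle n ∧
              MaslovType.perturb θ Ψ 1 ∉ MaslovType.cycle n) ∧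
            (MaslovType.perturb θ Ψ 0 ∉ MaslovType.cycle n →
              MaslovType.perturb θ Ψ 1 ∉ MaslovType.cycle n →
              (∃ β, MaslovType.IsExtension (MaslovType.perturb θ Ψ) β) ∧
              ∀ β, MaslovType.IsExtension (MaslovType.perturb θ Ψ) β →
                ∃ d₁ d₂ : ℝ,
                  MaslovType.HasRotationNumber (MaslovType.perturb θ Ψ) d₁ ∧
                  MaslovType.HasRotationNumber β d₂ ∧
                  (μ n Φ : ℝ) = d₁ + d₂)) ∧
      -- invariance under homotopy with fixed endpoints
      (∀ (n : ℕ) (Φ Ψ : MaslovType.SpPath n),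
        ContinuousMap.HomotopicRel Φ Ψ {0, 1} → μ n Φ = μ n Ψ) ∧
      -- catenation
      (∀ (n : ℕ) (Φ : MaslovType.SpPath n) (a : ℝ), 0 < a → a < 1 →
        μ n Φ = μ n (MaslovType.piece Φ 0 a) + μ n (MaslovType.piece Φ a 1)) ∧
      -- symplectic direct sums: `ℝ²ⁿ` is the direct sum of the `ω₀`-orthogonal subspaces `V₁`, `V₂`,
      -- `Eⱼ` are any linear symplectic coordinates on `Vⱼ`, and `Φⱼ` is the path of `Sp(Vⱼ)`
      -- written in these coordinates
      (∀ (n n₁ n₂ : ℕ) (V₁ V₂ : Submodule ℝ (Fin n ⊕ Fin n → ℝ)),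
        IsCompl V₁ V₂ →
        (∀ x ∈ V₁, ∀ y ∈ V₂, MaslovType.omega0 x y = 0) →
        ∀ (E₁ : V₁ ≃ₗ[ℝ] (Fin n₁ ⊕ Fin n₁ → ℝ)) (E₂ : V₂ ≃ₗ[ℝ] (Fin n₂ ⊕ Fin n₂ → ℝ)),
        (∀ x y : V₁, MaslovType.omega0 (E₁ x) (E₁ y) =
          MaslovType.omega0 (x : Fin n ⊕ Fin n → ℝ) (y : Fin n ⊕ Fin n → ℝ)) →
        (∀ x y : V₂, MaslovType.omega0 (E₂ x) (E₂ y) =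
          MaslovType.omega0 (x : Fin n ⊕ Fin n → ℝ) (y : Fin n ⊕ Fin n → ℝ)) →
        ∀ (Φ : MaslovType.SpPath n) (Φ₁ : MaslovType.SpPath n₁) (Φ₂ : MaslovType.SpPath n₂),
        (∀ t, ∀ x : V₁,
          (Φ t : Matrix (Fin n ⊕ Fin n) (Fin n ⊕ Fin n) ℝ) *ᵥ (x : Fin n ⊕ Fin n → ℝ) =
            (E₁.symm ((Φ₁ t : Matrix (Fin n₁ ⊕ Fin n₁) (Fin n₁ ⊕ Fin n₁) ℝ) *ᵥ E₁ x) :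
              Fin n ⊕ Fin n → ℝ)) →
        (∀ t, ∀ x : V₂,
          (Φ t : Matrix (Fin n ⊕ Fin n) (Fin n ⊕ Fin n) ℝ) *ᵥ (x : Fin n ⊕ Fin n → ℝ) =
            (E₂.symm ((Φ₂ t : Matrix (Fin n₂ ⊕ Fin n₂) (Fin n₂ ⊕ Fin n₂) ℝ) *ᵥ E₂ x) :
              Fin n ⊕ Fin n → ℝ)) →
        μ n Φ = μ n₁ Φ₁ + μ n₂ Φ₂) := by
  refine ⟨fun n Φ => MaslovType.maslovIndex Φ, fun n Φ =>
    ⟨MaslovType.exists_isOrthogonalization Φ, MaslovType.maslovIndex_construction Φ⟩,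
    fun n Φ Ψ h => MaslovType.maslovIndex_homotopic h,
    fun n Φ a h0 h1 => MaslovType.maslovIndex_catenation Φ h0 h1, ?_⟩
  intro n n₁ n₂ V₁ V₂ hV hortho E₁ E₂ hE₁ hE₂ Φ Φ₁ Φ₂ hΦ₁ hΦ₂
  refine MaslovType.maslovIndex_directSum fun t => MaslovType.isDirectSum_complexify
    (f₁ := V₁.subtype ∘ₗ E₁.symm.toLinearMap) (f₂ := V₂.subtype ∘ₗ E₂.symm.toLinearMap)
    (fun x y => ?_) (fun x y => ?_) (fun x y => hortho _ (E₁.symm x).2 _ (E₂.symm y).2)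
    (fun v => ?_) (fun x => ?_) (fun x => ?_)
  · have h := hE₁ (E₁.symm x) (E₁.symm y)
    rw [E₁.apply_symm_apply, E₁.apply_symm_apply] at h
    exact h.symm
  · have h := hE₂ (E₂.symm x) (E₂.symm y)
    rw [E₂.apply_symm_apply, E₂.apply_symm_apply] at h
    exact h.symm
  · obtain ⟨x, hx, y, hy, rfl⟩ := Submodule.mem_sup.1 (hV.sup_eq_top ▸ Submodule.mem_top (x := v))
    exact ⟨E₁ ⟨x, hx⟩, E₂ ⟨y, hy⟩, by simp⟩
  · have h := hΦ₁ t (E₁.symm x)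
    rw [E₁.apply_symm_apply] at h
    exact h
  · have h := hΦ₂ t (E₂.symm x)
    rw [E₂.apply_symm_apply] at h
    exact h
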